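/- Let $n,m\ge 2$ be integers and let $q\in\mathbb C$ with $|q|=1$. Let $\mathcal E_{n,m}^q$ be the universal unital $C^*$-algebra generated by $s_1,\dots,s_n,t_1,\dots,t_m$ subject to the relations \[ s_i^*s_j=\delta_{ij}\mathbf 1,\qquad t_r^*t_l=\delta_{rl}\mathbf 1,\qquad s_j^*t_r=q\,t_rs_j^* \qquad(1\le i,j\le n,\ 1\le r,l\le m). \] Put $Q=\sum_{j=1}^n s_js_j^*$ and $P=\sum_{r=1}^m t_rt_r^*$. Let $\mathcal I_q$, $\mathcal I_1^q$, $\mathcal I_2^q$ and $\mathcal M_q$ be the closed two-sided ideals of $\mathcal E_{n,m}^q$ generated by $(\mathbf 1-Q)(\mathbf 1-P)$, by $\mathbf 1-Q$, by $\mathbf 1-P$, and by $\{\mathbf 1-Q,\mathbf 1-P\}$, respectively. Then: 1. The nontrivial (that is, nonzero and proper) closed two-sided ideals of $\mathcal E_{n,m}^q$ are exactly the four ideals $\mathcal I_q$, $\mathcal I_1^q$, $\mathcal I_2^q$, $\mathcal M_q$, and these are pairwise distinct. Moreover $\mathcal M_q=\mathcal I_1^q+\mathcal I_2^q$. 2.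 Every nontrivial closed two-sided ideal of $\mathcal E_{n,m}^q$ is essential, that is, it has nonzero intersection with every nonzero closed two-sided ideal. 3. $\mathcal I_q$ is $*$-isomorphic to the $C^*$-algebra $\mathbb K$ of compact operators on a separable infinite-dimensional Hilbert space, and $\mathcal I_q$ is the unique minimal ideal, that is, the unique minimal element among the nonzero closed two-sided ideals of $\mathcal E_{n,m}^q$. -/

import Mathlib

open scoped Pointwise

noncomputable section

namespace TwistedCuntz

/-! ### The defining relations -/

/-- The defining relations of the `q`-twist of two Cuntz-Toeplitz algebras:
`s i` and `t r` are families of isometries, each with pairwise orthogonal ranges, and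
`(s j)⋆ (t r) = q (t r) (s j)⋆`. -/
structure Relations {n m : ℕ} (q : ℂ) {B : Type*} [Ring B] [StarRing B] [Algebra ℂ B]
    (s : Fin n → B) (t : Fin m → B) : Prop where
  star_s_mul_s : ∀ i j, star (s i) * s j = if i = j then 1 else 0
  star_t_mul_t : ∀ r l, star (t r) * t l = if r = l then 1 else 0
  star_s_mul_t : ∀ j r, star (s j) * t r = q • (t r * star (s j))

/-! ### The free unital `*`-algebra on `n + m` generators -/

/-- The letters: generators (`inl`) and their formal adjoints (`inr`). -/
abbrev Letter (n m : ℕ) : Type := (Fin n ⊕ Fin m) ⊕ (Fin n ⊕ Fin m)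

/-- The free unital complex `*`-algebra on generators `s₁, …, sₙ, t₁, …, tₘ`. The parameter `q`
only serves to carry the seminorm `‖·‖` that is defined below. -/
def FreeStar (n m : ℕ) (_q : ℂ) : Type := FreeAlgebra ℂ (Letter n m)

namespace FreeStar

variable {n m : ℕ} {q : ℂ}

instance : Ring (FreeStar n m q) := inferInstanceAs (Ring (FreeAlgebra ℂ (Letter n m)))
instance : Algebra ℂ (FreeStar n m q) :=
  inferInstanceAs (Algebra ℂ (FreeAlgebra ℂ (Letter n m)))

/-- The letter `y` as an element of the free `*`-algebra. -/
def letter (y : Letter n m) : FreeStar n m q := FreeAlgebra.ι ℂ y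

theorem induction {C : FreeStar n m q → Prop} (h0 : ∀ c : ℂ, C (algebraMap ℂ _ c))
    (h1 : ∀ y, C (letter y)) (hm : ∀ a b, C a → C b → C (a * b))
    (ha : ∀ a b, C a → C b → C (a + b)) (a : FreeStar n m q) : C a :=
  FreeAlgebra.induction (R := ℂ) (X := Letter n m) (motive := C) h0 h1 hm ha a

/-- The involution as a ring homomorphism into the opposite ring: conjugate-linear, and
interchanging each generator with its formal adjoint. -/
def starHom : FreeStar n m q →+* (FreeStar n m q)ᵐᵒᵖ :=
  letI : Algebra ℂ (FreeStar n m q)ᵐᵒᵖ :=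
    Algebra.compHom (FreeStar n m q)ᵐᵒᵖ (starRingEnd ℂ)
  (FreeAlgebra.lift ℂ (fun y : Letter n m =>
    MulOpposite.op (letter y.swap : FreeStar n m q))).toRingHom

theorem starHom_letter (y : Letter n m) :
    starHom (letter y : FreeStar n m q) = MulOpposite.op (letter y.swap) := by
  let : Algebra ℂ (FreeStar n m q)ᵐᵒᵖ :=
    Algebra.compHom (FreeStar n m q)ᵐᵒᵖ (starRingEnd ℂ)
  exact FreeAlgebra.lift_ι_apply (R := ℂ)
    (fun y : Letter n m => MulOpposite.op (letter y.swap : FreeStar n m q)) y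

theorem starHom_algebraMap (c : ℂ) :
    starHom (algebraMap ℂ (FreeStar n m q) c) =
      MulOpposite.op (algebraMap ℂ (FreeStar n m q) (starRingEnd ℂ c)) := by
  let : Algebra ℂ (FreeStar n m q)ᵐᵒᵖ :=
    Algebra.compHom (FreeStar n m q)ᵐᵒᵖ (starRingEnd ℂ)
  exact AlgHom.commutes (FreeAlgebra.lift ℂ (fun y : Letter n m =>
    MulOpposite.op (letter y.swap : FreeStar n m q))) c

instance : StarRing (FreeStar n m q) where
  star x := (starHom x).unop
  star_involutive x := by
    change (starHom (starHom x).unop).unop = x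
    induction x using FreeStar.induction with
    | h0 c => simp [starHom_algebraMap]
    | h1 y => simp [starHom_letter]
    | hm a b ha hb => simp [ha, hb]
    | ha a b ha hb => simp [ha, hb]
  star_mul a b := by simp
  star_add a b := by simp

@[simp] theorem star_letter (y : Letter n m) :
    star (letter y : FreeStar n m q) = letter y.swap :=
  congrArg MulOpposite.unop (starHom_letter y)

@[simp] theorem star_algebraMap (c : ℂ) :
    star (algebraMap ℂ (FreeStar n m q) c) = algebraMap ℂ _ (star c) :=
  congrArg MulOpposite.unop (starHom_algebraMap c)

instance : StarModule ℂ (FreeStar n m q) where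
  star_smul c a := by
    rw [Algebra.smul_def, star_mul, star_algebraMap, Algebra.smul_def, Algebra.commutes]

/-- Evaluation of a noncommutative `*`-polynomial at a tuple of elements of a `*`-algebra. -/
def eval {B : Type*} [Ring B] [StarRing B] [Algebra ℂ B] (s : Fin n → B) (t : Fin m → B) :
    FreeStar n m q →ₐ[ℂ] B :=
  FreeAlgebra.lift ℂ (Sum.elim (Sum.elim s t) (Sum.elim (star s) (star t)))

@[simp] theorem eval_letter {B : Type*} [Ring B] [StarRing B] [Algebra ℂ B]
    (s : Fin n → B) (t : Fin m → B) (y : Letter n m) :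
    eval s t (letter y : FreeStar n m q) =
      Sum.elim (Sum.elim s t) (Sum.elim (star s) (star t)) y :=
  FreeAlgebra.lift_ι_apply (R := ℂ) _ y

theorem eval_star {B : Type*} [Ring B] [StarRing B] [Algebra ℂ B] [StarModule ℂ B]
    (s : Fin n → B) (t : Fin m → B) (x : FreeStar n m q) :
    eval s t (star x) = star (eval s t x) := by
  induction x using FreeStar.induction with
  | h0 c => rw [star_algebraMap, AlgHom.commutes, AlgHom.commutes, algebraMap_star_comm]
  | h1 y => rcases y with (y | y) | (y | y) <;> simp
  | hm a b ha hb => simp [ha, hb]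
  | ha a b ha hb => simp [ha, hb]

/-! ### The universal `C⋆`-seminorm -/

/-- The values `‖x(s, t)‖`, for all tuples `(s, t)` in a unital `C⋆`-algebra that satisfy the
relations. (A `C⋆`-algebra generated by finitely many elements is separable, hence it has a copy
in `Type`.) -/
def values (x : FreeStar n m q) : Set ℝ :=
  {c | ∃ (B : Type) (_ : CStarAlgebra B) (s : Fin n → B) (t : Fin m → B),
    Relations q s t ∧ c = ‖eval s t x‖}

theorem norm_one_le {B : Type*} [CStarAlgebra B] : ‖(1 : B)‖ ≤ 1 := by
  have h := CStarRing.norm_star_mul_self (x := (1 : B))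
  rw [star_one, one_mul] at h
  nlinarith [norm_nonneg (1 : B)]

theorem norm_le_one_of_star_mul_self {B : Type*} [CStarAlgebra B] {b : B}
    (h : star b * b = 1) : ‖b‖ ≤ 1 := by
  have h' := CStarRing.norm_star_mul_self (x := b)
  rw [h] at h'
  nlinarith [norm_nonneg b, norm_one_le (B := B)]

theorem norm_letter_le {B : Type*} [CStarAlgebra B] {s : Fin n → B} {t : Fin m → B}
    (h : Relations q s t) (y : Letter n m) : ‖eval s t (letter y : FreeStar n m q)‖ ≤ 1 := by
  have hs : ∀ i, ‖s i‖ ≤ 1 := fun i =>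
    norm_le_one_of_star_mul_self (by simpa using h.star_s_mul_s i i)
  have ht : ∀ r, ‖t r‖ ≤ 1 := fun r =>
    norm_le_one_of_star_mul_self (by simpa using h.star_t_mul_t r r)
  rcases y with (y | y) | (y | y) <;> simp [hs, ht]

theorem exists_bound (x : FreeStar n m q) : ∃ C : ℝ, ∀ (B : Type) (_ : CStarAlgebra B)
    (s : Fin n → B) (t : Fin m → B), Relations q s t → ‖eval s t x‖ ≤ C := by
  induction x using FreeStar.induction with
  | h0 c =>
    refine ⟨‖c‖, fun B _ s t _ => ?_⟩
    rw [AlgHom.commutes, norm_algebraMap]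
    nlinarith [norm_nonneg c, norm_one_le (B := B)]
  | h1 y => exact ⟨1, fun B _ s t h => norm_letter_le h y⟩
  | hm a b ha hb =>
    obtain ⟨C, hC⟩ := ha
    obtain ⟨D, hD⟩ := hb
    refine ⟨C * D, fun B _ s t h => ?_⟩
    rw [map_mul]
    exact (norm_mul_le _ _).trans (mul_le_mul (hC B _ s t h) (hD B _ s t h) (norm_nonneg _)
      ((norm_nonneg _).trans (hC B _ s t h)))
  | ha a b ha hb =>
    obtain ⟨C, hC⟩ := ha
    obtain ⟨D, hD⟩ := hb
    refine ⟨C + D, fun B _ s t h => ?_⟩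
    rw [map_add]
    exact (norm_add_le _ _).trans (add_le_add (hC B _ s t h) (hD B _ s t h))

theorem bddAbove_values (x : FreeStar n m q) : BddAbove (values x) := by
  obtain ⟨C, hC⟩ := exists_bound x
  refine ⟨C, ?_⟩
  rintro _ ⟨B, _, s, t, h, rfl⟩
  exact hC B _ s t h

/-- The universal `C⋆`-seminorm: the supremum of `‖x(s, t)‖` over all tuples `(s, t)` in unital
`C⋆`-algebras that satisfy the relations. -/
def uNorm (x : FreeStar n m q) : ℝ := sSup (values x)

theorem norm_eval_le {B : Type} [CStarAlgebra B] {s : Fin n → B} {t : Fin m → B}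
    (h : Relations q s t) (x : FreeStar n m q) : ‖eval s t x‖ ≤ uNorm x :=
  le_csSup (bddAbove_values x) ⟨B, _, s, t, h, rfl⟩

theorem uNorm_nonneg (x : FreeStar n m q) : 0 ≤ uNorm x := by
  refine Real.sSup_nonneg ?_
  rintro _ ⟨B, _, s, t, h, rfl⟩
  exact norm_nonneg _

theorem uNorm_le {x : FreeStar n m q} {c : ℝ} (hc : 0 ≤ c)
    (h : ∀ (B : Type) (_ : CStarAlgebra B) (s : Fin n → B) (t : Fin m → B),
      Relations q s t → ‖eval s t x‖ ≤ c) : uNorm x ≤ c := by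
  refine Real.sSup_le ?_ hc
  rintro _ ⟨B, _, s, t, hr, rfl⟩
  exact h B _ s t hr

theorem uNorm_add_le (x y : FreeStar n m q) : uNorm (x + y) ≤ uNorm x + uNorm y :=
  uNorm_le (add_nonneg (uNorm_nonneg x) (uNorm_nonneg y)) fun B _ s t h => by
    rw [map_add]
    exact (norm_add_le _ _).trans (add_le_add (norm_eval_le h x) (norm_eval_le h y))

theorem uNorm_mul_le (x y : FreeStar n m q) : uNorm (x * y) ≤ uNorm x * uNorm y :=
  uNorm_le (mul_nonneg (uNorm_nonneg x) (uNorm_nonneg y)) fun B _ s t h => by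
    rw [map_mul]
    exact (norm_mul_le _ _).trans
      (mul_le_mul (norm_eval_le h x) (norm_eval_le h y) (norm_nonneg _) (uNorm_nonneg x))

theorem uNorm_smul_le (c : ℂ) (x : FreeStar n m q) : uNorm (c • x) ≤ ‖c‖ * uNorm x :=
  uNorm_le (mul_nonneg (norm_nonneg c) (uNorm_nonneg x)) fun B _ s t h => by
    rw [map_smul, norm_smul]
    exact mul_le_mul_of_nonneg_left (norm_eval_le h x) (norm_nonneg c)

theorem uNorm_neg (x : FreeStar n m q) : uNorm (-x) = uNorm x := by
  simp only [uNorm, values, map_neg, norm_neg]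

theorem uNorm_zero : uNorm (0 : FreeStar n m q) = 0 :=
  le_antisymm (uNorm_le le_rfl fun B _ s t _ => by simp) (uNorm_nonneg 0)

theorem uNorm_star (x : FreeStar n m q) : uNorm (star x) = uNorm x := by
  simp only [uNorm, values, eval_star, norm_star]

theorem uNorm_mul_self_le (x : FreeStar n m q) : uNorm x * uNorm x ≤ uNorm (star x * x) := by
  have h : uNorm x ≤ Real.sqrt (uNorm (star x * x)) :=
    uNorm_le (Real.sqrt_nonneg _) fun B _ s t h => by
      refine Real.le_sqrt_of_sq_le ?_
      have h2 := norm_eval_le h (star x * x)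
      rwa [map_mul, eval_star, CStarRing.norm_star_mul_self, ← sq] at h2
  calc uNorm x * uNorm x
      ≤ Real.sqrt (uNorm (star x * x)) * Real.sqrt (uNorm (star x * x)) :=
        mul_le_mul h h (uNorm_nonneg x) (Real.sqrt_nonneg _)
    _ = uNorm (star x * x) := Real.mul_self_sqrt (uNorm_nonneg _)

/-- The universal seminorm as a seminorm on the additive group. -/
def uSeminorm : AddGroupSeminorm (FreeStar n m q) where
  toFun := uNorm
  map_zero' := uNorm_zero
  add_le' := uNorm_add_le
  neg' := uNorm_neg

instance : Norm (FreeStar n m q) := ⟨uNorm⟩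

instance : PseudoMetricSpace (FreeStar n m q) :=
  (AddGroupSeminorm.toSeminormedAddCommGroup uSeminorm).toPseudoMetricSpace

instance : SeminormedRing (FreeStar n m q) where
  dist_eq _ _ := (AddGroupSeminorm.toSeminormedAddCommGroup uSeminorm).dist_eq _ _
  norm_mul_le := uNorm_mul_le

theorem norm_def (x : FreeStar n m q) : ‖x‖ = uNorm x := rfl

instance : NormedAlgebra ℂ (FreeStar n m q) where
  norm_smul_le := uNorm_smul_le

instance : NormedStarGroup (FreeStar n m q) where
  norm_star_le x := (uNorm_star x).le

end FreeStar

/-! ### The universal `C⋆`-algebra -/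

open UniformSpace

/-- The universal unital `C⋆`-algebra `𝓔` generated by `s₁, …, sₙ, t₁, …, tₘ` subject to
`Relations q s t`: the Hausdorff completion of the free `*`-algebra in the universal
`C⋆`-seminorm. -/
def E (n m : ℕ) (q : ℂ) : Type := Completion (FreeStar n m q)

namespace E

variable {n m : ℕ} {q : ℂ}

instance : NormedRing (E n m q) := inferInstanceAs (NormedRing (Completion (FreeStar n m q)))
instance : CompleteSpace (E n m q) :=
  inferInstanceAs (CompleteSpace (Completion (FreeStar n m q)))
instance : Algebra ℂ (E n m q) :=
  inferInstanceAs (Algebra ℂ (Completion (FreeStar n m q)))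
instance : NormedAlgebra ℂ (E n m q) where
  norm_smul_le := norm_smul_le (α := ℂ) (β := Completion (FreeStar n m q))

/-- The canonical map of the free `*`-algebra into `𝓔`. -/
def of : FreeStar n m q →ₐ[ℂ] E n m q where
  __ := (Completion.coeRingHom : FreeStar n m q →+* Completion (FreeStar n m q))
  commutes' _ := rfl

theorem norm_of (x : FreeStar n m q) : ‖of x‖ = FreeStar.uNorm x := Completion.norm_coe x

theorem denseRange_of : DenseRange (of : FreeStar n m q → E n m q) := Completion.denseRange_coe

theorem continuous_of : Continuous (of : FreeStar n m q → E n m q) := Completion.continuous_coe _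

theorem uniformContinuous_star : UniformContinuous (star : FreeStar n m q → FreeStar n m q) :=
  (starₗᵢ ℂ : FreeStar n m q ≃ₗᵢ⋆[ℂ] FreeStar n m q).isometry.uniformContinuous

instance : Star (E n m q) :=
  ⟨Completion.map (star : FreeStar n m q → FreeStar n m q)⟩

theorem star_of (x : FreeStar n m q) : star (of x) = of (star x) :=
  Completion.map_coe uniformContinuous_star x

theorem continuous_star' : Continuous (star : E n m q → E n m q) := Completion.continuous_map

instance : StarRing (E n m q) where
  star_involutive x := denseRange_of.induction_on x
    (isClosed_eq (continuous_star'.comp continuous_star') continuous_id)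
    fun a => by rw [star_of, star_of, star_star]
  star_mul x y := denseRange_of.induction_on₂
    (isClosed_eq (continuous_star'.comp continuous_mul)
      ((continuous_star'.comp continuous_snd).mul (continuous_star'.comp continuous_fst)))
    (fun a b => by rw [← map_mul, star_of, star_mul, map_mul, star_of, star_of]) x y
  star_add x y := denseRange_of.induction_on₂
    (isClosed_eq (continuous_star'.comp continuous_add)
      ((continuous_star'.comp continuous_fst).add (continuous_star'.comp continuous_snd)))
    (fun a b => by rw [← map_add, star_of, star_add, map_add, star_of, star_of]) x y

instance : CStarRing (E n m q) where
  norm_mul_self_le x := denseRange_of.induction_on x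
    (isClosed_le (continuous_norm.mul continuous_norm)
      (continuous_norm.comp (continuous_star'.mul continuous_id)))
    fun a => by
      rw [star_of, ← map_mul, norm_of, norm_of]
      exact FreeStar.uNorm_mul_self_le a

instance : StarModule ℂ (E n m q) where
  star_smul c x := denseRange_of.induction_on x
    (isClosed_eq (continuous_star'.comp (continuous_const_smul c))
      ((continuous_const_smul (star c)).comp continuous_star'))
    fun a => by rw [← map_smul, star_of, star_smul, map_smul, star_of]

instance : CStarAlgebra (E n m q) where

variable (n m q)

/-- The generators `s₁, …, sₙ` of `𝓔`. -/
def s (i : Fin n) : E n m q := of (FreeStar.letter (Sum.inl (Sum.inl i)))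

/-- The generators `t₁, …, tₘ` of `𝓔`. -/
def t (r : Fin m) : E n m q := of (FreeStar.letter (Sum.inl (Sum.inr r)))

/-- `Q = ∑ sᵢ sᵢ⋆`. -/
def Q : E n m q := ∑ i, s n m q i * star (s n m q i)

/-- `P = ∑ tᵣ tᵣ⋆`. -/
def P : E n m q := ∑ r, t n m q r * star (t n m q r)

end E

/-! ### Ideals -/

/-- The closed two-sided ideal of a topological ring generated by a set: the smallest closed
two-sided ideal that contains it. -/
def closedIdeal {A : Type*} [NormedRing A] (X : Set A) : TwoSidedIdeal A :=
  sInf {J | IsClosed (J : Set A) ∧ X ⊆ J}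

/-- A nontrivial closed two-sided ideal: nonzero and proper. -/
structure IsNontrivialClosedIdeal {A : Type*} [NormedRing A] (J : TwoSidedIdeal A) : Prop where
  isClosed : IsClosed (J : Set A)
  ne_bot : J ≠ ⊥
  ne_top : J ≠ ⊤

/-- A closed two-sided ideal is essential if it has nonzero intersection with every nonzero closed
two-sided ideal. -/
def IsEssential {A : Type*} [NormedRing A] (J : TwoSidedIdeal A) : Prop :=
  ∀ K : TwoSidedIdeal A, IsClosed (K : Set A) → K ≠ ⊥ → J ⊓ K ≠ ⊥

/-- A minimal ideal: minimal among the nonzero closed two-sided ideals. -/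
def IsMinimalClosedIdeal {A : Type*} [NormedRing A] (J : TwoSidedIdeal A) : Prop :=
  Minimal (fun K : TwoSidedIdeal A => IsClosed (K : Set A) ∧ K ≠ ⊥) J

section Ideals

variable (n m : ℕ) (q : ℂ)

/-- The closed ideal generated by `(1 - Q)(1 - P)`. -/
def idealI : TwoSidedIdeal (E n m q) := closedIdeal {(1 - E.Q n m q) * (1 - E.P n m q)}

/-- The closed ideal generated by `1 - Q`. -/
def idealI₁ : TwoSidedIdeal (E n m q) := closedIdeal {1 - E.Q n m q}

/-- The closed ideal generated by `1 - P`. -/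
def idealI₂ : TwoSidedIdeal (E n m q) := closedIdeal {1 - E.P n m q}

/-- The closed ideal generated by `1 - Q` and `1 - P`. -/
def idealM : TwoSidedIdeal (E n m q) := closedIdeal {1 - E.Q n m q, 1 - E.P n m q}

end Ideals

/-! ### The compact operators -/

section Compact

variable (H : Type*) [NormedAddCommGroup H] [InnerProductSpace ℂ H] [CompleteSpace H]

theorem isCompactOperator_star {T : H →L[ℂ] H} (hT : IsCompactOperator T) :
    IsCompactOperator (star T : H →L[ℂ] H) := by
  refine (isCompactOperator_iff_isCompact_closure_image_ball
    (star T : H →L[ℂ] H).toLinearMap one_pos).2 ?_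
  have h1 : IsCompactOperator (T ∘L (star T)) := hT.comp_clm (star T)
  have h2 := (h1.isCompact_closure_image_ball 1).totallyBounded.subset subset_closure
  refine TotallyBounded.isCompact_of_isClosed (TotallyBounded.closure ?_) isClosed_closure
  rw [Metric.totallyBounded_iff]
  intro ε hε
  obtain ⟨u, hu, huf, hcov⟩ :=
    Metric.finite_approx_of_totallyBounded h2 (ε ^ 2 / 2) (by positivity)
  have hu' : ∀ y ∈ u, ∃ x, x ∈ Metric.ball (0 : H) 1 ∧ T (star T x) = y := fun y hy => hu hy
  choose! g hg using hu'
  refine ⟨(fun y => star T (g y)) '' u, huf.image _, ?_⟩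
  rintro _ ⟨x, hx, rfl⟩
  obtain ⟨y, hy, hxy⟩ := Set.mem_iUnion₂.1 (hcov ⟨x, hx, rfl⟩)
  refine Set.mem_iUnion₂.2 ⟨_, ⟨y, hy, rfl⟩, ?_⟩
  obtain ⟨hgb, hgy⟩ := hg y hy
  rw [Metric.mem_ball, dist_eq_norm] at hxy ⊢
  rw [← hgy] at hxy
  set z := x - g y with hz
  have hz2 : ‖z‖ ≤ 2 := by
    rw [mem_ball_zero_iff] at hx hgb
    calc ‖z‖ ≤ ‖x‖ + ‖g y‖ := norm_sub_le _ _
      _ ≤ 2 := by linarith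
  have hTz : ‖T (star T z)‖ < ε ^ 2 / 2 := by simpa [hz] using hxy
  have hkey : ‖star T z‖ ^ 2 ≤ ‖T (star T z)‖ * ‖z‖ := by
    have e : inner ℂ (star T z) (star T z) = inner ℂ (T (star T z)) z := by
      rw [ContinuousLinearMap.star_eq_adjoint, ContinuousLinearMap.adjoint_inner_right]
    have e2 := norm_inner_le_norm (𝕜 := ℂ) (T (star T z)) z
    rw [← e, inner_self_eq_norm_sq_to_K] at e2
    simpa using e2
  have : ‖star T z‖ ^ 2 < ε ^ 2 := by nlinarith [norm_nonneg z, norm_nonneg (T (star T z))]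
  have hlt := lt_of_pow_lt_pow_left₀ 2 hε.le this
  simpa [hz] using hlt

/-- The `C⋆`-algebra of compact operators on a Hilbert space. -/
def compactOperators : NonUnitalStarSubalgebra ℂ (H →L[ℂ] H) where
  carrier := {T | IsCompactOperator T}
  add_mem' hS hT := hS.add hT
  zero_mem' := isCompactOperator_zero
  smul_mem' c _ hT := hT.smul c
  mul_mem' {_ T} hS _ := hS.comp_clm T
  star_mem' hT := isCompactOperator_star H hT

end Compact

end TwistedCuntz

end

/-!
Write `Q_k` for the sum of the range projections of the words of length `k` in the `sᵢ`
(`rangeProj`), and `P_k` for the same with the `tᵣ`. These projections decrease in `k`, and `Q_k`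
commutes with the `tᵣ` while `Q_{k+1} sᵢ = sᵢ Q_k`. Therefore the elements `x` with `Q_k x → 0`
form a closed ideal, and this ideal is `I₁`, the one generated by the defect `1 - Q`
(`mem_closedIdeal_defect_iff`); similarly for `I₂`. Two facts follow: `I = I₁ ∩ I₂`
(`mem_closedIdeal_mul_defect_iff`), and `I₁ + I₂` is closed, hence equal to `M`
(`closedIdeal_pair_defect`), because `1 - Q_k` is an approximate unit of `I₁` with a bound.

The classification rests on `mul_mem_of_compression`. Let `z` be an element of a closed ideal `J`
whose compressions `Q_k P_k z` (or `Q_k (1 - P) z`, or `(1 - Q) (1 - P) z`) have norms bounded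
below. The gauge averages of `z z⋆` over roots of unity keep norms bounded below under these
compressions. Approximate `z z⋆` by a combination of monomials `s_μ s_ν⋆ t_α t_β⋆` of length at most
`k`: averaging removes the unbalanced monomials, and what is left is a matrix over the matrix units
given by the words of length `k`, so it has a large matrix coefficient. For the element itself
(which, unlike its average, is close to `J`) the unbalanced monomials are removed by compressing
with the aperiodic word `0 ⋯ 0 1` (`compress_word_eq_zero`), which leaves that coefficient as it
is. So `J` contains an element close to a large multiple of a projection, and then it contains the
projection. According to the compression the projection is `1`, a defect, or the product of the two
defects. Thus a closed ideal not inside `M` is everything (`one_mem_of_not_mem`), one inside `M`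
but not inside `I₂` contains `I₁` (`defect_mem_of_not_mem`), and a nonzero one inside `I` contains
`I` (`mul_defect_mem_of_ne_zero`). Everything else about the lattice of ideals is formal
(`closed_ideal_cases`).

The ideals are told apart by representations by weighted shifts (`ShiftSystem.rep`), in which each
family is of Fock type (`1 - Q`, or `1 - P`, is not zero) or of Cuntz type (it is zero). The
representation with both families of Fock type is faithful by the classification, since its kernel
does not contain `(1 - Q) (1 - P)`; it maps this product to the projection onto the vacuum vector,
which is cyclic, and hence maps `I` onto the compact operators.
-/

noncomputable section

namespace TwistedCuntz

open Filter Topology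

section Relations

variable {n m : ℕ} {q : ℂ} {B : Type*} [CStarAlgebra B] {s : Fin n → B} {t : Fin m → B}

/-! ### Words in a family of isometries -/

/-- A family of isometries with pairwise orthogonal ranges. -/
def OrthoIsometries (s : Fin n → B) : Prop := ∀ i j, star (s i) * s j = if i = j then 1 else 0

/-- The product `s μ₁ * s μ₂ * ⋯` along a word `μ`. -/
def word (s : Fin n → B) (μ : List (Fin n)) : B := (μ.map s).prod

@[simp] theorem word_nil : word s [] = 1 := rfl

@[simp] theorem word_cons (i : Fin n) (μ : List (Fin n)) : word s (i :: μ) = s i * word s μ := by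
  simp [word]

theorem word_append (μ ν : List (Fin n)) : word s (μ ++ ν) = word s μ * word s ν := by
  simp [word]

theorem star_word_mul_word_append (h : OrthoIsometries s) (μ ν : List (Fin n)) :
    star (word s μ) * word s (μ ++ ν) = word s ν := by
  induction μ with
  | nil => simp
  | cons i μ ih =>
    have hi : star (s i) * s i = 1 := by simpa using h i i
    rw [List.cons_append, word_cons, word_cons, star_mul, mul_assoc, ← mul_assoc (star (s i)), hi,
      one_mul, ih]

theorem star_word_mul_self (h : OrthoIsometries s) (μ : List (Fin n)) :
    star (word s μ) * word s μ = 1 := by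
  simpa using star_word_mul_word_append h μ []

theorem star_word_mul_word_of_not_prefix (h : OrthoIsometries s) {μ ν : List (Fin n)}
    (h₁ : ¬ μ <+: ν) (h₂ : ¬ ν <+: μ) : star (word s μ) * word s ν = 0 := by
  induction μ generalizing ν with
  | nil => simp at h₁
  | cons i μ ih =>
    cases ν with
    | nil => simp at h₂
    | cons j ν =>
      rw [word_cons, word_cons, star_mul, mul_assoc, ← mul_assoc (star (s i)), h i j]
      split_ifs with hij
      · subst hij
        simp only [List.cons_prefix_cons, true_and] at h₁ h₂
        simpa using ih h₁ h₂
      · simp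

theorem star_word_mul_word_of_length_eq (h : OrthoIsometries s) {μ ν : List (Fin n)}
    (hl : μ.length = ν.length) : star (word s μ) * word s ν = if μ = ν then 1 else 0 := by
  split_ifs with hμν
  · rw [hμν, star_word_mul_self h]
  · exact star_word_mul_word_of_not_prefix h (fun hp => hμν (hp.eq_of_length hl))
      (fun hp => hμν (hp.eq_of_length hl.symm).symm)

/-- For `|μ| ≤ |ν|` the product `(word μ)⋆ (word ν)` is zero or a word of length `|ν| - |μ|`. -/
theorem star_word_mul_word_of_length_le (h : OrthoIsometries s) {μ ν : List (Fin n)}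
    (hl : μ.length ≤ ν.length) : star (word s μ) * word s ν = 0 ∨
      ∃ κ : List (Fin n), κ.length + μ.length = ν.length ∧
        star (word s μ) * word s ν = word s κ := by
  by_cases hp : μ <+: ν
  · obtain ⟨κ, rfl⟩ := hp
    exact Or.inr ⟨κ, by simp [add_comm], star_word_mul_word_append h μ κ⟩
  · refine Or.inl (star_word_mul_word_of_not_prefix h hp fun hp' => hp ?_)
    rw [hp'.eq_of_length (le_antisymm hp'.length_le hl)]

theorem norm_word_le (h : OrthoIsometries s) (μ : List (Fin n)) : ‖word s μ‖ ≤ 1 :=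
  FreeStar.norm_le_one_of_star_mul_self (star_word_mul_self h μ)

/-- The word `i i ⋯ i j` is aperiodic: compressing by it kills products `(word μ)⋆ (word ν)` with
`|μ| ≠ |ν|`, since the last letter `j` of the one word meets a letter `i` of the other. -/
theorem compress_word_eq_zero (h : OrthoIsometries s) {i j : Fin n} (hij : i ≠ j) {k : ℕ}
    {μ ν : List (Fin n)} (hμ : μ.length ≤ k) (hν : ν.length ≤ k) (hl : μ.length ≠ ν.length) :
    star (word s (List.replicate k i ++ [j])) * (star (word s μ) * word s ν) *
      word s (List.replicate k i ++ [j]) = 0 := by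
  have key : ∀ α β : List (Fin n), α.length ≤ k → β.length ≤ k → α.length < β.length →
      ¬ (α ++ (List.replicate k i ++ [j]) <+: β ++ (List.replicate k i ++ [j])) := by
    intro α β hα hβ hlt hp
    have h1 := hp.getElem (i := α.length + k) (by simp)
    have h2 : (α ++ (List.replicate k i ++ [j]))[α.length + k]'(by simp) = j := by
      simp [List.getElem_append_right]
    have h3 : (β ++ (List.replicate k i ++ [j]))[α.length + k]'(by simp; omega) = i := by
      rw [List.getElem_append_right (by omega), List.getElem_append_left (by simp; omega)]
      simp
    exact hij (h3.symm.trans (h1.symm.trans h2))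
  have hlen : ∀ α β : List (Fin n), β.length ≤ α.length →
      ¬ (α.length = β.length) →
      ¬ (α ++ (List.replicate k i ++ [j]) <+: β ++ (List.replicate k i ++ [j])) := by
    intro α β h1 h2 hp
    have := hp.length_le
    simp at this
    omega
  have e : star (word s (List.replicate k i ++ [j])) * (star (word s μ) * word s ν) *
      word s (List.replicate k i ++ [j]) =
      star (word s (μ ++ (List.replicate k i ++ [j]))) *
        word s (ν ++ (List.replicate k i ++ [j])) := by
    rw [word_append μ, word_append ν, star_mul]
    simp only [mul_assoc]
  rw [e]
  rcases lt_or_gt_of_ne hl with hlt | hlt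
  · exact star_word_mul_word_of_not_prefix h (key μ ν hμ hν hlt) (hlen ν μ hlt.le hl.symm)
  · exact star_word_mul_word_of_not_prefix h (hlen μ ν hlt.le hl) (key ν μ hν hμ hlt)

/-! ### The range projections -/

/-- The sum of the range projections of all words of length `k`. -/
def rangeProj (s : Fin n → B) : ℕ → B
  | 0 => 1
  | k + 1 => ∑ i, s i * rangeProj s k * star (s i)

@[simp] theorem rangeProj_zero : rangeProj s 0 = 1 := rfl

theorem rangeProj_succ (k : ℕ) :
    rangeProj s (k + 1) = ∑ i, s i * rangeProj s k * star (s i) := rfl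

theorem rangeProj_one : rangeProj s 1 = ∑ i, s i * star (s i) := by simp [rangeProj]

theorem rangeProj_eq_sum_word (k : ℕ) : rangeProj s k =
    ∑ μ : Fin k → Fin n, word s (List.ofFn μ) * star (word s (List.ofFn μ)) := by
  induction k with
  | zero => simp
  | succ k ih =>
    rw [rangeProj_succ, ← (Fin.consEquiv (fun _ => Fin n)).sum_comp, Fintype.sum_prod_type]
    refine Finset.sum_congr rfl fun i _ => ?_
    rw [ih, Finset.mul_sum, Finset.sum_mul]
    refine Finset.sum_congr rfl fun μ _ => ?_
    simp [Fin.consEquiv, List.ofFn_succ, mul_assoc]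

theorem star_rangeProj (k : ℕ) : star (rangeProj s k) = rangeProj s k := by
  rw [rangeProj_eq_sum_word, star_sum]
  simp

theorem rangeProj_succ_mul (h : OrthoIsometries s) (k : ℕ) (i : Fin n) :
    rangeProj s (k + 1) * s i = s i * rangeProj s k := by
  rw [rangeProj_succ, Finset.sum_mul, Finset.sum_eq_single i]
  · rw [mul_assoc, h i i, if_pos rfl, mul_one]
  · intro j _ hj
    rw [mul_assoc, h j i, if_neg hj, mul_zero]
  · simp

theorem star_mul_rangeProj_succ (h : OrthoIsometries s) (k : ℕ) (i : Fin n) :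
    star (s i) * rangeProj s (k + 1) = rangeProj s k * star (s i) := by
  have := congrArg star (rangeProj_succ_mul h k i)
  simpa [star_rangeProj] using this

theorem rangeProj_succ_mul_rangeProj (h : OrthoIsometries s) (k : ℕ) :
    rangeProj s (k + 1) * rangeProj s k = rangeProj s (k + 1) := by
  induction k with
  | zero => simp
  | succ k ih =>
    rw [rangeProj_succ (k := k), Finset.mul_sum, rangeProj_succ (k := k + 1)]
    refine Finset.sum_congr rfl fun i _ => ?_
    rw [← mul_assoc, ← mul_assoc, ← rangeProj_succ, rangeProj_succ_mul h, mul_assoc (s i), ih]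

theorem rangeProj_mul_self (h : OrthoIsometries s) (k : ℕ) :
    rangeProj s k * rangeProj s k = rangeProj s k := by
  induction k with
  | zero => simp
  | succ k ih =>
    nth_rw 2 [rangeProj_succ]
    rw [Finset.mul_sum, rangeProj_succ]
    refine Finset.sum_congr rfl fun i _ => ?_
    rw [← mul_assoc, ← mul_assoc, ← rangeProj_succ, rangeProj_succ_mul h, mul_assoc (s i), ih]

theorem norm_le_one_of_projection {e : B} (h₁ : star e = e) (h₂ : e * e = e) : ‖e‖ ≤ 1 := by
  have h := CStarRing.norm_star_mul_self (x := e)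
  rw [h₁, h₂] at h
  nlinarith [norm_nonneg e, sq_nonneg (‖e‖ - 1)]

theorem norm_rangeProj_le (h : OrthoIsometries s) (k : ℕ) : ‖rangeProj s k‖ ≤ 1 :=
  norm_le_one_of_projection (star_rangeProj k) (rangeProj_mul_self h k)

theorem norm_one_sub_rangeProj_le (h : OrthoIsometries s) (k : ℕ) : ‖1 - rangeProj s k‖ ≤ 1 :=
  norm_le_one_of_projection (by simp [star_rangeProj])
    (by simp [sub_mul, mul_sub, rangeProj_mul_self h])

theorem star_mul_one_sub_rangeProj_one (h : OrthoIsometries s) (i : Fin n) :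
    star (s i) * (1 - rangeProj s 1) = 0 := by
  rw [mul_sub, star_mul_rangeProj_succ h]; simp

theorem one_sub_rangeProj_one_mul (h : OrthoIsometries s) (i : Fin n) :
    (1 - rangeProj s 1) * s i = 0 := by
  rw [sub_mul, rangeProj_succ_mul h]; simp

theorem one_sub_rangeProj_mul_self (h : OrthoIsometries s) (k : ℕ) :
    (1 - rangeProj s k) * (1 - rangeProj s k) = 1 - rangeProj s k := by
  simp [sub_mul, mul_sub, rangeProj_mul_self h]

theorem one_sub_rangeProj_succ (k : ℕ) : 1 - rangeProj s (k + 1) =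
    (1 - rangeProj s 1) + ∑ i, s i * (1 - rangeProj s k) * star (s i) := by
  simp only [mul_sub, sub_mul, mul_one, Finset.sum_sub_distrib, ← rangeProj_succ, rangeProj_one]
  abel

/-! ### Two twisted-commuting families -/

theorem Relations.left (h : Relations q s t) : OrthoIsometries s := h.star_s_mul_s

theorem Relations.right (h : Relations q s t) : OrthoIsometries t := h.star_t_mul_t

theorem Relations.star_t_mul_s (h : Relations q s t) (r : Fin m) (j : Fin n) :
    star (t r) * s j = star q • (s j * star (t r)) := by
  have := congrArg star (h.star_s_mul_t j r)
  simpa using this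

/-- The relations are symmetric in the two families. -/
theorem Relations.swap (h : Relations q s t) : Relations (star q) t s :=
  ⟨h.star_t_mul_t, h.star_s_mul_s, fun r j => h.star_t_mul_s r j⟩

/-- In a `C⋆`-algebra the relations imply `t r * s j = q • (s j * t r)`: the difference `d`
satisfies `star d * d = 0`. -/
theorem Relations.t_mul_s (h : Relations q s t) (hq : ‖q‖ = 1) (r : Fin m) (j : Fin n) :
    t r * s j = q • (s j * t r) := by
  have hqq : star q * q = 1 := by
    simpa [hq] using RCLike.conj_mul q
  have hs : star (s j) * s j = 1 := by simpa using h.star_s_mul_s j j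
  have ht : star (t r) * t r = 1 := by simpa using h.star_t_mul_t r r
  have e1 : star (s j) * star (t r) * (s j * t r) = star q • 1 := by
    rw [mul_assoc, ← mul_assoc (star (t r)), h.star_t_mul_s, smul_mul_assoc, mul_smul_comm,
      mul_assoc (s j), ht, mul_one, hs]
  have e2 : star (t r) * star (s j) * (t r * s j) = q • 1 := by
    rw [mul_assoc, ← mul_assoc (star (s j)), h.star_s_mul_t, smul_mul_assoc, mul_smul_comm,
      mul_assoc (t r), hs, mul_one, ht]
  have e3 : star (s j) * star (t r) * (t r * s j) = 1 := by
    rw [mul_assoc, ← mul_assoc (star (t r)), ht, one_mul, hs]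
  have e4 : star (t r) * star (s j) * (s j * t r) = 1 := by
    rw [mul_assoc, ← mul_assoc (star (s j)), hs, one_mul, ht]
  rw [← sub_eq_zero, ← CStarRing.star_mul_self_eq_zero_iff]
  rw [star_sub, star_smul, star_mul, star_mul, sub_mul, mul_sub, mul_sub, mul_smul_comm,
    smul_mul_assoc, smul_mul_assoc, mul_smul_comm, e1, e2, e3, e4, smul_smul, smul_smul,
    mul_comm q, hqq]
  simp

/-- Commutation up to a nonzero scalar. -/
def QComm (x y : B) : Prop := ∃ c : ℂ, c ≠ 0 ∧ x * y = c • (y * x)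

theorem QComm.symm {x y : B} (h : QComm x y) : QComm y x := by
  obtain ⟨c, hc, h⟩ := h
  exact ⟨c⁻¹, inv_ne_zero hc, by rw [h, smul_smul, inv_mul_cancel₀ hc, one_smul]⟩

theorem QComm.star {x y : B} (h : QComm x y) : QComm (star x) (star y) := by
  obtain ⟨c, hc, h⟩ := h
  refine QComm.symm ⟨Star.star c, by simpa using hc, ?_⟩
  simpa using congrArg Star.star h

theorem _root_.Commute.qComm {x y : B} (h : Commute x y) : QComm x y :=
  ⟨1, one_ne_zero, by rw [one_smul, h.eq]⟩

theorem QComm.mul_left {x y z : B} (h₁ : QComm x z) (h₂ : QComm y z) : QComm (x * y) z := by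
  obtain ⟨c, hc, h₁⟩ := h₁
  obtain ⟨d, hd, h₂⟩ := h₂
  refine ⟨d * c, mul_ne_zero hd hc, ?_⟩
  rw [mul_assoc, h₂, mul_smul_comm, ← mul_assoc, h₁, smul_mul_assoc, smul_smul, mul_assoc]

theorem QComm.mul_right {x y z : B} (h₁ : QComm x y) (h₂ : QComm x z) : QComm x (y * z) :=
  (h₁.symm.mul_left h₂.symm).symm

/-- The multiplicative monoid generated by the isometries, their adjoints and the defect
projection. -/
def monoid (s : Fin n → B) : Submonoid B :=
  Submonoid.closure ({x | ∃ i, x = s i ∨ x = star (s i)} ∪ {1 - rangeProj s 1})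

theorem mem_monoid (i : Fin n) : s i ∈ monoid s :=
  Submonoid.subset_closure (Or.inl ⟨i, Or.inl rfl⟩)

theorem defect_mem_monoid : 1 - rangeProj s 1 ∈ monoid s :=
  Submonoid.subset_closure (Or.inr rfl)

theorem star_mem_monoid {x : B} (hx : x ∈ monoid s) : star x ∈ monoid s := by
  induction hx using Submonoid.closure_induction with
  | mem x hx =>
    rcases hx with ⟨i, rfl | rfl⟩ | rfl
    · exact Submonoid.subset_closure (Or.inl ⟨i, Or.inr rfl⟩)
    · simpa using mem_monoid i
    · simpa [star_rangeProj] using defect_mem_monoid (s := s)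
  | one => simp [one_mem]
  | mul x y _ _ hx hy => rw [star_mul]; exact mul_mem hy hx

theorem word_mem_monoid (μ : List (Fin n)) : word s μ ∈ monoid s := by
  induction μ with
  | nil => exact one_mem _
  | cons i μ ih => rw [word_cons]; exact mul_mem (mem_monoid i) ih

theorem Relations.qComm_s_t (h : Relations q s t) (hq : ‖q‖ = 1) (i : Fin n) (r : Fin m) :
    QComm (s i) (t r) :=
  QComm.symm ⟨q, by rintro rfl; simp at hq, h.t_mul_s hq r i⟩

theorem Relations.qComm_star_s_t (h : Relations q s t) (hq : ‖q‖ = 1) (i : Fin n) (r : Fin m) :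
    QComm (star (s i)) (t r) :=
  ⟨q, by rintro rfl; simp at hq, h.star_s_mul_t i r⟩

/-- The range projections of one family commute with the other family. -/
theorem Relations.commute_rangeProj (h : Relations q s t) (hq : ‖q‖ = 1) (k : ℕ) (r : Fin m) :
    Commute (rangeProj s k) (t r) := by
  have hqq : star q * q = 1 := by
    simpa [hq] using RCLike.conj_mul q
  induction k with
  | zero => exact Commute.one_left _
  | succ k ih =>
    rw [rangeProj_succ]
    refine Commute.sum_left _ _ _ fun i _ => ?_
    have hs : s i * t r = star q • (t r * s i) := by
      rw [h.t_mul_s hq, smul_smul, hqq, one_smul]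
    rw [commute_iff_eq, mul_assoc, h.star_s_mul_t, mul_smul_comm, ← mul_assoc, mul_assoc (s i),
      ih.eq, ← mul_assoc, hs, smul_mul_assoc, smul_mul_assoc, smul_smul, mul_comm q, hqq, one_smul]
    simp only [mul_assoc]

theorem Relations.commute_rangeProj_star (h : Relations q s t) (hq : ‖q‖ = 1) (k : ℕ)
    (r : Fin m) : Commute (rangeProj s k) (star (t r)) := by
  have := congrArg star (h.commute_rangeProj hq k r).eq
  simp only [star_mul, star_rangeProj] at this
  exact this.symm

theorem Relations.commute_rangeProj_monoid (h : Relations q s t) (hq : ‖q‖ = 1) (k : ℕ)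
    {y : B} (hy : y ∈ monoid t) : Commute (rangeProj s k) y := by
  induction hy using Submonoid.closure_induction with
  | mem x hx =>
    rcases hx with ⟨i, rfl | rfl⟩ | rfl
    · exact h.commute_rangeProj hq k i
    · exact h.commute_rangeProj_star hq k i
    · refine (Commute.one_right _).sub_right ?_
      rw [rangeProj_one]
      exact Commute.sum_right _ _ _ fun i _ =>
        (h.commute_rangeProj hq k i).mul_right (h.commute_rangeProj_star hq k i)
  | one => exact Commute.one_right _
  | mul x y _ _ hx hy => exact hx.mul_right hy

theorem Relations.commute_rangeProj_rangeProj (h : Relations q s t) (hq : ‖q‖ = 1) (k l : ℕ) :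
    Commute (rangeProj s k) (rangeProj t l) := by
  rw [rangeProj_eq_sum_word (s := t)]
  exact Commute.sum_right _ _ _ fun μ _ =>
    (h.commute_rangeProj_monoid hq k (word_mem_monoid _)).mul_right
      (h.commute_rangeProj_monoid hq k (star_mem_monoid (word_mem_monoid _)))

/-- Products of letters from different families commute up to a scalar. -/
theorem Relations.qComm (h : Relations q s t) (hq : ‖q‖ = 1) {x y : B} (hx : x ∈ monoid s)
    (hy : y ∈ monoid t) : QComm x y := by
  induction hx using Submonoid.closure_induction with
  | mem x hx =>
    rcases hx with hx | rfl
    · induction hy using Submonoid.closure_induction with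
      | mem y hy =>
        rcases hy with ⟨r, rfl | rfl⟩ | rfl
        · obtain ⟨i, rfl | rfl⟩ := hx
          · exact h.qComm_s_t hq i r
          · exact h.qComm_star_s_t hq i r
        · obtain ⟨i, rfl | rfl⟩ := hx
          · simpa using (h.qComm_star_s_t hq i r).star
          · exact (h.qComm_s_t hq i r).star
        · have hq' : ‖star q‖ = 1 := by simpa using hq
          refine (Commute.sub_right (Commute.one_right _) ?_).qComm
          refine (h.swap.commute_rangeProj_monoid hq' 1 ?_).symm
          obtain ⟨i, rfl | rfl⟩ := hx
          · exact mem_monoid i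
          · exact star_mem_monoid (mem_monoid i)
      | one => exact (Commute.one_right _).qComm
      | mul y z _ _ hy hz => exact hy.mul_right hz
    · exact ((Commute.one_left _).sub_left (h.commute_rangeProj_monoid hq 1 hy)).qComm
  | one => exact (Commute.one_left _).qComm
  | mul x y _ _ hx hy => exact hx.mul_left hy

/-! ### Closed ideals -/

theorem subset_closedIdeal {A : Type*} [NormedRing A] (X : Set A) :
    X ⊆ (closedIdeal X : Set A) := fun _ hx =>
  (TwoSidedIdeal.mem_sInf _).2 fun _ hJ => hJ.2 hx

theorem mem_closedIdeal_singleton {A : Type*} [NormedRing A] (x : A) : x ∈ closedIdeal {x} :=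
  subset_closedIdeal _ (Set.mem_singleton x)

theorem closedIdeal_le {A : Type*} [NormedRing A] {X : Set A} {J : TwoSidedIdeal A}
    (hJ : IsClosed (J : Set A)) (hX : X ⊆ J) : closedIdeal X ≤ J := fun _ hx =>
  (TwoSidedIdeal.mem_sInf _).1 hx J ⟨hJ, hX⟩

theorem isClosed_closedIdeal {A : Type*} [NormedRing A] (X : Set A) :
    IsClosed (closedIdeal X : Set A) := by
  have : (closedIdeal X : Set A) =
      ⋂ J ∈ {J : TwoSidedIdeal A | IsClosed (J : Set A) ∧ X ⊆ J}, (J : Set A) := by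
    ext x
    simp only [closedIdeal, SetLike.mem_coe, TwoSidedIdeal.mem_sInf, Set.mem_iInter]
  rw [this]
  exact isClosed_biInter fun J hJ => hJ.1

theorem smul_mem_ideal {A : Type*} [NormedRing A] [Algebra ℂ A] (J : TwoSidedIdeal A) (c : ℂ)
    {x : A} (hx : x ∈ J) : c • x ∈ J := by
  rw [Algebra.smul_def]; exact J.mul_mem_left _ _ hx

/-- A closed ideal that contains, up to an error less than `‖c‖`, a multiple `c • f` of a
projection `f`, contains `f`. -/
theorem projection_mem_of_norm_sub_lt {J : TwoSidedIdeal B} {f y : B} {c : ℂ}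
    (hf : star f = f) (hff : f * f = f) (hy : y ∈ J) (h : ‖y - c • f‖ < ‖c‖) : f ∈ J := by
  have hc : c ≠ 0 := by
    rintro rfl
    simp only [norm_zero] at h
    exact absurd h (not_lt.2 (norm_nonneg _))
  have hc' : 0 < ‖c‖ := norm_pos_iff.2 hc
  set w := f - c⁻¹ • (f * y * f) with hw
  have hfn : ‖f‖ ≤ 1 := norm_le_one_of_projection hf hff
  have hwn : ‖w‖ < 1 := by
    have e : w = -(c⁻¹ • (f * (y - c • f) * f)) := by
      rw [mul_sub, sub_mul, mul_smul_comm, smul_mul_assoc, hff, hff, smul_sub, smul_smul,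
        inv_mul_cancel₀ hc, one_smul, neg_sub]
    rw [e, norm_neg, norm_smul, norm_inv, inv_mul_lt_iff₀ hc', mul_one]
    calc ‖f * (y - c • f) * f‖ ≤ ‖f * (y - c • f)‖ * ‖f‖ := norm_mul_le _ _
      _ ≤ ‖f‖ * ‖y - c • f‖ * ‖f‖ := by gcongr; exact norm_mul_le _ _
      _ ≤ 1 * ‖y - c • f‖ * 1 := by gcongr
      _ < ‖c‖ := by simpa using h
  -- `1 - w` is invertible and `f * (1 - w) = c⁻¹ • (f * y * f)` lies in `J`
  have hu := (Units.oneSub w hwn).mul_inv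
  rw [Units.val_oneSub] at hu
  have e : f * (1 - w) = c⁻¹ • (f * y * f) := by
    rw [hw, mul_sub, mul_sub, hff, mul_smul_comm, mul_one, ← mul_assoc, ← mul_assoc, hff]
    abel
  have : f = c⁻¹ • (f * y * f) * ((Units.oneSub w hwn)⁻¹ : Bˣ) := by
    rw [← e, mul_assoc, hu, mul_one]
  rw [this]
  exact J.mul_mem_right _ _ (smul_mem_ideal J _ (J.mul_mem_right _ _ (J.mul_mem_left _ _ hy)))

/-! ### Algebras generated by the two families -/

/-- The `C⋆`-algebra is generated by the two families: a closed subalgebra that contains them and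
their adjoints is everything. -/
def IsGenerated (s : Fin n → B) (t : Fin m → B) : Prop :=
  ∀ A : Subalgebra ℂ B, IsClosed (A : Set B) → (∀ i, s i ∈ A ∧ star (s i) ∈ A) →
    (∀ r, t r ∈ A ∧ star (t r) ∈ A) → A = ⊤

theorem IsGenerated.swap (h : IsGenerated s t) : IsGenerated t s :=
  fun A hA h₁ h₂ => h A hA h₂ h₁

/-- A closed subspace that is stable under left multiplication by the generators is a left
ideal. -/
theorem IsGenerated.mul_mem (h : IsGenerated s t) {L : Submodule ℂ B} (hL : IsClosed (L : Set B))
    (hs : ∀ i, ∀ x ∈ L, s i * x ∈ L ∧ star (s i) * x ∈ L)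
    (ht : ∀ r, ∀ x ∈ L, t r * x ∈ L ∧ star (t r) * x ∈ L) (a : B) {x : B} (hx : x ∈ L) :
    a * x ∈ L := by
  let A : Subalgebra ℂ B :=
    { carrier := {a | ∀ x ∈ L, a * x ∈ L}
      mul_mem' := fun {a b} ha hb x hx => by rw [mul_assoc]; exact ha _ (hb _ hx)
      add_mem' := fun {a b} ha hb x hx => by rw [add_mul]; exact add_mem (ha _ hx) (hb _ hx)
      algebraMap_mem' := fun c x hx => by
        rw [← Algebra.smul_def]; exact L.smul_mem c hx }
  have hA : IsClosed (A : Set B) := by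
    have : (A : Set B) = ⋂ x ∈ L, (fun a => a * x) ⁻¹' (L : Set B) := by
      ext a; simp [A]
    rw [this]
    exact isClosed_biInter fun x _ => hL.preimage (continuous_mul_const x)
  have := h A hA (fun i => ⟨fun x hx => (hs i x hx).1, fun x hx => (hs i x hx).2⟩)
    (fun r => ⟨fun x hx => (ht r x hx).1, fun x hx => (ht r x hx).2⟩)
  exact (this ▸ Algebra.mem_top : a ∈ A) x hx

/-! ### The ideal of a defect projection -/

/-- The subspace, in fact right ideal, of the elements `x` with `e k * x → 0`. -/
def vanishing (e : ℕ → B) : Submodule ℂ B where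
  carrier := {x | Tendsto (fun k => e k * x) atTop (𝓝 0)}
  add_mem' {x y} hx hy := by
    simpa [mul_add] using Tendsto.add hx hy
  zero_mem' := by simp
  smul_mem' c x hx := by
    simpa [mul_smul_comm] using Tendsto.const_smul hx c

theorem mem_vanishing {e : ℕ → B} {x : B} :
    x ∈ vanishing e ↔ Tendsto (fun k => e k * x) atTop (𝓝 0) := Iff.rfl

theorem isClosed_vanishing {e : ℕ → B} (he : ∀ k, ‖e k‖ ≤ 1) :
    IsClosed (vanishing e : Set B) := by
  refine isClosed_of_closure_subset fun x hx => ?_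
  refine Metric.tendsto_atTop.2 fun ε hε => ?_
  obtain ⟨y, hy, hxy⟩ := Metric.mem_closure_iff.1 hx (ε / 2) (half_pos hε)
  obtain ⟨N, hN⟩ := Metric.tendsto_atTop.1 (mem_vanishing.1 hy) (ε / 2) (half_pos hε)
  refine ⟨N, fun k hk => ?_⟩
  have h1 := hN k hk
  rw [dist_zero_right] at h1 ⊢
  rw [dist_eq_norm] at hxy
  calc ‖e k * x‖ = ‖e k * (x - y) + e k * y‖ := by rw [mul_sub, sub_add_cancel]
    _ ≤ ‖e k‖ * ‖x - y‖ + ‖e k * y‖ := (norm_add_le _ _).trans (by gcongr; exact norm_mul_le _ _)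
    _ ≤ 1 * ‖x - y‖ + ‖e k * y‖ := by gcongr; exact he k
    _ < ε := by linarith

theorem mul_right_mem_vanishing {e : ℕ → B} {x : B} (hx : x ∈ vanishing e) (a : B) :
    x * a ∈ vanishing e := by
  have := (mem_vanishing.1 hx).mul_const a
  simpa [mem_vanishing, mul_assoc] using this

theorem mul_left_mem_vanishing_rangeProj (h : Relations q s t) (hq : ‖q‖ = 1)
    (hg : IsGenerated s t) (a : B) {x : B} (hx : x ∈ vanishing (rangeProj s)) :
    a * x ∈ vanishing (rangeProj s) := by
  refine hg.mul_mem (isClosed_vanishing (norm_rangeProj_le h.left)) (fun i x hx => ⟨?_, ?_⟩)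
    (fun r x hx => ⟨?_, ?_⟩) a hx
  · rw [mem_vanishing, ← tendsto_add_atTop_iff_nat 1]
    simp_rw [← mul_assoc, rangeProj_succ_mul h.left, mul_assoc]
    simpa using (mem_vanishing.1 hx).const_mul (s i)
  · rw [mem_vanishing]
    simp_rw [← mul_assoc, ← star_mul_rangeProj_succ h.left, mul_assoc]
    simpa using ((tendsto_add_atTop_iff_nat 1).2 (mem_vanishing.1 hx)).const_mul (star (s i))
  · rw [mem_vanishing]
    simp_rw [← mul_assoc, (h.commute_rangeProj hq _ r).eq, mul_assoc]
    simpa using (mem_vanishing.1 hx).const_mul (t r)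
  · rw [mem_vanishing]
    simp_rw [← mul_assoc, (h.commute_rangeProj_star hq _ r).eq, mul_assoc]
    simpa using (mem_vanishing.1 hx).const_mul (star (t r))

theorem one_sub_rangeProj_mem {J : TwoSidedIdeal B} (hJ : 1 - rangeProj s 1 ∈ J) (k : ℕ) :
    1 - rangeProj s k ∈ J := by
  induction k with
  | zero => simp
  | succ k ih =>
    rw [one_sub_rangeProj_succ]
    exact J.add_mem hJ (sum_mem fun i _ => J.mul_mem_right _ _ (J.mul_mem_left _ _ ih))

theorem rangeProj_mul_defect (h : OrthoIsometries s) (k : ℕ) :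
    rangeProj s (k + 1) * (1 - rangeProj s 1) = 0 := by
  rw [rangeProj_succ, Finset.sum_mul]
  refine Finset.sum_eq_zero fun i _ => ?_
  rw [mul_assoc, star_mul_one_sub_rangeProj_one h, mul_zero]

theorem mem_of_tendsto_mul {J : TwoSidedIdeal B} (hJ : IsClosed (J : Set B)) {e : ℕ → B} {x : B}
    (he : ∀ k, (1 - e k) * x ∈ J) (hx : Tendsto (fun k => e k * x) atTop (𝓝 0)) : x ∈ J := by
  have : Tendsto (fun k => (1 - e k) * x) atTop (𝓝 x) := by
    simpa [sub_mul] using (tendsto_const_nhds (x := x)).sub hx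
  exact hJ.mem_of_tendsto this (Eventually.of_forall he)

/-- The closed ideal generated by the defect projection `1 - ∑ sᵢ sᵢ⋆` consists of the elements
on which the decreasing range projections tend to zero. -/
theorem mem_closedIdeal_defect_iff (h : Relations q s t) (hq : ‖q‖ = 1) (hg : IsGenerated s t)
    {x : B} : x ∈ closedIdeal {1 - rangeProj s 1} ↔
      Tendsto (fun k => rangeProj s k * x) atTop (𝓝 0) := by
  constructor
  · intro hx
    let J : TwoSidedIdeal B := TwoSidedIdeal.mk' (vanishing (rangeProj s) : Set B)
      (vanishing _).zero_mem (vanishing _).add_mem (vanishing _).neg_mem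
      (fun {a _} hx => mul_left_mem_vanishing_rangeProj h hq hg a hx)
      (fun {_ a} hx => mul_right_mem_vanishing hx a)
    have hJ : (J : Set B) = vanishing (rangeProj s) := TwoSidedIdeal.coe_mk' ..
    have hle : closedIdeal {1 - rangeProj s 1} ≤ J := by
      refine closedIdeal_le ?_ ?_
      · rw [hJ]; exact isClosed_vanishing (norm_rangeProj_le h.left)
      · rw [hJ, Set.singleton_subset_iff]
        refine mem_vanishing.2 ((tendsto_add_atTop_iff_nat 1).1 ?_)
        simp [rangeProj_mul_defect h.left]
    have : x ∈ (J : Set B) := hle hx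
    rwa [hJ] at this
  · intro hx
    refine mem_of_tendsto_mul (isClosed_closedIdeal _) (fun k => ?_) hx
    exact TwoSidedIdeal.mul_mem_right _ _ _
      (one_sub_rangeProj_mem (mem_closedIdeal_singleton _) k)

theorem norm_rangeProj_succ_mul_le (h : OrthoIsometries s) (k : ℕ) (x : B) :
    ‖rangeProj s (k + 1) * x‖ ≤ ‖rangeProj s k * x‖ := by
  rw [← rangeProj_succ_mul_rangeProj h, mul_assoc]
  exact (norm_mul_le _ _).trans (mul_le_of_le_one_left (norm_nonneg _) (norm_rangeProj_le h _))

/-- A decreasing sequence of norms that does not tend to zero is bounded below. -/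
theorem exists_pos_le_norm {y : ℕ → B} (hy : ∀ k, ‖y (k + 1)‖ ≤ ‖y k‖)
    (h : ¬ Tendsto y atTop (𝓝 0)) : ∃ δ > 0, ∀ k, δ ≤ ‖y k‖ := by
  by_contra! hcon
  refine h (Metric.tendsto_atTop.2 fun ε hε => ?_)
  obtain ⟨N, hN⟩ := hcon ε hε
  refine ⟨N, fun k hk => ?_⟩
  rw [dist_zero_right]
  exact (antitone_nat_of_succ_le (f := fun k => ‖y k‖) hy hk).trans_lt hN

/-! ### Intersections and sums of the ideals -/

/-- The product of the two defect projections, of any levels, lies in every ideal that contains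
the product of the two defect projections of level one. -/
theorem one_sub_mul_one_sub_mem (h : Relations q s t) (hq : ‖q‖ = 1) {J : TwoSidedIdeal B}
    (hJ : (1 - rangeProj s 1) * (1 - rangeProj t 1) ∈ J) (k l : ℕ) :
    (1 - rangeProj s k) * (1 - rangeProj t l) ∈ J := by
  have hq' : ‖star q‖ = 1 := by simpa using hq
  have h1 : ∀ l, (1 - rangeProj s 1) * (1 - rangeProj t l) ∈ J := by
    intro l
    induction l with
    | zero => simp
    | succ l ih =>
      rw [one_sub_rangeProj_succ (s := t), mul_add, Finset.mul_sum]
      refine J.add_mem hJ (sum_mem fun r _ => ?_)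
      have hc : Commute (1 - rangeProj s 1) (t r) :=
        (Commute.one_left _).sub_left (h.commute_rangeProj hq 1 r)
      rw [← mul_assoc, ← mul_assoc, hc.eq, mul_assoc (t r)]
      exact J.mul_mem_right _ _ (J.mul_mem_left _ _ ih)
  induction k with
  | zero => simp
  | succ k ih =>
    rw [one_sub_rangeProj_succ, add_mul, Finset.sum_mul]
    refine J.add_mem (h1 l) (sum_mem fun i _ => ?_)
    have hc : Commute (star (s i)) (1 - rangeProj t l) :=
      (Commute.one_right _).sub_right (h.swap.commute_rangeProj_star hq' l i).symm
    rw [mul_assoc, hc.eq, ← mul_assoc, mul_assoc (s i)]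
    exact J.mul_mem_right _ _ (J.mul_mem_left _ _ ih)

theorem tendsto_one_sub_mul_one_sub_mul (h : OrthoIsometries s) {x : B}
    (h₁ : Tendsto (fun k => rangeProj s k * x) atTop (𝓝 0))
    (h₂ : Tendsto (fun k => rangeProj t k * x) atTop (𝓝 0)) :
    Tendsto (fun k => (1 - rangeProj s k) * (1 - rangeProj t k) * x) atTop (𝓝 x) := by
  have e : ∀ k, (1 - rangeProj s k) * (1 - rangeProj t k) * x =
      x - rangeProj s k * x - rangeProj t k * x + rangeProj s k * (rangeProj t k * x) := by
    intro k; noncomm_ring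
  have h₃ : Tendsto (fun k => rangeProj s k * (rangeProj t k * x)) atTop (𝓝 0) := by
    refine squeeze_zero_norm (fun k => ?_) (tendsto_zero_iff_norm_tendsto_zero.1 h₂)
    exact (norm_mul_le _ _).trans
      (mul_le_of_le_one_left (norm_nonneg _) (norm_rangeProj_le h _))
  simp_rw [e]
  simpa using (((tendsto_const_nhds (x := x)).sub h₁).sub h₂).add h₃

/-- The ideal generated by the product of the defect projections is the intersection of the
ideals generated by the defect projections. -/
theorem mem_closedIdeal_mul_defect_iff (h : Relations q s t) (hq : ‖q‖ = 1)
    (hg : IsGenerated s t) {x : B} :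
    x ∈ closedIdeal {(1 - rangeProj s 1) * (1 - rangeProj t 1)} ↔
      x ∈ closedIdeal {1 - rangeProj s 1} ∧ x ∈ closedIdeal {1 - rangeProj t 1} := by
  have hq' : ‖star q‖ = 1 := by simpa using hq
  constructor
  · intro hx
    refine ⟨closedIdeal_le (isClosed_closedIdeal _) ?_ hx,
      closedIdeal_le (isClosed_closedIdeal _) ?_ hx⟩
    · rw [Set.singleton_subset_iff]
      exact TwoSidedIdeal.mul_mem_right _ _ _ (mem_closedIdeal_singleton _)
    · rw [Set.singleton_subset_iff]
      exact TwoSidedIdeal.mul_mem_left _ _ _ (mem_closedIdeal_singleton _)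
  · rintro ⟨h₁, h₂⟩
    rw [mem_closedIdeal_defect_iff h hq hg] at h₁
    rw [mem_closedIdeal_defect_iff h.swap hq' hg.swap] at h₂
    have h₄ := tendsto_one_sub_mul_one_sub_mul h.left h₁ h₂
    exact (isClosed_closedIdeal _).mem_of_tendsto h₄ (Eventually.of_forall fun k =>
      TwoSidedIdeal.mul_mem_right _ _ _
        (one_sub_mul_one_sub_mem h hq (mem_closedIdeal_singleton _) k k))

/-- A sum of two closed ideals is closed, if the first has an approximate unit `1 - e k` of norm
at most one, with `‖e k‖ ≤ 1`: an element of the sum has a decomposition of controlled norm. -/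
theorem isClosed_sup {I J : TwoSidedIdeal B} (hI : IsClosed (I : Set B))
    (hJ : IsClosed (J : Set B)) {e : ℕ → B} (he : ∀ k, ‖e k‖ ≤ 1) (he' : ∀ k, ‖1 - e k‖ ≤ 1)
    (hmem : ∀ k, 1 - e k ∈ I) (hlim : ∀ x ∈ I, Tendsto (fun k => e k * x) atTop (𝓝 0)) :
    IsClosed ((I ⊔ J : TwoSidedIdeal B) : Set B) := by
  let I' : AddSubgroup B := ⟨⟨⟨I, I.add_mem⟩, I.zero_mem⟩, I.neg_mem⟩
  let J' : AddSubgroup B := ⟨⟨⟨J, J.add_mem⟩, J.zero_mem⟩, J.neg_mem⟩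
  have : CompleteSpace I' := hI.completeSpace_coe
  let _f : I' × J' →+ B := (I'.subtype.comp (AddMonoidHom.fst I' J')) +
    (J'.subtype.comp (AddMonoidHom.snd I' J'))
  have : CompleteSpace J' := hJ.completeSpace_coe
  let f : NormedAddGroupHom (I' × J') B := _f.mkNormedAddGroupHom 2 fun x => by
    have h1 := norm_fst_le x
    have h2 := norm_snd_le x
    calc ‖(x.1 : B) + x.2‖ ≤ ‖(x.1 : B)‖ + ‖(x.2 : B)‖ := norm_add_le _ _
      _ ≤ 2 * ‖x‖ := by simp only [AddSubgroup.coe_norm] at *; linarith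
  have hf : ∀ x, f x = (x.1 : B) + x.2 := fun _ => rfl
  let K : AddSubgroup B :=
    ⟨⟨⟨(I ⊔ J : TwoSidedIdeal B), TwoSidedIdeal.add_mem _⟩, TwoSidedIdeal.zero_mem _⟩,
      TwoSidedIdeal.neg_mem _⟩
  have hK : ∀ x, x ∈ K ↔ ∃ y ∈ I, ∃ z ∈ J, y + z = x := fun x => TwoSidedIdeal.mem_sup
  have hsurj : f.SurjectiveOnWith K 2 := by
    intro x hx
    obtain ⟨y, hy, z, hz, rfl⟩ := (hK x).1 hx
    by_cases h0 : y + z = 0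
    · exact ⟨0, by simp [h0], by simp⟩
    · have hpos : 0 < ‖y + z‖ := norm_pos_iff.2 h0
      obtain ⟨k, hk⟩ := (((tendsto_zero_iff_norm_tendsto_zero.1 (hlim y hy)).eventually_lt_const
        hpos)).exists
      have m1 : (1 - e k) * (y + z) + e k * y ∈ I' :=
        I.add_mem (I.mul_mem_right _ _ (hmem k)) (I.mul_mem_left _ _ hy)
      have m2 : e k * z ∈ J' := J.mul_mem_left _ _ hz
      refine ⟨(⟨_, m1⟩, ⟨_, m2⟩), ?_, ?_⟩
      · rw [hf]; simp only; noncomm_ring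
      · have n1 : ‖(1 - e k) * (y + z) + e k * y‖ ≤ 2 * ‖y + z‖ := by
          have := (norm_mul_le (1 - e k) (y + z)).trans
            (mul_le_of_le_one_left (norm_nonneg _) (he' k))
          linarith [norm_add_le ((1 - e k) * (y + z)) (e k * y)]
        have n2 : ‖e k * z‖ ≤ 2 * ‖y + z‖ := by
          have h1 : e k * z = e k * (y + z) - e k * y := by rw [mul_add, add_sub_cancel_left]
          have := (norm_mul_le (e k) (y + z)).trans
            (mul_le_of_le_one_left (norm_nonneg _) (he k))
          rw [h1]
          linarith [norm_sub_le (e k * (y + z)) (e k * y)]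
        exact max_le n1 n2
  -- `f` maps onto `K` with a norm bound, so its range contains the closure of `K`
  have hcl := controlled_closure_of_complete (f := f) (K := K) (C := 2) (ε := 1) (by norm_num)
    one_pos hsurj
  refine isClosed_of_closure_subset fun x hx => ?_
  obtain ⟨g, hg, -⟩ := hcl x hx
  refine TwoSidedIdeal.mem_sup.2 ⟨g.1, g.1.2, g.2, g.2.2, ?_⟩
  rw [← hg, hf]

theorem closedIdeal_pair_defect (h : Relations q s t) (hq : ‖q‖ = 1) (hg : IsGenerated s t) :
    closedIdeal {1 - rangeProj s 1, 1 - rangeProj t 1} =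
      closedIdeal {1 - rangeProj s 1} ⊔ closedIdeal {1 - rangeProj t 1} := by
  apply le_antisymm
  · refine closedIdeal_le (isClosed_sup (isClosed_closedIdeal _) (isClosed_closedIdeal _)
      (norm_rangeProj_le h.left) (norm_one_sub_rangeProj_le h.left)
      (one_sub_rangeProj_mem (mem_closedIdeal_singleton _))
      fun x hx => (mem_closedIdeal_defect_iff h hq hg).1 hx) ?_
    rintro x (rfl | rfl)
    · exact TwoSidedIdeal.mem_sup_left (mem_closedIdeal_singleton _)
    · exact TwoSidedIdeal.mem_sup_right (mem_closedIdeal_singleton _)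
  · refine sup_le (closedIdeal_le (isClosed_closedIdeal _) ?_)
      (closedIdeal_le (isClosed_closedIdeal _) ?_)
    · exact Set.singleton_subset_iff.2 (subset_closedIdeal _ (Set.mem_insert _ _))
    · exact Set.singleton_subset_iff.2
        (subset_closedIdeal _ (Set.mem_insert_of_mem _ (Set.mem_singleton _)))

/-! ### Matrix blocks -/

section Block

variable {W : Type*} [DecidableEq W] {v : W → B} {f : B}

theorem mul_projection_of_ortho (hf : star f = f) (hff : f * f = f)
    (hv : ∀ a b, star (v a) * v b = if a = b then f else 0) (a : W) : v a * f = v a := by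
  have h1 : star (v a) * v a = f := by simpa using hv a a
  rw [← sub_eq_zero, ← CStarRing.star_mul_self_eq_zero_iff, star_sub, star_mul, hf, sub_mul,
    mul_sub, mul_sub, ← mul_assoc (star (v a)), mul_assoc f, mul_assoc f, ← mul_assoc (star (v a)),
    h1, hff, hff, sub_self]

variable [Fintype W]

/-- The `*`-homomorphism of the matrix algebra, in its operator norm, given by the matrix units
`v a * star (v b)`. -/
def blockHom (hf : star f = f) (hff : f * f = f)
    (hv : ∀ a b, star (v a) * v b = if a = b then f else 0) :
    (EuclideanSpace ℂ W →L[ℂ] EuclideanSpace ℂ W) →⋆ₙₐ[ℂ] B where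
  toFun T := ∑ a, ∑ b, (Matrix.toEuclideanCLM (n := W) (𝕜 := ℂ)).symm T a b • (v a * star (v b))
  map_smul' c T := by
    simp only [map_smul, Matrix.smul_apply, Finset.smul_sum, smul_smul, smul_eq_mul]
    rfl
  map_zero' := by simp
  map_add' S T := by
    simp only [map_add, Matrix.add_apply, add_smul, Finset.sum_add_distrib]
  map_mul' S T := by
    have key : ∀ (M : Matrix W W ℂ) (c : ℂ) (a d : W), (c • (v a * star (v d))) *
        (∑ e, ∑ b, M e b • (v e * star (v b))) = ∑ b, (c * M d b) • (v a * star (v b)) := by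
      intro M c a d
      rw [Finset.mul_sum, Finset.sum_eq_single d]
      · rw [Finset.mul_sum]
        refine Finset.sum_congr rfl fun b _ => ?_
        rw [smul_mul_smul_comm, mul_assoc, ← mul_assoc (star (v d)), hv d d, if_pos rfl,
          ← mul_assoc, mul_projection_of_ortho hf hff hv]
      · intro e _ he
        rw [Finset.mul_sum]
        refine Finset.sum_eq_zero fun b _ => ?_
        rw [smul_mul_smul_comm, mul_assoc, ← mul_assoc (star (v d)), hv d e, if_neg he.symm,
          zero_mul, mul_zero, smul_zero]
      · simp
    rw [Finset.sum_mul]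
    refine Finset.sum_congr rfl fun a _ => ?_
    rw [Finset.sum_mul]
    simp_rw [key, map_mul, Matrix.mul_apply, Finset.sum_smul]
    exact Finset.sum_comm
  map_star' T := by
    simp only [map_star, star_sum, star_smul, star_mul, star_star, Matrix.star_apply]
    exact Finset.sum_comm

/-- A matrix block of norm more than `c` has a matrix coefficient of modulus more than `c` along
two vectors of the unit ball. -/
theorem exists_lt_norm_coefficient (hf : star f = f) (hff : f * f = f)
    (hv : ∀ a b, star (v a) * v b = if a = b then f else 0) (C : W → W → ℂ) {c : ℝ}
    (hc : 0 ≤ c) (hC : c < ‖∑ a, ∑ b, C a b • (v a * star (v b))‖) :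
    ∃ ξ η : W → ℂ, ∑ a, ‖ξ a‖ ^ 2 ≤ 1 ∧ ∑ a, ‖η a‖ ^ 2 ≤ 1 ∧
      c < ‖∑ a, ∑ b, star (ξ a) * C a b * η b‖ := by
  set T := Matrix.toEuclideanCLM (n := W) (𝕜 := ℂ) (Matrix.of C) with hT
  have h1 : blockHom hf hff hv T = ∑ a, ∑ b, C a b • (v a * star (v b)) := by
    simp [blockHom, hT]
  have h2 : c < ‖T‖ := by
    rw [← h1] at hC
    exact hC.trans_le (NonUnitalStarAlgHom.norm_apply_le (blockHom hf hff hv) T)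
  obtain ⟨η, hη, hcη⟩ := T.exists_lt_apply_of_lt_opNorm h2
  have hpos : 0 < ‖T η‖ := hc.trans_lt hcη
  have hTη : ∀ a, T η a = ∑ b, C a b * η b := by
    intro a
    rw [hT, Matrix.ofLp_toEuclideanCLM]
    rfl
  refine ⟨fun a => (‖T η‖⁻¹ : ℂ) * T η a, fun a => η a, ?_, ?_, ?_⟩
  · have : ∑ a, ‖(‖T η‖⁻¹ : ℂ) * T η a‖ ^ 2 = ‖T η‖⁻¹ ^ 2 * ‖T η‖ ^ 2 := by
      rw [EuclideanSpace.norm_sq_eq (T η), Finset.mul_sum]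
      refine Finset.sum_congr rfl fun a _ => ?_
      rw [norm_mul, mul_pow]
      simp
    rw [this, ← mul_pow, inv_mul_cancel₀ hpos.ne', one_pow]
  · rw [← EuclideanSpace.norm_sq_eq η]
    nlinarith [norm_nonneg η]
  · have : ∑ a, ∑ b, star ((‖T η‖⁻¹ : ℂ) * T η a) * C a b * η b = (‖T η‖ : ℂ) := by
      have e : ∀ a, ∑ b, star ((‖T η‖⁻¹ : ℂ) * T η a) * C a b * η b =
          (‖T η‖⁻¹ : ℂ) * (‖T η a‖ ^ 2 : ℝ) := by
        intro a
        simp_rw [mul_assoc]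
        rw [← Finset.mul_sum, ← hTη, star_mul', mul_assoc]
        have h3 : star (T η a) * T η a = ((‖T η a‖ ^ 2 : ℝ) : ℂ) := by
          simpa using RCLike.conj_mul (T η a)
        rw [h3]
        simp
      simp_rw [e]
      rw [← Finset.mul_sum, ← Complex.ofReal_sum, ← EuclideanSpace.norm_sq_eq (T η)]
      have : (‖T η‖ : ℂ) ≠ 0 := by exact_mod_cast hpos.ne'
      push_cast
      field_simp
    rw [this]
    simpa using hcη

theorem norm_sum_smul_le (hf : star f = f) (hff : f * f = f)
    (hv : ∀ a b, star (v a) * v b = if a = b then f else 0) {ξ : W → ℂ}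
    (hξ : ∑ a, ‖ξ a‖ ^ 2 ≤ 1) : ‖∑ a, ξ a • v a‖ ≤ 1 := by
  have h1 : star (∑ a, ξ a • v a) * ∑ a, ξ a • v a = ((∑ a, ‖ξ a‖ ^ 2 : ℝ) : ℂ) • f := by
    rw [star_sum, Finset.sum_mul, Complex.ofReal_sum, Finset.sum_smul]
    refine Finset.sum_congr rfl fun a _ => ?_
    rw [Finset.mul_sum, Finset.sum_eq_single a]
    · rw [star_smul, smul_mul_smul_comm, hv a a, if_pos rfl]
      congr 1
      simpa using RCLike.conj_mul (ξ a)
    · intro b _ hb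
      rw [star_smul, smul_mul_smul_comm, hv a b, if_neg hb.symm, smul_zero]
    · simp
  have h2 := CStarRing.norm_star_mul_self (x := ∑ a, ξ a • v a)
  rw [h1, norm_smul, Complex.norm_real, Real.norm_eq_abs,
    abs_of_nonneg (Finset.sum_nonneg fun a _ => sq_nonneg _)] at h2
  have h3 := norm_le_one_of_projection hf hff
  have h4 : (∑ a, ‖ξ a‖ ^ 2) * ‖f‖ ≤ 1 * 1 :=
    mul_le_mul hξ h3 (norm_nonneg _) zero_le_one
  nlinarith [norm_nonneg (∑ a, ξ a • v a)]

/-- If `b'` and, after a further compression by `u`, also `b` have the same scalar matrix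
coefficients along the matrix units `v a * star (v b)`, and the block of `b'` has norm more than
`c`, then a closed ideal that contains an element at distance at most `c` from `b` contains `f`. -/
theorem projection_mem_of_block {J : TwoSidedIdeal B} {u x b b' : B} {c : ℝ}
    (hf : star f = f) (hff : f * f = f)
    (hv : ∀ a b, star (v a) * v b = if a = b then f else 0) (hu : ‖u‖ ≤ 1)
    (hb : ∀ i j, ∃ C : ℂ, star (v i) * b' * v j = C • f ∧
      star u * (star (v i) * b * v j) * u = C • f)
    (hx : x ∈ J) (hc : 0 ≤ c) (hxb : ‖x - b‖ ≤ c)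
    (hR : c < ‖(∑ a, v a * star (v a)) * b' * ∑ a, v a * star (v a)‖) : f ∈ J := by
  choose C hC hC' using hb
  have e : (∑ a, v a * star (v a)) * b' * ∑ a, v a * star (v a) =
      ∑ i, ∑ j, C i j • (v i * star (v j)) := by
    rw [Finset.sum_mul, Finset.sum_mul]
    refine Finset.sum_congr rfl fun i _ => ?_
    rw [Finset.mul_sum]
    refine Finset.sum_congr rfl fun j _ => ?_
    calc v i * star (v i) * b' * (v j * star (v j))
        = v i * (star (v i) * b' * v j) * star (v j) := by
          simp only [mul_assoc]
      _ = _ := by rw [hC, mul_smul_comm, smul_mul_assoc, mul_projection_of_ortho hf hff hv]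
  rw [e] at hR
  obtain ⟨ξ, η, hξ, hη, hlt⟩ := exists_lt_norm_coefficient hf hff hv C hc hR
  set V := ∑ a, ξ a • v a with hV
  set V' := ∑ a, η a • v a with hV'
  have hVn : ‖V‖ ≤ 1 := norm_sum_smul_le hf hff hv hξ
  have hVn' : ‖V'‖ ≤ 1 := norm_sum_smul_le hf hff hv hη
  refine projection_mem_of_norm_sub_lt (y := star u * (star V * x * V') * u)
    (c := ∑ a, ∑ b, star (ξ a) * C a b * η b) hf hff
    (J.mul_mem_right _ _ (J.mul_mem_left _ _ (J.mul_mem_right _ _ (J.mul_mem_left _ _ hx)))) ?_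
  have e2 : (∑ a, ∑ b, star (ξ a) * C a b * η b) • f = star u * (star V * b * V') * u := by
    rw [hV, hV', star_sum, Finset.sum_smul, Finset.sum_mul, Finset.sum_mul, Finset.mul_sum,
      Finset.sum_mul]
    refine Finset.sum_congr rfl fun i _ => ?_
    rw [Finset.sum_smul, Finset.mul_sum, Finset.mul_sum, Finset.sum_mul]
    refine Finset.sum_congr rfl fun j _ => ?_
    rw [star_smul, smul_mul_assoc, smul_mul_assoc, mul_smul_comm, mul_smul_comm, mul_smul_comm,
      smul_mul_assoc, smul_mul_assoc, hC', smul_smul, smul_smul]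
    congr 1
    ring
  have e3 : star u * (star V * x * V') * u - star u * (star V * b * V') * u =
      star u * (star V * (x - b) * V') * u := by noncomm_ring
  rw [e2, e3]
  refine lt_of_le_of_lt ?_ hlt
  calc ‖star u * (star V * (x - b) * V') * u‖
      ≤ ‖star u‖ * (‖star V‖ * ‖x - b‖ * ‖V'‖) * ‖u‖ :=
        (norm_mul_le _ _).trans (by
          gcongr
          refine (norm_mul_le _ _).trans ?_
          gcongr
          refine (norm_mul_le _ _).trans ?_
          gcongr
          exact norm_mul_le _ _)
    _ ≤ 1 * (1 * c * 1) * 1 := by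
        rw [norm_star, norm_star]; gcongr
    _ = c := by ring

end Block

/-! ### The gauge action -/

/-- An action by `*`-endomorphisms that multiplies the two families by independent phases. -/
structure IsGauge (γ : Circle → Circle → B →⋆ₐ[ℂ] B) (s : Fin n → B) (t : Fin m → B) : Prop where
  map_s : ∀ z w i, γ z w (s i) = (z : ℂ) • s i
  map_t : ∀ z w r, γ z w (t r) = (w : ℂ) • t r

theorem IsGauge.swap {γ : Circle → Circle → B →⋆ₐ[ℂ] B} (h : IsGauge γ s t) :
    IsGauge (fun z w => γ w z) t s :=
  ⟨fun z w r => h.map_t w z r, fun z w i => h.map_s w z i⟩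

theorem IsGauge.map_word {γ : Circle → Circle → B →⋆ₐ[ℂ] B} (h : IsGauge γ s t) (z w : Circle)
    (μ : List (Fin n)) : γ z w (word s μ) = (z : ℂ) ^ μ.length • word s μ := by
  induction μ with
  | nil => simp
  | cons i μ ih =>
    rw [word_cons, map_mul, ih, h.map_s, smul_mul_smul_comm, List.length_cons, pow_succ']

theorem IsGauge.map_word_mul_star {γ : Circle → Circle → B →⋆ₐ[ℂ] B} (h : IsGauge γ s t)
    (z w : Circle) (μ ν : List (Fin n)) : γ z w (word s μ * star (word s ν)) =
      ((z : ℂ) ^ μ.length * star (z : ℂ) ^ ν.length) • (word s μ * star (word s ν)) := by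
  rw [map_mul, map_star, h.map_word, h.map_word, star_smul, smul_mul_smul_comm, star_pow]

/-- The gauge action is continuous at the neutral element, pointwise. -/
theorem IsGauge.tendsto {γ : Circle → Circle → B →⋆ₐ[ℂ] B} (h : IsGauge γ s t)
    (hg : IsGenerated s t) (x : B) :
    Tendsto (fun p : Circle × Circle => γ p.1 p.2 x) (𝓝 1) (𝓝 x) := by
  let A : Subalgebra ℂ B :=
    { carrier := {x | Tendsto (fun p : Circle × Circle => γ p.1 p.2 x) (𝓝 1) (𝓝 x)}
      mul_mem' := fun {a b} ha hb => by
        simp only [Set.mem_ofPred_eq, map_mul] at *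
        exact ha.mul hb
      add_mem' := fun {a b} ha hb => by
        simp only [Set.mem_ofPred_eq, map_add] at *
        exact ha.add hb
      algebraMap_mem' := fun c => by
        simp only [Set.mem_ofPred_eq, AlgHomClass.commutes]
        exact tendsto_const_nhds }
  have hA : IsClosed (A : Set B) := by
    refine isClosed_of_closure_subset fun x hx => ?_
    refine Metric.tendsto_nhds.2 fun ε hε => ?_
    obtain ⟨y, hy, hxy⟩ := Metric.mem_closure_iff.1 hx (ε / 3) (by positivity)
    filter_upwards [Metric.tendsto_nhds.1 (show Tendsto _ _ _ from hy) (ε / 3) (by positivity)]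
      with p hp
    have h1 : dist (γ p.1 p.2 x) (γ p.1 p.2 y) ≤ dist x y := by
      rw [dist_eq_norm, dist_eq_norm, ← map_sub]
      exact NonUnitalStarAlgHom.norm_apply_le _ _
    have h2 := dist_triangle4 (γ p.1 p.2 x) (γ p.1 p.2 y) y x
    rw [dist_comm y x] at h2
    linarith
  have hA' : ∀ x ∈ A, star x ∈ A := fun x hx => by
    change Tendsto _ _ _
    simp_rw [map_star]
    exact (continuous_star.tendsto x).comp hx
  have hs : ∀ i, s i ∈ A := fun i => by
    change Tendsto _ _ _
    simp_rw [h.map_s]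
    have : Continuous fun p : Circle × Circle => (p.1 : ℂ) • s i := by fun_prop
    simpa using this.tendsto 1
  have ht : ∀ r, t r ∈ A := fun r => by
    change Tendsto _ _ _
    simp_rw [h.map_t]
    have : Continuous fun p : Circle × Circle => (p.2 : ℂ) • t r := by fun_prop
    simpa using this.tendsto 1
  have := hg A hA (fun i => ⟨hs i, hA' _ (hs i)⟩) (fun r => ⟨ht r, hA' _ (ht r)⟩)
  exact (this ▸ Algebra.mem_top : x ∈ A)

/-- The average of the gauge action over the pairs of `N`-th roots of unity. -/
def gaugeAvg (γ : Circle → Circle → B →⋆ₐ[ℂ] B) (N : ℕ) (x : B) : B :=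
  ((N : ℂ) ^ 2)⁻¹ • ∑ p ∈ Finset.range N ×ˢ Finset.range N,
    γ (Circle.exp (2 * Real.pi * p.1 / N)) (Circle.exp (2 * Real.pi * p.2 / N)) x

theorem gaugeAvg_add (γ : Circle → Circle → B →⋆ₐ[ℂ] B) (N : ℕ) (x y : B) :
    gaugeAvg γ N (x + y) = gaugeAvg γ N x + gaugeAvg γ N y := by
  simp [gaugeAvg, Finset.sum_add_distrib]

theorem gaugeAvg_smul (γ : Circle → Circle → B →⋆ₐ[ℂ] B) (N : ℕ) (c : ℂ) (x : B) :
    gaugeAvg γ N (c • x) = c • gaugeAvg γ N x := by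
  simp only [gaugeAvg, map_smul, ← Finset.smul_sum]
  rw [smul_comm]

theorem norm_gaugeAvg_le (γ : Circle → Circle → B →⋆ₐ[ℂ] B) (N : ℕ) (x : B) :
    ‖gaugeAvg γ N x‖ ≤ ‖x‖ := by
  rcases Nat.eq_zero_or_pos N with rfl | hN
  · simp [gaugeAvg]
  rw [gaugeAvg, norm_smul]
  have h1 : ‖∑ p ∈ Finset.range N ×ˢ Finset.range N, γ (Circle.exp (2 * Real.pi * p.1 / N))
      (Circle.exp (2 * Real.pi * p.2 / N)) x‖ ≤ (N : ℝ) ^ 2 * ‖x‖ := by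
    refine (norm_sum_le_of_le _ fun p _ => NonUnitalStarAlgHom.norm_apply_le _ x).trans ?_
    simp [sq]
  have h2 : ‖((N : ℂ) ^ 2)⁻¹‖ = ((N : ℝ) ^ 2)⁻¹ := by simp
  rw [h2, inv_mul_le_iff₀ (by positivity)]
  exact h1

/-- A power sum over the `N`-th roots of unity. -/
theorem sum_root_pow_mul_star_pow {N a b : ℕ} (ha : a < N) (hb : b < N) (hab : a ≠ b) :
    ∑ j ∈ Finset.range N, ((Circle.exp (2 * Real.pi * j / N) : Circle) : ℂ) ^ a *
      star ((Circle.exp (2 * Real.pi * j / N) : Circle) : ℂ) ^ b = 0 := by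
  have hN : N ≠ 0 := by omega
  set ω : ℂ := Complex.exp (2 * Real.pi * Complex.I / N) with hω
  have hprim : IsPrimitiveRoot ω N := Complex.isPrimitiveRoot_exp N hN
  have hωω : ω * star ω = 1 := by
    have : ‖ω‖ = 1 := hprim.norm'_eq_one hN
    simpa [this] using RCLike.mul_conj ω
  have hj : ∀ j : ℕ, ((Circle.exp (2 * Real.pi * j / N) : Circle) : ℂ) = ω ^ j := by
    intro j
    rw [Circle.coe_exp, hω, ← Complex.exp_nat_mul]
    congr 1
    push_cast
    ring
  have hx : ∀ j : ℕ, ((Circle.exp (2 * Real.pi * j / N) : Circle) : ℂ) ^ a *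
      star ((Circle.exp (2 * Real.pi * j / N) : Circle) : ℂ) ^ b = (ω ^ a * star ω ^ b) ^ j := by
    intro j
    rw [hj, star_pow, mul_pow, ← pow_mul, ← pow_mul, ← pow_mul, ← pow_mul, mul_comm j a,
      mul_comm j b]
  simp_rw [hx]
  have hne : ω ^ a * star ω ^ b ≠ 1 := by
    intro h1
    have : ω ^ a = ω ^ b := by
      calc ω ^ a = ω ^ a * (ω * star ω) ^ b := by rw [hωω, one_pow, mul_one]
        _ = (ω ^ a * star ω ^ b) * ω ^ b := by rw [mul_pow]; ring
        _ = ω ^ b := by rw [h1, one_mul]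
    exact hab (hprim.pow_inj ha hb this)
  have hpow : (ω ^ a * star ω ^ b) ^ N = 1 := by
    rw [mul_pow, ← pow_mul, ← pow_mul, mul_comm a, mul_comm b, pow_mul, pow_mul, ← star_pow,
      hprim.pow_eq_one]
    simp
  have := geom_sum_eq hne N
  rw [this, hpow, sub_self, zero_div]

/-- The average of a monomial is the monomial or zero. -/
theorem IsGauge.gaugeAvg_monomial {γ : Circle → Circle → B →⋆ₐ[ℂ] B} (h : IsGauge γ s t) {N : ℕ}
    {μ ν : List (Fin n)} {α β : List (Fin m)} (hμ : μ.length < N) (hν : ν.length < N)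
    (hα : α.length < N) (hβ : β.length < N) :
    gaugeAvg γ N (word s μ * star (word s ν) * (word t α * star (word t β))) =
      if μ.length = ν.length ∧ α.length = β.length then
        word s μ * star (word s ν) * (word t α * star (word t β)) else 0 := by
  have hN : (N : ℂ) ≠ 0 := by
    have : N ≠ 0 := by omega
    exact_mod_cast this
  have e : ∀ z w, γ z w (word s μ * star (word s ν) * (word t α * star (word t β))) =
      (((z : ℂ) ^ μ.length * star (z : ℂ) ^ ν.length) *
        ((w : ℂ) ^ α.length * star (w : ℂ) ^ β.length)) •
        (word s μ * star (word s ν) * (word t α * star (word t β))) := by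
    intro z w
    rw [map_mul, h.map_word_mul_star, h.swap.map_word_mul_star w z, smul_mul_smul_comm]
  have hz : ∀ (z : Circle) (a : ℕ), (z : ℂ) ^ a * star (z : ℂ) ^ a = 1 := by
    intro z a
    rw [← mul_pow]
    have : (z : ℂ) * star (z : ℂ) = 1 := by
      have h1 := RCLike.mul_conj (z : ℂ)
      rw [Circle.norm_coe] at h1
      simpa using h1
    rw [this, one_pow]
  rw [gaugeAvg]
  simp_rw [e]
  rw [← Finset.sum_smul, Finset.sum_product, smul_smul]
  simp_rw [← Finset.mul_sum]
  rw [← Finset.sum_mul]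
  split_ifs with hl
  · rw [hl.1, hl.2]
    simp only [hz, Finset.sum_const, Finset.card_range, nsmul_eq_mul, mul_one]
    rw [← sq, inv_mul_cancel₀ (pow_ne_zero 2 hN), one_smul]
  · rw [not_and_or] at hl
    rcases hl with hl | hl
    · rw [sum_root_pow_mul_star_pow hμ hν hl]; simp
    · rw [sum_root_pow_mul_star_pow hα hβ hl]; simp

/-- Averages of positive elements over the roots of unity are bounded below, uniformly in
compressions: the roots in a fixed small arc are a fixed proportion, and on them the gauge action
moves the element only a little. -/
theorem IsGauge.exists_le_norm_gaugeAvg {γ : Circle → Circle → B →⋆ₐ[ℂ] B} (h : IsGauge γ s t)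
    (hg : IsGenerated s t) (z : B) {δ : ℝ} (hδ : 0 < δ) :
    ∃ c > 0, ∃ K > 0, ∀ L > 0, ∀ R : B, ‖R‖ ≤ 1 → star R = R → δ ≤ ‖R * z‖ →
      c ≤ ‖R * gaugeAvg γ (K * L) (z * star z) * R‖ := by
  let _ : PartialOrder B := CStarAlgebra.spectralOrder B
  have _ : StarOrderedRing B := CStarAlgebra.spectralOrderedRing B
  set x := z * star z with hx
  have hcont : Tendsto (fun p : ℝ × ℝ => γ (Circle.exp p.1) (Circle.exp p.2) x) (𝓝 0) (𝓝 x) := by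
    have h1 : Continuous fun p : ℝ × ℝ => (Circle.exp p.1, Circle.exp p.2) := by fun_prop
    have h2 := h1.tendsto 0
    simp only [Prod.fst_zero, Prod.snd_zero, Circle.exp_zero] at h2
    exact (h.tendsto hg x).comp h2
  obtain ⟨ε, hε, hγ⟩ := Metric.tendsto_nhds_nhds.1 hcont (δ ^ 2 / 2) (by positivity)
  obtain ⟨K, hK⟩ := exists_nat_gt (2 * Real.pi / ε)
  have hK0 : 0 < K := by
    have : (0 : ℝ) < K := lt_trans (by positivity) hK
    exact_mod_cast this
  have hKr : (0 : ℝ) < K := by exact_mod_cast hK0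
  refine ⟨(K ^ 2 : ℝ)⁻¹ * (δ ^ 2 / 2), by positivity, K, hK0, fun L hL R hR hR' hRz => ?_⟩
  have hLr : (0 : ℝ) < L := by exact_mod_cast hL
  set g : ℕ × ℕ → B := fun p => R * γ (Circle.exp (2 * Real.pi * p.1 / (K * L : ℕ)))
    (Circle.exp (2 * Real.pi * p.2 / (K * L : ℕ))) x * R with hgdef
  have hg0 : ∀ p, 0 ≤ g p := by
    intro p
    simp only [hgdef, hx, map_mul, map_star]
    rw [← mul_assoc, mul_assoc (R * _)]
    nth_rw 2 [← hR']
    rw [← star_mul]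
    exact mul_star_self_nonneg _
  set S := Finset.range L ×ˢ Finset.range L
  set S' := Finset.range (K * L) ×ˢ Finset.range (K * L)
  have hSS : S ⊆ S' := Finset.product_subset_product
    (Finset.range_subset_range.2 (Nat.le_mul_of_pos_left L hK0))
    (Finset.range_subset_range.2 (Nat.le_mul_of_pos_left L hK0))
  have h1 : ‖∑ p ∈ S, g p‖ ≤ ‖∑ p ∈ S', g p‖ :=
    CStarAlgebra.norm_le_norm_of_nonneg_of_le (Finset.sum_nonneg fun p _ => hg0 p)
      (Finset.sum_le_sum_of_subset_of_nonneg hSS fun p _ _ => hg0 p)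
  -- the first `L` of the `K * L` roots lie in an arc that does not depend on `L`
  have hangle : ∀ j ∈ Finset.range L, |2 * Real.pi * j / (K * L : ℕ)| < ε := by
    intro j hj
    rw [Finset.mem_range] at hj
    have hjr : (j : ℝ) ≤ L := by exact_mod_cast hj.le
    rw [abs_of_nonneg (by positivity)]
    push_cast
    rw [div_lt_iff₀ hε] at hK
    rw [div_lt_iff₀ (by positivity)]
    nlinarith [Real.pi_pos]
  have h2 : ‖(L ^ 2 : ℝ) • (R * x * R) - ∑ p ∈ S, g p‖ ≤ L ^ 2 * (δ ^ 2 / 2) := by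
    have e : (L ^ 2 : ℝ) • (R * x * R) = ∑ p ∈ S, R * x * R := by
      rw [Finset.sum_const, Finset.card_product, Finset.card_range, ← sq,
        ← Nat.cast_smul_eq_nsmul ℝ]
      push_cast
      rfl
    rw [e, ← Finset.sum_sub_distrib]
    refine (norm_sum_le_of_le S (f := fun p => R * x * R - g p) (n := fun _ => δ ^ 2 / 2)
      fun p hp => ?_).trans_eq ?_
    · rw [Finset.mem_product] at hp
      have hd := hγ (x := (2 * Real.pi * p.1 / (K * L : ℕ), 2 * Real.pi * p.2 / (K * L : ℕ)))
        (by
          rw [dist_zero_right, Prod.norm_def]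
          exact max_lt (hangle _ hp.1) (hangle _ hp.2))
      rw [dist_comm, dist_eq_norm] at hd
      have e2 : R * x * R - g p = R * (x - γ (Circle.exp (2 * Real.pi * p.1 / (K * L : ℕ)))
          (Circle.exp (2 * Real.pi * p.2 / (K * L : ℕ))) x) * R := by
        simp only [hgdef]; noncomm_ring
      rw [e2]
      calc _ ≤ ‖R‖ * ‖x - _‖ * ‖R‖ := (norm_mul_le _ _).trans (by gcongr; exact norm_mul_le _ _)
        _ ≤ 1 * (δ ^ 2 / 2) * 1 := by gcongr
        _ = δ ^ 2 / 2 := by ring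
    · rw [Finset.sum_const, Finset.card_product, Finset.card_range]
      simp [sq]
  have h3 : δ ^ 2 ≤ ‖R * x * R‖ := by
    have e : R * x * R = (R * z) * star (R * z) := by
      rw [star_mul, hR', hx]; simp only [mul_assoc]
    rw [e, CStarRing.norm_self_mul_star, ← sq]
    gcongr
  have h4 : L ^ 2 * (δ ^ 2 / 2) ≤ ‖∑ p ∈ S', g p‖ := by
    have h5 : ‖(L ^ 2 : ℝ) • (R * x * R)‖ = L ^ 2 * ‖R * x * R‖ := by
      rw [norm_smul]; simp
    have h6 := norm_le_norm_add_norm_sub' ((L ^ 2 : ℝ) • (R * x * R)) (∑ p ∈ S, g p)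
    have h7 : (L : ℝ) ^ 2 * δ ^ 2 ≤ L ^ 2 * ‖R * x * R‖ := by gcongr
    linarith
  have h8 : R * gaugeAvg γ (K * L) x * R = (((K * L : ℕ) : ℂ) ^ 2)⁻¹ • ∑ p ∈ S', g p := by
    rw [gaugeAvg, mul_smul_comm, smul_mul_assoc, Finset.mul_sum, Finset.sum_mul]
  rw [h8, norm_smul]
  have h9 : ‖(((K * L : ℕ) : ℂ) ^ 2)⁻¹‖ = ((K : ℝ) ^ 2)⁻¹ * ((L : ℝ) ^ 2)⁻¹ := by
    simp [mul_pow, mul_comm]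
  rw [h9, mul_assoc]
  gcongr
  rw [le_inv_mul_iff₀ (by positivity)]
  exact h4

/-! ### Monomials -/

/-- The monomials `(s_μ s_ν⋆) (t_α t_β⋆)`, whose span is dense. -/
def monomials (s : Fin n → B) (t : Fin m → B) : Set B :=
  {x | ∃ μ ν : List (Fin n), ∃ α β : List (Fin m),
    x = word s μ * star (word s ν) * (word t α * star (word t β))}

theorem word_mul_star_word_mem_monoid (μ ν : List (Fin n)) :
    word s μ * star (word s ν) ∈ monoid s :=
  mul_mem (word_mem_monoid μ) (star_mem_monoid (word_mem_monoid ν))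

theorem star_mul_word_mul_star_word (h : OrthoIsometries s) (i : Fin n) (μ ν : List (Fin n)) :
    star (s i) * (word s μ * star (word s ν)) = 0 ∨
      ∃ μ' ν', star (s i) * (word s μ * star (word s ν)) = word s μ' * star (word s ν') := by
  cases μ with
  | nil =>
    refine Or.inr ⟨[], ν ++ [i], ?_⟩
    simp [word_append]
  | cons j μ =>
    rw [word_cons, ← mul_assoc, ← mul_assoc, h i j]
    split_ifs
    · exact Or.inr ⟨μ, ν, by simp⟩
    · simp

theorem topologicalClosure_span_monomials (h : Relations q s t) (hq : ‖q‖ = 1)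
    (hg : IsGenerated s t) (x : B) :
    x ∈ (Submodule.span ℂ (monomials s t)).topologicalClosure := by
  set L := (Submodule.span ℂ (monomials s t)).topologicalClosure with hL
  have hLc : IsClosed (L : Set B) := Submodule.isClosed_topologicalClosure _
  have hsub : ∀ y ∈ monomials s t, y ∈ L := fun y hy =>
    Submodule.le_topologicalClosure _ (Submodule.subset_span hy)
  -- it suffices to multiply monomials by generators
  have hred : ∀ g : B, (∀ y ∈ monomials s t, g * y ∈ L) → ∀ y ∈ L, g * y ∈ L := by
    intro g hgm y hy
    have h1 : Submodule.span ℂ (monomials s t) ≤ L.comap (LinearMap.mulLeft ℂ g) :=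
      Submodule.span_le.2 fun y hy => hgm y hy
    have h2 : (Submodule.span ℂ (monomials s t)).topologicalClosure ≤
        L.comap (LinearMap.mulLeft ℂ g) :=
      Submodule.topologicalClosure_minimal _ h1 (hLc.preimage (continuous_const_mul g))
    exact h2 hy
  have h1 : (1 : B) ∈ L := hsub 1 ⟨[], [], [], [], by simp⟩
  have := hg.mul_mem (L := L) hLc (fun i y hy => ⟨hred _ ?_ y hy, hred _ ?_ y hy⟩)
    (fun r y hy => ⟨hred _ ?_ y hy, hred _ ?_ y hy⟩) x h1
  · simpa using this
  · rintro _ ⟨μ, ν, α, β, rfl⟩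
    exact hsub _ ⟨i :: μ, ν, α, β, by simp [mul_assoc]⟩
  · rintro _ ⟨μ, ν, α, β, rfl⟩
    rw [← mul_assoc]
    rcases star_mul_word_mul_star_word h.left i μ ν with h0 | ⟨μ', ν', h0⟩
    · rw [h0, zero_mul]; exact L.zero_mem
    · rw [h0]; exact hsub _ ⟨μ', ν', α, β, rfl⟩
  · rintro _ ⟨μ, ν, α, β, rfl⟩
    obtain ⟨c, -, hc⟩ := (h.qComm hq (word_mul_star_word_mem_monoid μ ν) (mem_monoid r)).symm
    rw [← mul_assoc, hc, smul_mul_assoc, mul_assoc _ (t r)]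
    exact L.smul_mem c (hsub _ ⟨μ, ν, r :: α, β, by simp [mul_assoc]⟩)
  · rintro _ ⟨μ, ν, α, β, rfl⟩
    obtain ⟨c, -, hc⟩ := (h.qComm hq (word_mul_star_word_mem_monoid μ ν)
      (star_mem_monoid (mem_monoid r))).symm
    rw [← mul_assoc, hc, smul_mul_assoc, mul_assoc _ (star (t r))]
    refine L.smul_mem c ?_
    rcases star_mul_word_mul_star_word h.right r α β with h0 | ⟨α', β', h0⟩
    · rw [h0, mul_zero]; exact L.zero_mem
    · rw [h0]; exact hsub _ ⟨μ, ν, α', β', rfl⟩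

/-! ### Compressions -/

/-- A system of partial isometries `v a` in one family, with common source projection `f`, that
compresses the monomials `s_μ s_ν⋆` with `|μ| = |ν| ≤ k` to multiples of `f`; a further
compression by `u` kills the monomials with `|μ| ≠ |ν|`. The projection `f` is `1` or the defect
projection, and the sum of the range projections `v a * star (v a)` is `rangeProj s k` or the
defect projection; hence `f` and this sum commute with the other family. -/
structure Compression (s : Fin n → B) (k : ℕ) {W : Type} [Fintype W] [DecidableEq W]
    (v : W → B) (f u : B) : Prop where
  v_mem : ∀ a, v a ∈ monoid s
  u_mem : u ∈ monoid s
  f_eq : f = 1 ∨ f = 1 - rangeProj s 1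
  sum_eq : ∑ a, v a * star (v a) = rangeProj s k ∨ ∑ a, v a * star (v a) = 1 - rangeProj s 1
  ortho : ∀ a b, star (v a) * v b = if a = b then f else 0
  norm_u_le : ‖u‖ ≤ 1
  star_u_mul_mul_u : star u * f * u = f
  balanced : ∀ a b (μ ν : List (Fin n)), μ.length ≤ k → ν.length ≤ k → μ.length = ν.length →
    ∃ c : ℂ, star (v a) * (word s μ * star (word s ν)) * v b = c • f
  unbalanced : ∀ a b (μ ν : List (Fin n)), μ.length ≤ k → ν.length ≤ k → μ.length ≠ ν.length →
    star u * (star (v a) * (word s μ * star (word s ν)) * v b) * u = 0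

/-- Compression by the words of length `k`. -/
theorem compression_word (h : OrthoIsometries s) {i j : Fin n} (hij : i ≠ j) (k : ℕ) :
    Compression s k (fun μ : Fin k → Fin n => word s (List.ofFn μ)) 1
      (word s (List.replicate k i ++ [j])) := by
  -- `v⋆ s_μ` is zero or the adjoint of a word of length `k - |μ|`
  have key : ∀ (a : Fin k → Fin n) (μ : List (Fin n)), μ.length ≤ k →
      star (word s (List.ofFn a)) * word s μ = 0 ∨ ∃ κ : List (Fin n),
        κ.length + μ.length = k ∧ star (word s (List.ofFn a)) * word s μ = star (word s κ) := by
    intro a μ hμ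
    rcases star_word_mul_word_of_length_le h (μ := μ) (ν := List.ofFn a) (by simpa using hμ)
      with h0 | ⟨κ, hκ, h0⟩
    · left; simpa using congrArg star h0
    · exact Or.inr ⟨κ, by simpa using hκ, by simpa using congrArg star h0⟩
  have key2 : ∀ (a b : Fin k → Fin n) (μ ν : List (Fin n)), μ.length ≤ k → ν.length ≤ k →
      star (word s (List.ofFn a)) * (word s μ * star (word s ν)) * word s (List.ofFn b) = 0 ∨
      ∃ κ κ' : List (Fin n), κ.length + μ.length = k ∧ κ'.length + ν.length = k ∧
        star (word s (List.ofFn a)) * (word s μ * star (word s ν)) * word s (List.ofFn b) =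
          star (word s κ) * word s κ' := by
    intro a b μ ν hμ hν
    have e : star (word s (List.ofFn a)) * (word s μ * star (word s ν)) * word s (List.ofFn b) =
        (star (word s (List.ofFn a)) * word s μ) *
          star (star (word s (List.ofFn b)) * word s ν) := by
      simp [mul_assoc]
    rw [e]
    rcases key a μ hμ with h0 | ⟨κ, hκ, h0⟩
    · left; rw [h0, zero_mul]
    rcases key b ν hν with h1 | ⟨κ', hκ', h1⟩
    · left; rw [h1, star_zero, mul_zero]
    · exact Or.inr ⟨κ, κ', hκ, hκ', by rw [h0, h1, star_star]⟩
  refine ⟨fun a => word_mem_monoid _, word_mem_monoid _, Or.inl rfl,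
    Or.inl (rangeProj_eq_sum_word k).symm, fun a b => ?_, norm_word_le h _, ?_, ?_, ?_⟩
  · rw [star_word_mul_word_of_length_eq h (by simp)]
    simp [List.ofFn_inj]
  · rw [mul_one, star_word_mul_self h]
  · intro a b μ ν hμ hν hl
    rcases key2 a b μ ν hμ hν with h0 | ⟨κ, κ', hκ, hκ', h0⟩
    · exact ⟨0, by rw [h0, zero_smul]⟩
    · rw [h0, star_word_mul_word_of_length_eq h (by omega)]
      split_ifs
      · exact ⟨1, by simp⟩
      · exact ⟨0, by simp⟩
  · intro a b μ ν hμ hν hl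
    rcases key2 a b μ ν hμ hν with h0 | ⟨κ, κ', hκ, hκ', h0⟩
    · rw [h0]; simp
    · rw [h0]
      exact compress_word_eq_zero h hij (by omega) (by omega) (by omega)

/-- Compression by the defect projection. -/
theorem compression_defect (h : OrthoIsometries s) (k : ℕ) :
    Compression s k (fun _ : Unit => 1 - rangeProj s 1) (1 - rangeProj s 1) 1 := by
  have hD : star (1 - rangeProj s 1) = 1 - rangeProj s 1 := by simp [star_rangeProj]
  have hDD := one_sub_rangeProj_mul_self h 1
  have key : ∀ μ ν : List (Fin n), (μ ≠ [] ∨ ν ≠ []) →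
      (1 - rangeProj s 1) * (word s μ * star (word s ν)) * (1 - rangeProj s 1) = 0 := by
    intro μ ν hne
    rcases hne with hne | hne
    · cases μ with
      | nil => exact absurd rfl hne
      | cons i μ =>
        rw [word_cons, ← mul_assoc, ← mul_assoc, one_sub_rangeProj_one_mul h]
        simp
    · cases ν with
      | nil => exact absurd rfl hne
      | cons i ν =>
        rw [word_cons, star_mul, mul_assoc, mul_assoc, mul_assoc,
          star_mul_one_sub_rangeProj_one h]
        simp
  refine ⟨fun _ => defect_mem_monoid, one_mem _, Or.inr rfl, Or.inr ?_, fun a b => ?_, ?_, ?_,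
    ?_, ?_⟩
  · simp [hD, hDD]
  · simp [hD, hDD]
  · simpa using norm_word_le h []
  · simp
  · intro _ _ μ ν _ _ hl
    rw [hD]
    by_cases hμ : μ = []
    · subst hμ
      have hν : ν = [] := List.length_eq_zero_iff.1 hl.symm
      subst hν
      exact ⟨1, by simp [hDD]⟩
    · exact ⟨0, by rw [key μ ν (Or.inl hμ), zero_smul]⟩
  · intro _ _ μ ν _ _ hl
    rw [hD, key μ ν]
    · simp
    · by_contra! hcon
      exact hl (by rw [hcon.1, hcon.2])

theorem Relations.commute_defect (h : Relations q s t) (hq : ‖q‖ = 1) :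
    Commute (1 - rangeProj s 1) (1 - rangeProj t 1) :=
  (Commute.one_left _).sub_left ((Commute.one_right _).sub_right
    (h.commute_rangeProj_rangeProj hq 1 1))

/-- Compressions in the two families combine, up to a scalar. -/
theorem Relations.compress_mul (h : Relations q s t) (hq : ‖q‖ = 1) {x x' z y y' w : B}
    (hx : x ∈ monoid s) (hx' : x' ∈ monoid s) (hz : z ∈ monoid s) (hy : y ∈ monoid t)
    (hw : w ∈ monoid t) : ∃ c : ℂ,
      star (x * y) * (z * w) * (x' * y') = c • ((star x * z * x') * (star y * w * y')) := by
  obtain ⟨c, -, hc⟩ := (h.qComm hq hx' hw).symm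
  obtain ⟨d, -, hd⟩ := (h.qComm hq (mul_mem (mul_mem (star_mem_monoid hx) hz) hx')
    (star_mem_monoid hy)).symm
  refine ⟨c * d, ?_⟩
  calc star (x * y) * (z * w) * (x' * y')
      = star y * (star x * z) * (w * x') * y' := by rw [star_mul]; simp only [mul_assoc]
    _ = c • ((star y * (star x * z * x')) * w * y') := by
        rw [hc, mul_smul_comm, smul_mul_assoc]; simp only [mul_assoc]
    _ = (c * d) • ((star x * z * x') * (star y * w * y')) := by
        rw [hd, smul_mul_assoc, smul_mul_assoc, smul_smul]; simp only [mul_assoc]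

section Combine

variable {k : ℕ} {W W' : Type} [Fintype W] [DecidableEq W] [Fintype W'] [DecidableEq W']
  {v : W → B} {v' : W' → B} {f f' u u' : B}

theorem Compression.star_f (c : Compression s k v f u) : star f = f := by
  rcases c.f_eq with h | h <;> simp [h, star_rangeProj]

theorem Compression.f_mul_f (h : OrthoIsometries s) (c : Compression s k v f u) : f * f = f := by
  rcases c.f_eq with hf | hf
  · simp [hf]
  · rw [hf, one_sub_rangeProj_mul_self h]

theorem Compression.commute_f (h : Relations q s t) (hq : ‖q‖ = 1) (c : Compression s k v f u)
    {y : B} (hy : y ∈ monoid t) : Commute f y := by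
  rcases c.f_eq with hf | hf
  · rw [hf]; exact Commute.one_left _
  · rw [hf]; exact (Commute.one_left _).sub_left (h.commute_rangeProj_monoid hq 1 hy)

theorem Compression.commute_sum (h : Relations q s t) (hq : ‖q‖ = 1)
    (c : Compression s k v f u) {y : B} (hy : y ∈ monoid t) :
    Commute (∑ a, v a * star (v a)) y := by
  rcases c.sum_eq with hf | hf
  · rw [hf]; exact h.commute_rangeProj_monoid hq k hy
  · rw [hf]; exact (Commute.one_left _).sub_left (h.commute_rangeProj_monoid hq 1 hy)

theorem Compression.f_mem (c : Compression s k v f u) : f ∈ monoid s := by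
  rcases c.f_eq with hf | hf
  · rw [hf]; exact one_mem _
  · rw [hf]; exact defect_mem_monoid

theorem Compression.ortho_mul (h : Relations q s t) (hq : ‖q‖ = 1) (c : Compression s k v f u)
    (c' : Compression t k v' f' u') (a b : W × W') :
    star (v a.1 * v' a.2) * (v b.1 * v' b.2) = if a = b then f * f' else 0 := by
  have e : star (v a.1 * v' a.2) * (v b.1 * v' b.2) =
      star (v' a.2) * (star (v a.1) * v b.1) * v' b.2 := by
    rw [star_mul]; simp only [mul_assoc]
  rw [e, c.ortho]
  by_cases h1 : a.1 = b.1
  · rw [if_pos h1, ← (c.commute_f h hq (star_mem_monoid (c'.v_mem a.2))).eq, mul_assoc, c'.ortho]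
    by_cases h2 : a.2 = b.2
    · rw [if_pos h2, if_pos (Prod.ext h1 h2)]
    · rw [if_neg h2, if_neg fun hab => h2 (congrArg Prod.snd hab), mul_zero]
  · rw [if_neg h1, if_neg fun hab => h1 (congrArg Prod.fst hab), mul_zero, zero_mul]

theorem Compression.sum_mul (h : Relations q s t) (hq : ‖q‖ = 1) (c : Compression s k v f u)
    (c' : Compression t k v' f' u') :
    ∑ a : W × W', (v a.1 * v' a.2) * star (v a.1 * v' a.2) =
      (∑ a, v a * star (v a)) * ∑ a, v' a * star (v' a) := by
  have hq' : ‖star q‖ = 1 := by simpa using hq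
  rw [Fintype.sum_prod_type, Finset.sum_mul]
  refine Finset.sum_congr rfl fun a _ => ?_
  have hc := c'.commute_sum h.swap hq' (star_mem_monoid (c.v_mem a))
  rw [mul_assoc, ← hc.eq, ← mul_assoc, Finset.mul_sum, Finset.sum_mul]
  refine Finset.sum_congr rfl fun b _ => ?_
  rw [star_mul]; simp only [mul_assoc]

/-- The combined compression of a linear combination of monomials agrees with the one of its gauge
average, up to the further compression by `u * u'`. -/
theorem exists_compress_eq (h : Relations q s t) (hq : ‖q‖ = 1)
    {γ : Circle → Circle → B →⋆ₐ[ℂ] B} (hγ : IsGauge γ s t) {b : B}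
    (hb : b ∈ Submodule.span ℂ (monomials s t)) : ∃ k₀ : ℕ, ∀ k ≥ k₀, ∀ N > k,
      ∀ (W W' : Type) [Fintype W] [DecidableEq W] [Fintype W'] [DecidableEq W']
        (v : W → B) (v' : W' → B) (f f' u u' : B),
        Compression s k v f u → Compression t k v' f' u' → ∀ i j : W × W', ∃ C : ℂ,
          star (v i.1 * v' i.2) * gaugeAvg γ N b * (v j.1 * v' j.2) = C • (f * f') ∧
          star (u * u') * (star (v i.1 * v' i.2) * b * (v j.1 * v' j.2)) * (u * u') =
            C • (f * f') := by
  have hq' : ‖star q‖ = 1 := by simpa using hq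
  induction hb using Submodule.span_induction with
  | mem x hx =>
    obtain ⟨μ, ν, α, β, rfl⟩ := hx
    refine ⟨max (max μ.length ν.length) (max α.length β.length), ?_⟩
    intro k hk N hN W W' _ _ _ _ v v' f f' u u' c c' i j
    have hμ : μ.length ≤ k := by omega
    have hν : ν.length ≤ k := by omega
    have hα : α.length ≤ k := by omega
    have hβ : β.length ≤ k := by omega
    have hX := word_mul_star_word_mem_monoid (s := s) μ ν
    have hY := word_mul_star_word_mem_monoid (s := t) α β
    obtain ⟨d, hd⟩ := h.compress_mul hq (y' := v' j.2) (c.v_mem i.1) (c.v_mem j.1) hX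
      (c'.v_mem i.2) hY
    rw [hγ.gaugeAvg_monomial (by omega) (by omega) (by omega) (by omega)]
    split_ifs with hl
    · obtain ⟨a, ha⟩ := c.balanced i.1 j.1 μ ν hμ hν hl.1
      obtain ⟨a', ha'⟩ := c'.balanced i.2 j.2 α β hα hβ hl.2
      rw [ha, ha', smul_mul_smul_comm, smul_smul] at hd
      refine ⟨d * (a * a'), hd, ?_⟩
      have e : star (u * u') * (f * f') * (u * u') = f * f' := by
        have h1 : Commute f' u := c'.commute_f h.swap hq' c.u_mem
        have h2 : Commute f (star u') := c.commute_f h hq (star_mem_monoid c'.u_mem)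
        calc star (u * u') * (f * f') * (u * u')
            = star u' * (star u * f * (f' * u) * u') := by rw [star_mul]; simp only [mul_assoc]
          _ = star u' * ((star u * f * u) * (f' * u')) := by rw [h1.eq]; simp only [mul_assoc]
          _ = (star u' * f) * (f' * u') := by rw [c.star_u_mul_mul_u, mul_assoc]
          _ = f * (star u' * f' * u') := by rw [← h2.eq]; simp only [mul_assoc]
          _ = f * f' := by rw [c'.star_u_mul_mul_u]
      rw [hd, mul_smul_comm, smul_mul_assoc, e]
    · refine ⟨0, by simp, ?_⟩
      have m1 : star (v i.1) * (word s μ * star (word s ν)) * v j.1 ∈ monoid s :=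
        mul_mem (mul_mem (star_mem_monoid (c.v_mem _)) hX) (c.v_mem _)
      have m2 : star (v' i.2) * (word t α * star (word t β)) * v' j.2 ∈ monoid t :=
        mul_mem (mul_mem (star_mem_monoid (c'.v_mem _)) hY) (c'.v_mem _)
      obtain ⟨e, he⟩ := h.compress_mul hq (y' := u') c.u_mem c.u_mem m1 c'.u_mem m2
      rw [hd, mul_smul_comm, smul_mul_assoc, he, zero_smul]
      rw [not_and_or] at hl
      rcases hl with hl | hl
      · rw [c.unbalanced _ _ _ _ hμ hν hl]; simp
      · rw [c'.unbalanced _ _ _ _ hα hβ hl]; simp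
  | zero =>
    refine ⟨0, fun k _ N _ W W' _ _ _ _ v v' f f' u u' _ _ i j => ⟨0, ?_, ?_⟩⟩
    · simp [gaugeAvg]
    · simp
  | add x y _ _ hx hy =>
    obtain ⟨k₁, h₁⟩ := hx
    obtain ⟨k₂, h₂⟩ := hy
    refine ⟨max k₁ k₂, fun k hk N hN W W' _ _ _ _ v v' f f' u u' c c' i j => ?_⟩
    obtain ⟨C₁, e₁, e₁'⟩ := h₁ k (by omega) N hN W W' v v' f f' u u' c c' i j
    obtain ⟨C₂, e₂, e₂'⟩ := h₂ k (by omega) N hN W W' v v' f f' u u' c c' i j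
    refine ⟨C₁ + C₂, ?_, ?_⟩
    · rw [gaugeAvg_add, mul_add, add_mul, e₁, e₂, add_smul]
    · rw [mul_add, add_mul, mul_add, add_mul, e₁', e₂', add_smul]
  | smul a x _ hx =>
    obtain ⟨k₁, h₁⟩ := hx
    refine ⟨k₁, fun k hk N hN W W' _ _ _ _ v v' f f' u u' c c' i j => ?_⟩
    obtain ⟨C₁, e₁, e₁'⟩ := h₁ k hk N hN W W' v v' f f' u u' c c' i j
    refine ⟨a * C₁, ?_, ?_⟩
    · rw [gaugeAvg_smul, mul_smul_comm, smul_mul_assoc, e₁, smul_smul]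
    · rw [mul_smul_comm, smul_mul_assoc, mul_smul_comm, smul_mul_assoc, e₁', smul_smul]

end Combine

/-- The key step: if the compressions of an element `z` of a closed ideal, at all levels, have
norms bounded below, then the ideal contains the source projection of the compressions. The gauge
averages of `z * star z` stay bounded below; approximating `z * star z` by a linear combination of
monomials, the averages become matrices, with a large matrix coefficient. -/
theorem mul_mem_of_compression (h : Relations q s t) (hq : ‖q‖ = 1) (hg : IsGenerated s t)
    {γ : Circle → Circle → B →⋆ₐ[ℂ] B} (hγ : IsGauge γ s t) {J : TwoSidedIdeal B}
    {z : B} (hz : z ∈ J) {δ : ℝ} (hδ : 0 < δ) {f f' : B}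
    (hc : ∀ k, ∃ (W W' : Type) (_ : Fintype W) (_ : DecidableEq W) (_ : Fintype W')
      (_ : DecidableEq W') (v : W → B) (v' : W' → B) (u u' : B),
      Compression s k v f u ∧ Compression t k v' f' u' ∧
        δ ≤ ‖(∑ a, v a * star (v a)) * (∑ a, v' a * star (v' a)) * z‖) : f * f' ∈ J := by
  obtain ⟨ε, hε, K, hK, hlow⟩ := hγ.exists_le_norm_gaugeAvg hg z hδ
  set x := z * star z with hx
  have hxJ : x ∈ J := J.mul_mem_right _ _ hz
  obtain ⟨b, hb, hxb⟩ := Metric.mem_closure_iff.1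
    (topologicalClosure_span_monomials h hq hg x) (ε / 3) (by positivity)
  rw [dist_eq_norm] at hxb
  -- the roots of unity of order `K * (k + 1) > k` separate the degrees of the monomials of `b`
  obtain ⟨k, hk⟩ := exists_compress_eq h hq hγ hb
  obtain ⟨W, W', _, _, _, _, v, v', u, u', c, c', hR⟩ := hc k
  have hkN : k < K * (k + 1) := by nlinarith
  have hC := hk k le_rfl (K * (k + 1)) hkN W W' v v' f f' u u' c c'
  have hff' : Commute f f' := c.commute_f h hq c'.f_mem
  have hf : star (f * f') = f * f' := by
    rw [star_mul, c.star_f, c'.star_f, hff'.eq]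
  have hff : f * f' * (f * f') = f * f' := by
    rw [mul_assoc, ← mul_assoc f', ← hff'.eq, mul_assoc f, c'.f_mul_f h.right, ← mul_assoc,
      c.f_mul_f h.left]
  have hortho := c.ortho_mul h hq c'
  rw [← c.sum_mul h hq c'] at hR
  set R := ∑ a : W × W', (v a.1 * v' a.2) * star (v a.1 * v' a.2) with hRdef
  have hRs : star R = R := by
    rw [hRdef, star_sum]; simp only [star_mul, star_star]
  have hRR : R * R = R := by
    rw [hRdef, Finset.sum_mul]
    refine Finset.sum_congr rfl fun a _ => ?_
    rw [Finset.mul_sum, Finset.sum_eq_single a]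
    · rw [mul_assoc, ← mul_assoc (star _), hortho, if_pos rfl, ← mul_assoc,
        mul_projection_of_ortho hf hff hortho a]
    · intro b _ hb
      rw [mul_assoc, ← mul_assoc (star _), hortho, if_neg hb.symm]
      simp
    · simp
  have hRn := norm_le_one_of_projection hRs hRR
  have hl := hlow (k + 1) (Nat.succ_pos k) R hRn hRs hR
  refine projection_mem_of_block (v := fun a : W × W' => v a.1 * v' a.2) (u := u * u') (x := x)
    (b := b) (b' := gaugeAvg γ (K * (k + 1)) b) (c := ε / 3) hf hff hortho ?_ hC hxJ
    (by positivity) hxb.le ?_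
  · exact (norm_mul_le _ _).trans (mul_le_one₀ c.norm_u_le (norm_nonneg _) c'.norm_u_le)
  · -- the block of the average of `b` differs from the one of `x`, of norm at least `ε`, by `ε / 3`
    have e : R * gaugeAvg γ (K * (k + 1)) x * R = R * gaugeAvg γ (K * (k + 1)) b * R +
        R * gaugeAvg γ (K * (k + 1)) (x - b) * R := by
      rw [← add_mul, ← mul_add, ← gaugeAvg_add, add_sub_cancel]
    have h1 : ‖R * gaugeAvg γ (K * (k + 1)) (x - b) * R‖ ≤ ε / 3 := by
      calc _ ≤ ‖R‖ * ‖gaugeAvg γ (K * (k + 1)) (x - b)‖ * ‖R‖ :=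
            (norm_mul_le _ _).trans (by gcongr; exact norm_mul_le _ _)
        _ ≤ 1 * (ε / 3) * 1 := by
            gcongr
            exact (norm_gaugeAvg_le _ _ _).trans hxb.le
        _ = ε / 3 := by ring
    rw [e] at hl
    have := norm_add_le (R * gaugeAvg γ (K * (k + 1)) b * R)
      (R * gaugeAvg γ (K * (k + 1)) (x - b) * R)
    linarith

/-! ### Classification of the closed ideals -/

/-- The two-sided ideal of the elements `e` with `e * y * x ∈ L` for all `y`. -/
def transporter (L : TwoSidedIdeal B) (x : B) : TwoSidedIdeal B :=
  TwoSidedIdeal.mk' {e | ∀ y, e * y * x ∈ L}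
    (fun y => by simp)
    (fun {a b} ha hb y => by rw [add_mul, add_mul]; exact L.add_mem (ha y) (hb y))
    (fun {a} ha y => by rw [neg_mul, neg_mul]; exact L.neg_mem (ha y))
    (fun {a b} hb y => by rw [mul_assoc a, mul_assoc a]; exact L.mul_mem_left _ _ (hb y))
    (fun {a b} ha y => by rw [mul_assoc a]; exact ha (b * y))

theorem mem_transporter {L : TwoSidedIdeal B} {x e : B} :
    e ∈ transporter L x ↔ ∀ y, e * y * x ∈ L := TwoSidedIdeal.mem_mk' ..

theorem isClosed_transporter {L : TwoSidedIdeal B} (hL : IsClosed (L : Set B)) (x : B) :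
    IsClosed (transporter L x : Set B) := by
  have : (transporter L x : Set B) = ⋂ y, (fun e => e * y * x) ⁻¹' (L : Set B) := by
    ext e; simp [mem_transporter]
  rw [this]
  exact isClosed_iInter fun y => hL.preimage (by fun_prop)

theorem one_sub_mul_mem_closedIdeal_pair (k : ℕ) : 1 - rangeProj s k * rangeProj t k ∈
    closedIdeal {1 - rangeProj s 1, 1 - rangeProj t 1} := by
  have h1 : 1 - rangeProj s k ∈ closedIdeal {1 - rangeProj s 1, 1 - rangeProj t 1} :=
    one_sub_rangeProj_mem (subset_closedIdeal _ (Set.mem_insert _ _)) k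
  have h2 : 1 - rangeProj t k ∈ closedIdeal {1 - rangeProj s 1, 1 - rangeProj t 1} :=
    one_sub_rangeProj_mem (subset_closedIdeal _ (Set.mem_insert_of_mem _ (Set.mem_singleton _))) k
  have e : 1 - rangeProj s k * rangeProj t k =
      (1 - rangeProj s k) + rangeProj s k * (1 - rangeProj t k) := by noncomm_ring
  rw [e]
  exact TwoSidedIdeal.add_mem _ h1 (TwoSidedIdeal.mul_mem_left _ _ _ h2)

/-- A closed ideal not contained in the ideal of both defect projections is everything. -/
theorem one_mem_of_not_mem (h : Relations q s t) (hq : ‖q‖ = 1) (hg : IsGenerated s t)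
    {γ : Circle → Circle → B →⋆ₐ[ℂ] B} (hγ : IsGauge γ s t) (hn : 2 ≤ n) (hm : 2 ≤ m)
    {J : TwoSidedIdeal B} {x : B} (hx : x ∈ J)
    (hxM : x ∉ closedIdeal {1 - rangeProj s 1, 1 - rangeProj t 1}) : 1 ∈ J := by
  have hnt : ¬ Tendsto (fun k => rangeProj s k * rangeProj t k * x) atTop (𝓝 0) := fun hlim =>
    hxM (mem_of_tendsto_mul (isClosed_closedIdeal _)
      (fun k => TwoSidedIdeal.mul_mem_right _ _ _ (one_sub_mul_mem_closedIdeal_pair k)) hlim)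
  obtain ⟨δ, hδ, hlow⟩ := exists_pos_le_norm (fun k => by
    have e : rangeProj s (k + 1) * rangeProj t (k + 1) * x =
        rangeProj s (k + 1) * rangeProj t (k + 1) * (rangeProj s k * rangeProj t k * x) := by
      have hc := h.commute_rangeProj_rangeProj hq k (k + 1)
      calc rangeProj s (k + 1) * rangeProj t (k + 1) * x
          = rangeProj s (k + 1) * rangeProj s k * (rangeProj t (k + 1) * rangeProj t k) * x := by
            rw [rangeProj_succ_mul_rangeProj h.left, rangeProj_succ_mul_rangeProj h.right]
        _ = rangeProj s (k + 1) * (rangeProj s k * rangeProj t (k + 1)) * rangeProj t k * x := by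
            simp only [mul_assoc]
        _ = _ := by rw [hc.eq]; simp only [mul_assoc]
    rw [e]
    refine (norm_mul_le _ _).trans (mul_le_of_le_one_left (norm_nonneg _) ?_)
    exact (norm_mul_le _ _).trans (mul_le_one₀ (norm_rangeProj_le h.left _) (norm_nonneg _)
      (norm_rangeProj_le h.right _))) hnt
  have h01 : (⟨0, by omega⟩ : Fin n) ≠ ⟨1, by omega⟩ := by simp
  have h01' : (⟨0, by omega⟩ : Fin m) ≠ ⟨1, by omega⟩ := by simp
  have := mul_mem_of_compression h hq hg hγ hx hδ (f := 1) (f' := 1) fun k =>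
    ⟨_, _, _, _, _, _, _, _, _, _, compression_word h.left h01 k, compression_word h.right h01' k,
      by rw [← rangeProj_eq_sum_word, ← rangeProj_eq_sum_word]; exact hlow k⟩
  simpa using this

/-- A closed ideal with an element of the ideal of both defect projections, but not of the ideal
of the second one, contains the first one. -/
theorem defect_mem_of_not_mem (h : Relations q s t) (hq : ‖q‖ = 1) (hg : IsGenerated s t)
    {γ : Circle → Circle → B →⋆ₐ[ℂ] B} (hγ : IsGauge γ s t) (hm : 2 ≤ m)
    {J : TwoSidedIdeal B} {x : B} (hx : x ∈ J)
    (hxM : x ∈ closedIdeal {1 - rangeProj s 1, 1 - rangeProj t 1})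
    (hxI : x ∉ closedIdeal {1 - rangeProj t 1}) : 1 - rangeProj s 1 ∈ J := by
  have hq' : ‖star q‖ = 1 := by simpa using hq
  set L := closedIdeal {1 - rangeProj t 1} with hL
  have hLc : IsClosed (L : Set B) := isClosed_closedIdeal _
  obtain ⟨y, hy⟩ : ∃ y, (1 - rangeProj s 1) * y * x ∉ L := by
    by_contra! hcon
    have hle : closedIdeal {1 - rangeProj s 1, 1 - rangeProj t 1} ≤ transporter L x := by
      refine closedIdeal_le (isClosed_transporter hLc x) ?_
      rintro _ (rfl | rfl)
      · exact mem_transporter.2 hcon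
      · exact mem_transporter.2 fun y => L.mul_mem_right _ _ (L.mul_mem_right _ _
          (mem_closedIdeal_singleton _))
    refine hxI (mem_of_tendsto_mul hLc (e := fun k => rangeProj s k * rangeProj t k)
      (fun k => ?_) ?_)
    · simpa using mem_transporter.1 (hle (one_sub_mul_mem_closedIdeal_pair k)) 1
    · rw [closedIdeal_pair_defect h hq hg, TwoSidedIdeal.mem_sup] at hxM
      obtain ⟨a, ha, b, hb, rfl⟩ := hxM
      rw [mem_closedIdeal_defect_iff h hq hg] at ha
      rw [mem_closedIdeal_defect_iff h.swap hq' hg.swap] at hb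
      have h1 : Tendsto (fun k => rangeProj s k * (rangeProj t k * b)) atTop (𝓝 0) := by
        refine squeeze_zero_norm (fun k => ?_) (tendsto_zero_iff_norm_tendsto_zero.1 hb)
        exact (norm_mul_le _ _).trans
          (mul_le_of_le_one_left (norm_nonneg _) (norm_rangeProj_le h.left _))
      have h2 : Tendsto (fun k => rangeProj t k * (rangeProj s k * a)) atTop (𝓝 0) := by
        refine squeeze_zero_norm (fun k => ?_) (tendsto_zero_iff_norm_tendsto_zero.1 ha)
        exact (norm_mul_le _ _).trans
          (mul_le_of_le_one_left (norm_nonneg _) (norm_rangeProj_le h.right _))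
      have e : ∀ k, rangeProj s k * rangeProj t k * (a + b) =
          rangeProj t k * (rangeProj s k * a) + rangeProj s k * (rangeProj t k * b) := by
        intro k
        rw [mul_add, ← mul_assoc, ← mul_assoc, (h.commute_rangeProj_rangeProj hq k k).eq]
      simp_rw [e]
      simpa using h2.add h1
  set z := (1 - rangeProj s 1) * y * x with hz
  have hzJ : z ∈ J := J.mul_mem_left _ _ hx
  have hnt : ¬ Tendsto (fun k => rangeProj t k * z) atTop (𝓝 0) := fun hlim =>
    hy ((mem_closedIdeal_defect_iff h.swap hq' hg.swap).2 hlim)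
  obtain ⟨δ, hδ, hlow⟩ := exists_pos_le_norm
    (fun k => norm_rangeProj_succ_mul_le h.right k z) hnt
  have h01' : (⟨0, by omega⟩ : Fin m) ≠ ⟨1, by omega⟩ := by simp
  have hDz : (1 - rangeProj s 1) * z = z := by
    rw [hz, ← mul_assoc, ← mul_assoc, one_sub_rangeProj_mul_self h.left]
  have := mul_mem_of_compression h hq hg hγ hzJ hδ (f := 1 - rangeProj s 1) (f' := 1) fun k =>
    ⟨_, _, _, _, _, _, _, _, _, _, compression_defect h.left k, compression_word h.right h01' k,
      by
        have hc : Commute (1 - rangeProj s 1) (rangeProj t k) :=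
          (Commute.one_left _).sub_left (h.commute_rangeProj_rangeProj hq 1 k)
        rw [← rangeProj_eq_sum_word]
        simp only [Finset.univ_unique, Finset.sum_const, Finset.card_singleton, one_smul, star_sub,
          star_one, star_rangeProj, one_sub_rangeProj_mul_self h.left]
        rw [hc.eq, mul_assoc, hDz]
        exact hlow k⟩
  simpa using this

/-- A closed ideal with a nonzero element of the ideal of the product of the defect projections
contains this product. -/
theorem mul_defect_mem_of_ne_zero (h : Relations q s t) (hq : ‖q‖ = 1) (hg : IsGenerated s t)
    {γ : Circle → Circle → B →⋆ₐ[ℂ] B} (hγ : IsGauge γ s t) {J : TwoSidedIdeal B} {x : B}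
    (hx : x ∈ J) (hxI : x ∈ closedIdeal {(1 - rangeProj s 1) * (1 - rangeProj t 1)})
    (hx0 : x ≠ 0) : (1 - rangeProj s 1) * (1 - rangeProj t 1) ∈ J := by
  have hq' : ‖star q‖ = 1 := by simpa using hq
  obtain ⟨y, hy⟩ : ∃ y, (1 - rangeProj s 1) * (1 - rangeProj t 1) * y * x ≠ 0 := by
    by_contra! hcon
    have hle : closedIdeal {(1 - rangeProj s 1) * (1 - rangeProj t 1)} ≤ transporter ⊥ x := by
      refine closedIdeal_le (isClosed_transporter (by simp) x) ?_
      rintro _ rfl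
      exact mem_transporter.2 fun y => (TwoSidedIdeal.mem_bot B).2 (hcon y)
    obtain ⟨h₁, h₂⟩ := (mem_closedIdeal_mul_defect_iff h hq hg).1 hxI
    rw [mem_closedIdeal_defect_iff h hq hg] at h₁
    rw [mem_closedIdeal_defect_iff h.swap hq' hg.swap] at h₂
    have hlim := tendsto_one_sub_mul_one_sub_mul h.left h₁ h₂
    have e : ∀ k, (1 - rangeProj s k) * (1 - rangeProj t k) * x = 0 := by
      intro k
      have := mem_transporter.1
        (hle (one_sub_mul_one_sub_mem h hq (mem_closedIdeal_singleton _) k k)) 1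
      rw [mul_one] at this
      exact (TwoSidedIdeal.mem_bot B).1 this
    simp_rw [e] at hlim
    exact hx0 (tendsto_nhds_unique hlim tendsto_const_nhds)
  set z := (1 - rangeProj s 1) * (1 - rangeProj t 1) * y * x with hz
  have hzJ : z ∈ J := J.mul_mem_left _ _ hx
  refine mul_mem_of_compression h hq hg hγ hzJ (norm_pos_iff.2 hy) fun k =>
    ⟨_, _, _, _, _, _, _, _, _, _, compression_defect h.left k, compression_defect h.right k, ?_⟩
  simp only [Finset.univ_unique, Finset.sum_const, Finset.card_singleton, one_smul, star_sub,
    star_one, star_rangeProj, one_sub_rangeProj_mul_self h.left,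
    one_sub_rangeProj_mul_self h.right]
  refine le_of_eq (congrArg norm ?_)
  have hc := h.commute_defect hq
  calc z = (1 - rangeProj s 1) * (1 - rangeProj s 1) *
        ((1 - rangeProj t 1) * (1 - rangeProj t 1)) * y * x := by
        rw [one_sub_rangeProj_mul_self h.left, one_sub_rangeProj_mul_self h.right]
    _ = (1 - rangeProj s 1) * ((1 - rangeProj s 1) * (1 - rangeProj t 1)) *
        (1 - rangeProj t 1) * y * x := by simp only [mul_assoc]
    _ = (1 - rangeProj s 1) * ((1 - rangeProj t 1) * (1 - rangeProj s 1)) *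
        (1 - rangeProj t 1) * y * x := by rw [← hc.eq]
    _ = _ := by rw [hz]; simp only [mul_assoc]

/-- Every closed ideal is zero, everything, or one of the four ideals of defect projections. -/
theorem closed_ideal_cases (h : Relations q s t) (hq : ‖q‖ = 1) (hg : IsGenerated s t)
    {γ : Circle → Circle → B →⋆ₐ[ℂ] B} (hγ : IsGauge γ s t) (hn : 2 ≤ n) (hm : 2 ≤ m)
    {J : TwoSidedIdeal B} (hJ : IsClosed (J : Set B)) :
    J = ⊥ ∨ J = closedIdeal {(1 - rangeProj s 1) * (1 - rangeProj t 1)} ∨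
      J = closedIdeal {1 - rangeProj s 1} ∨ J = closedIdeal {1 - rangeProj t 1} ∨
      J = closedIdeal {1 - rangeProj s 1, 1 - rangeProj t 1} ∨ J = ⊤ := by
  have hq' : ‖star q‖ = 1 := by simpa using hq
  by_cases hM : J ≤ closedIdeal {1 - rangeProj s 1, 1 - rangeProj t 1}
  swap
  · obtain ⟨x, hx, hxM⟩ := SetLike.not_le_iff_exists.1 hM
    have := one_mem_of_not_mem h hq hg hγ hn hm hx hxM
    exact Or.inr (Or.inr (Or.inr (Or.inr (Or.inr (J.one_mem_iff.1 this)))))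
  have hst : ¬ J ≤ closedIdeal {1 - rangeProj t 1} → closedIdeal {1 - rangeProj s 1} ≤ J := by
    intro hnot
    obtain ⟨x, hx, hxI⟩ := SetLike.not_le_iff_exists.1 hnot
    exact closedIdeal_le hJ (Set.singleton_subset_iff.2
      (defect_mem_of_not_mem h hq hg hγ hm hx (hM hx) hxI))
  have hts : ¬ J ≤ closedIdeal {1 - rangeProj s 1} → closedIdeal {1 - rangeProj t 1} ≤ J := by
    intro hnot
    obtain ⟨x, hx, hxI⟩ := SetLike.not_le_iff_exists.1 hnot
    exact closedIdeal_le hJ (Set.singleton_subset_iff.2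
      (defect_mem_of_not_mem h.swap hq' hg.swap hγ.swap hn hx
        (by rw [Set.pair_comm]; exact hM hx) hxI))
  by_cases h1 : J ≤ closedIdeal {1 - rangeProj s 1}
  · by_cases h2 : J ≤ closedIdeal {1 - rangeProj t 1}
    · have hI : J ≤ closedIdeal {(1 - rangeProj s 1) * (1 - rangeProj t 1)} := fun x hx =>
        (mem_closedIdeal_mul_defect_iff h hq hg).2 ⟨h1 hx, h2 hx⟩
      by_cases h0 : J = ⊥
      · exact Or.inl h0
      · obtain ⟨x, hx, hx0⟩ : ∃ x ∈ J, x ≠ 0 := by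
          by_contra! hcon
          exact h0 (le_bot_iff.1 fun x hx => (TwoSidedIdeal.mem_bot B).2 (hcon x hx))
        refine Or.inr (Or.inl (le_antisymm hI (closedIdeal_le hJ ?_)))
        exact Set.singleton_subset_iff.2
          (mul_defect_mem_of_ne_zero h hq hg hγ hx (hI hx) hx0)
    · exact Or.inr (Or.inr (Or.inl (le_antisymm h1 (hst h2))))
  · by_cases h2 : J ≤ closedIdeal {1 - rangeProj t 1}
    · exact Or.inr (Or.inr (Or.inr (Or.inl (le_antisymm h2 (hts h1)))))
    · refine Or.inr (Or.inr (Or.inr (Or.inr (Or.inl (le_antisymm hM ?_)))))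
      rw [closedIdeal_pair_defect h hq hg]
      exact sup_le (hst h2) (hts h1)

end Relations

/-! ### The universal algebra -/

namespace E

variable {n m : ℕ} {q : ℂ}

theorem of_eq_of {x y : FreeStar n m q}
    (h : ∀ (B : Type) (_ : CStarAlgebra B) (s : Fin n → B) (t : Fin m → B), Relations q s t →
      FreeStar.eval s t x = FreeStar.eval s t y) : (of x : E n m q) = of y := by
  rw [← sub_eq_zero, ← map_sub, ← norm_le_zero_iff, norm_of]
  refine FreeStar.uNorm_le le_rfl fun B _ s t hr => ?_
  rw [map_sub, h B _ s t hr, sub_self, norm_zero]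

theorem relations : Relations q (E.s n m q) (E.t n m q) where
  star_s_mul_s i j := by
    have h := of_eq_of (x := (star (FreeStar.letter (.inl (.inl i))) *
      FreeStar.letter (.inl (.inl j)) : FreeStar n m q)) (y := if i = j then 1 else 0)
      fun B _ s t hr => by
        rw [map_mul, FreeStar.eval_star]
        simp only [FreeStar.eval_letter, Sum.elim_inl, hr.star_s_mul_s]
        split_ifs <;> simp
    rw [map_mul, ← star_of] at h
    rw [s, s, h]
    split_ifs <;> simp
  star_t_mul_t i j := by
    have h := of_eq_of (x := (star (FreeStar.letter (.inl (.inr i))) *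
      FreeStar.letter (.inl (.inr j)) : FreeStar n m q)) (y := if i = j then 1 else 0)
      fun B _ s t hr => by
        rw [map_mul, FreeStar.eval_star]
        simp only [FreeStar.eval_letter, Sum.elim_inl, Sum.elim_inr, hr.star_t_mul_t]
        split_ifs <;> simp
    rw [map_mul, ← star_of] at h
    rw [t, t, h]
    split_ifs <;> simp
  star_s_mul_t j r := by
    have h := of_eq_of (x := (star (FreeStar.letter (.inl (.inl j))) *
      FreeStar.letter (.inl (.inr r)) : FreeStar n m q))
      (y := q • (FreeStar.letter (.inl (.inr r)) * star (FreeStar.letter (.inl (.inl j)))))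
      fun B _ s t hr => by
        rw [map_mul, map_smul, map_mul, FreeStar.eval_star]
        simp only [FreeStar.eval_letter, Sum.elim_inl, Sum.elim_inr, hr.star_s_mul_t]
    rw [map_mul, map_smul, map_mul, ← star_of] at h
    exact h

theorem isGenerated : IsGenerated (E.s n m q) (E.t n m q) := by
  intro A hA hs ht
  have h1 : ∀ x : FreeStar n m q, of x ∈ A := by
    intro x
    induction x using FreeStar.induction with
    | h0 c => rw [AlgHom.commutes]; exact A.algebraMap_mem c
    | h1 y =>
      rcases y with (y | y) | (y | y)
      · exact (hs y).1
      · exact (ht y).1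
      · have := (hs y).2
        rwa [s, star_of, FreeStar.star_letter] at this
      · have := (ht y).2
        rwa [t, star_of, FreeStar.star_letter] at this
    | hm a b ha hb => rw [map_mul]; exact A.mul_mem ha hb
    | ha a b ha hb => rw [map_add]; exact A.add_mem ha hb
  rw [eq_top_iff]
  intro x _
  exact denseRange_of.induction_on x hA h1

section Lift

variable {B : Type} [CStarAlgebra B] {s : Fin n → B} {t : Fin m → B}

theorem continuous_eval (h : Relations q s t) :
    Continuous (FreeStar.eval s t : FreeStar n m q → B) :=
  AddMonoidHomClass.continuous_of_bound (FreeStar.eval s t : FreeStar n m q →ₐ[ℂ] B) 1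
    fun x => by rw [one_mul]; exact FreeStar.norm_eval_le h x

/-- The universal property: a tuple that satisfies the relations defines a `*`-homomorphism. -/
def lift (h : Relations q s t) : E n m q →⋆ₐ[ℂ] B :=
  let f : E n m q →+* B := UniformSpace.Completion.extensionHom
    (FreeStar.eval s t : FreeStar n m q →ₐ[ℂ] B).toRingHom (continuous_eval h)
  have hf : ∀ x : FreeStar n m q, f (of x) = FreeStar.eval s t x := fun x =>
    UniformSpace.Completion.extensionHom_coe
      (FreeStar.eval s t : FreeStar n m q →ₐ[ℂ] B).toRingHom (continuous_eval h) x
  have hc : Continuous f := UniformSpace.Completion.continuous_extension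
  { f with
    commutes' := fun c => by
      have := hf (algebraMap ℂ _ c)
      rwa [AlgHom.commutes, AlgHom.commutes] at this
    map_star' := fun x => by
      change f (star x) = star (f x)
      exact denseRange_of.induction_on x
        (isClosed_eq (hc.comp continuous_star) (continuous_star.comp hc))
        fun a => by rw [star_of, hf, hf, FreeStar.eval_star] }

theorem lift_of (h : Relations q s t) (x : FreeStar n m q) :
    lift h (of x) = FreeStar.eval s t x :=
  UniformSpace.Completion.extensionHom_coe
    (FreeStar.eval s t : FreeStar n m q →ₐ[ℂ] B).toRingHom (continuous_eval h) x

@[simp] theorem lift_s (h : Relations q s t) (i : Fin n) : lift h (E.s n m q i) = s i := by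
  rw [E.s, lift_of]; simp

@[simp] theorem lift_t (h : Relations q s t) (r : Fin m) : lift h (E.t n m q r) = t r := by
  rw [E.t, lift_of]; simp

end Lift

theorem relations_gauge (z w : Circle) :
    Relations q (fun i => (z : ℂ) • E.s n m q i) (fun r => (w : ℂ) • E.t n m q r) where
  star_s_mul_s i j := by
    have hz : star (z : ℂ) * z = 1 := by
      have h1 := RCLike.conj_mul (z : ℂ)
      rw [Circle.norm_coe] at h1
      simpa using h1
    rw [star_smul, smul_mul_smul_comm, hz, one_smul, relations.star_s_mul_s]
  star_t_mul_t i j := by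
    have hz : star (w : ℂ) * w = 1 := by
      have h1 := RCLike.conj_mul (w : ℂ)
      rw [Circle.norm_coe] at h1
      simpa using h1
    rw [star_smul, smul_mul_smul_comm, hz, one_smul, relations.star_t_mul_t]
  star_s_mul_t j r := by
    rw [star_smul, smul_mul_smul_comm, relations.star_s_mul_t, smul_mul_smul_comm, smul_comm,
      mul_comm]

theorem isGauge : IsGauge (fun z w => lift (relations_gauge (n := n) (m := m) (q := q) z w))
    (E.s n m q) (E.t n m q) :=
  ⟨fun z w i => lift_s (relations_gauge z w) i, fun z w r => lift_t (relations_gauge z w) r⟩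

variable (n m q) in
theorem Q_eq : E.Q n m q = rangeProj (E.s n m q) 1 := rangeProj_one.symm

variable (n m q) in
theorem P_eq : E.P n m q = rangeProj (E.t n m q) 1 := rangeProj_one.symm

end E

/-! ### Weighted shifts -/

section Shift

variable {Z : Type} [DecidableEq Z]

/-- The standard basis of `ℓ²(Z)`. -/
def basisVec (z : Z) : lp (fun _ : Z => ℂ) 2 := lp.single 2 z 1

theorem inner_basisVec (z : Z) (f : lp (fun _ : Z => ℂ) 2) : inner ℂ (basisVec z) f = f z := by
  rw [basisVec, lp.inner_single_left]
  simp

theorem orthonormal_basisVec : Orthonormal ℂ (basisVec : Z → lp (fun _ : Z => ℂ) 2) := by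
  rw [orthonormal_iff_ite]
  intro i j
  rw [inner_basisVec, basisVec, lp.single_apply]
  simp [Pi.single_apply]

theorem hasSum_basisVec (f : lp (fun _ : Z => ℂ) 2) : HasSum (fun z => f z • basisVec z) f := by
  have h := lp.hasSum_single (p := 2) (by simp) f
  have e : ∀ z, lp.single 2 z (f z) = f z • basisVec z := fun z => by
    rw [basisVec, ← lp.single_smul]
    simp
  simpa only [e] using h

theorem ext_basisVec {F : Type*} [NormedAddCommGroup F] [NormedSpace ℂ F]
    {A A' : lp (fun _ : Z => ℂ) 2 →L[ℂ] F} (h : ∀ z, A (basisVec z) = A' (basisVec z)) :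
    A = A' := by
  ext f
  have h1 := (hasSum_basisVec f).mapL A
  have h2 := (hasSum_basisVec f).mapL A'
  simp only [map_smul, h] at h1 h2
  exact h1.unique h2

theorem orthonormal_smul_basisVec {φ : Z → Z} (hφ : Function.Injective φ) (c : Z → Circle) :
    Orthonormal ℂ fun z => (c z : ℂ) • basisVec (φ z) := by
  rw [orthonormal_iff_ite]
  intro i j
  rw [inner_smul_left, inner_smul_right, orthonormal_iff_ite.1 orthonormal_basisVec]
  by_cases h : i = j
  · subst h
    have h1 := RCLike.conj_mul (c i : ℂ)
    rw [Circle.norm_coe] at h1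
    simpa using h1
  · simp [h, hφ.ne h]

/-- The weighted shift that maps `basisVec z` to `c z • basisVec (φ z)`. -/
def shift (φ : Z → Z) (hφ : Function.Injective φ) (c : Z → Circle) :
    lp (fun _ : Z => ℂ) 2 →L[ℂ] lp (fun _ : Z => ℂ) 2 :=
  (orthonormal_smul_basisVec hφ c).orthogonalFamily.linearIsometry.toContinuousLinearMap

variable {φ : Z → Z} {hφ : Function.Injective φ} {c : Z → Circle}

theorem shift_basisVec (z : Z) : shift φ hφ c (basisVec z) = (c z : ℂ) • basisVec (φ z) := by
  have := (orthonormal_smul_basisVec hφ c).orthogonalFamily.linearIsometry_apply_single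
    (i := z) (1 : ℂ)
  rw [LinearIsometry.toSpanSingleton_apply, one_smul] at this
  exact this

theorem star_shift_apply (f : lp (fun _ : Z => ℂ) 2) (z : Z) :
    (star (shift φ hφ c) f) z = star (c z : ℂ) * f (φ z) := by
  rw [← inner_basisVec, ContinuousLinearMap.star_eq_adjoint,
    ContinuousLinearMap.adjoint_inner_right, shift_basisVec, inner_smul_left, inner_basisVec]
  rfl

theorem star_shift_basisVec (z : Z) :
    star (shift φ hφ c) (basisVec (φ z)) = star (c z : ℂ) • basisVec z := by
  ext y
  rw [star_shift_apply]
  by_cases h : y = z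
  · subst h; simp [basisVec]
  · simp [basisVec, lp.single_apply, h, hφ.ne h]

theorem star_shift_basisVec_of_notMem {w : Z} (hw : ∀ z, φ z ≠ w) :
    star (shift φ hφ c) (basisVec w) = 0 := by
  ext y
  rw [star_shift_apply]
  simp [basisVec, lp.single_apply, hw y]

end Shift

/-! ### Representations by shifts -/

/-- Two families of injections of a set, each with disjoint ranges, that commute with each other,
and a degree that the first family raises by one. The last condition says that a point `τ r z` in
the range of `σ i` is of the form `σ i (τ r y)`; the shifts then satisfy `s⋆ t = q t s⋆`, and not
only `t s = q s t`. -/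
structure ShiftSystem (n m : ℕ) (Z : Type) where
  σ : Fin n → Z → Z
  τ : Fin m → Z → Z
  d : Z → ℤ
  σ_inj : ∀ {i j z w}, σ i z = σ j w → i = j ∧ z = w
  τ_inj : ∀ {r l z w}, τ r z = τ l w → r = l ∧ z = w
  σ_τ : ∀ i r z, σ i (τ r z) = τ r (σ i z)
  d_σ : ∀ i z, d (σ i z) = d z + 1
  exists_of_σ_eq_τ : ∀ {i r w z}, σ i w = τ r z → ∃ y, z = σ i y

namespace ShiftSystem

variable {n m : ℕ} {q : ℂ} {Z Z' : Type}

/-- Transport of a system along a bijection. -/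
def congr (S : ShiftSystem n m Z) (e : Z ≃ Z') : ShiftSystem n m Z' where
  σ i z := e (S.σ i (e.symm z))
  τ r z := e (S.τ r (e.symm z))
  d z := S.d (e.symm z)
  σ_inj h := by
    obtain ⟨h1, h2⟩ := S.σ_inj (e.injective h)
    exact ⟨h1, e.symm.injective h2⟩
  τ_inj h := by
    obtain ⟨h1, h2⟩ := S.τ_inj (e.injective h)
    exact ⟨h1, e.symm.injective h2⟩
  σ_τ i r z := by simp [S.σ_τ]
  d_σ i z := by simp [S.d_σ]
  exists_of_σ_eq_τ h := by
    obtain ⟨y, hy⟩ := S.exists_of_σ_eq_τ (e.injective h)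
    exact ⟨e y, by rw [e.symm_apply_apply, ← hy, e.apply_symm_apply]⟩

/-- The product of a graded family and a family. -/
def prod {X Y : Type} (σ : Fin n → X → X) (hσ : ∀ {i j z w}, σ i z = σ j w → i = j ∧ z = w)
    (d : X → ℤ) (hd : ∀ i z, d (σ i z) = d z + 1) (τ : Fin m → Y → Y)
    (hτ : ∀ {i j z w}, τ i z = τ j w → i = j ∧ z = w) : ShiftSystem n m (X × Y) where
  σ i z := (σ i z.1, z.2)
  τ r z := (z.1, τ r z.2)
  d z := d z.1
  σ_inj h := by
    rw [Prod.mk.injEq] at h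
    obtain ⟨h1, h2⟩ := hσ h.1
    exact ⟨h1, Prod.ext h2 h.2⟩
  τ_inj h := by
    rw [Prod.mk.injEq] at h
    obtain ⟨h1, h2⟩ := hτ h.2
    exact ⟨h1, Prod.ext h.1 h2⟩
  σ_τ _ _ _ := rfl
  d_σ i z := hd i z.1
  exists_of_σ_eq_τ {i r w z} h := by
    rw [Prod.mk.injEq] at h
    exact ⟨(w.1, z.2), Prod.ext h.1.symm rfl⟩

variable (S : ShiftSystem n m Z) (hq : ‖q‖ = 1)

theorem σ_injective (i : Fin n) : Function.Injective (S.σ i) := fun _ _ h => (S.σ_inj h).2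

theorem τ_injective (r : Fin m) : Function.Injective (S.τ r) := fun _ _ h => (S.τ_inj h).2

/-- The scalar `q` as an element of the circle. -/
def phase : Circle := ⟨q, mem_sphere_zero_iff_norm.2 hq⟩

variable [DecidableEq Z]

/-- The shifts of the first family. -/
def opS (i : Fin n) : lp (fun _ : Z => ℂ) 2 →L[ℂ] lp (fun _ : Z => ℂ) 2 :=
  shift (S.σ i) (S.σ_injective i) 1

/-- The shifts of the second family, weighted by the powers of `q` given by the degree. -/
def opT (r : Fin m) : lp (fun _ : Z => ℂ) 2 →L[ℂ] lp (fun _ : Z => ℂ) 2 :=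
  shift (S.τ r) (S.τ_injective r) fun z => phase hq ^ S.d z

theorem opS_basisVec (i : Fin n) (z : Z) : S.opS i (basisVec z) = basisVec (S.σ i z) := by
  rw [opS, shift_basisVec]; simp

theorem star_opS_basisVec (i : Fin n) (z : Z) :
    star (S.opS i) (basisVec (S.σ i z)) = basisVec z := by
  rw [opS, star_shift_basisVec]; simp

theorem star_opS_basisVec_of_notMem {i : Fin n} {w : Z} (h : ∀ z, S.σ i z ≠ w) :
    star (S.opS i) (basisVec w) = 0 :=
  star_shift_basisVec_of_notMem h

theorem opT_basisVec (r : Fin m) (z : Z) :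
    S.opT hq r (basisVec z) = q ^ S.d z • basisVec (S.τ r z) := by
  rw [opT, shift_basisVec]
  congr 1

theorem q_ne_zero (hq : ‖q‖ = 1) : q ≠ 0 := by rintro rfl; simp at hq

theorem star_opT_basisVec (r : Fin m) (z : Z) :
    star (S.opT hq r) (basisVec (S.τ r z)) = star (q ^ S.d z) • basisVec z := by
  rw [opT, star_shift_basisVec]
  congr 2

theorem star_opT_basisVec_of_notMem {r : Fin m} {w : Z} (h : ∀ z, S.τ r z ≠ w) :
    star (S.opT hq r) (basisVec w) = 0 :=
  star_shift_basisVec_of_notMem h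

theorem star_zpow_mul_zpow (hq : ‖q‖ = 1) (k : ℤ) : star (q ^ k) * q ^ k = 1 := by
  have : star q * q = 1 := by simpa [hq] using RCLike.conj_mul q
  rw [star_zpow₀, ← mul_zpow, this, one_zpow]

theorem relations : Relations q S.opS (S.opT hq) where
  star_s_mul_s i j := by
    refine ext_basisVec fun z => ?_
    rw [mul_apply_eq_comp, S.opS_basisVec]
    split_ifs with h
    · rw [h, S.star_opS_basisVec]; rfl
    · rw [S.star_opS_basisVec_of_notMem fun w hw => h (S.σ_inj hw).1]; rfl
  star_t_mul_t r l := by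
    refine ext_basisVec fun z => ?_
    rw [mul_apply_eq_comp, S.opT_basisVec, map_smul]
    split_ifs with h
    · rw [h, S.star_opT_basisVec, smul_smul, mul_comm, star_zpow_mul_zpow hq, one_smul]; rfl
    · rw [S.star_opT_basisVec_of_notMem hq fun w hw => h (S.τ_inj hw).1, smul_zero]; rfl
  star_s_mul_t j r := by
    refine ext_basisVec fun z => ?_
    rw [mul_apply_eq_comp, _root_.smul_apply,
      mul_apply_eq_comp, S.opT_basisVec, map_smul]
    by_cases h : ∃ y, S.σ j y = z
    · obtain ⟨y, rfl⟩ := h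
      rw [← S.σ_τ, S.star_opS_basisVec, S.star_opS_basisVec, S.opT_basisVec, smul_smul, S.d_σ,
        zpow_add_one₀ (q_ne_zero hq), mul_comm]
    · rw [S.star_opS_basisVec_of_notMem (w := z) fun y hy => h ⟨y, hy⟩,
        S.star_opS_basisVec_of_notMem fun w hw => ?_]
      · simp
      · obtain ⟨y, hy⟩ := S.exists_of_σ_eq_τ hw
        exact h ⟨y, hy.symm⟩

/-- The representation of the universal algebra on `ℓ²(Z)`. -/
def rep : E n m q →⋆ₐ[ℂ] (lp (fun _ : Z => ℂ) 2 →L[ℂ] lp (fun _ : Z => ℂ) 2) :=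
  E.lift (S.relations hq)

theorem rep_s (i : Fin n) : S.rep hq (E.s n m q i) = S.opS i := E.lift_s _ i

theorem rep_t (r : Fin m) : S.rep hq (E.t n m q r) = S.opT hq r := E.lift_t _ r

theorem rep_Q_basisVec_of_mem {i : Fin n} {z : Z} :
    S.rep hq (1 - E.Q n m q) (basisVec (S.σ i z)) = 0 := by
  rw [map_sub, map_one, E.Q, map_sum, _root_.sub_apply, _root_.sum_apply,
    Finset.sum_eq_single i]
  · rw [map_mul, map_star, rep_s, mul_apply_eq_comp, S.star_opS_basisVec,
      S.opS_basisVec]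
    simp
  · intro j _ hj
    rw [map_mul, map_star, rep_s, mul_apply_eq_comp,
      S.star_opS_basisVec_of_notMem fun w hw => hj (S.σ_inj hw).1, map_zero]
  · simp

theorem rep_Q_basisVec_of_notMem {w : Z} (h : ∀ i z, S.σ i z ≠ w) :
    S.rep hq (1 - E.Q n m q) (basisVec w) = basisVec w := by
  rw [map_sub, map_one, E.Q, map_sum, _root_.sub_apply, _root_.sum_apply,
    Finset.sum_eq_zero]
  · simp
  · intro j _
    rw [map_mul, map_star, rep_s, mul_apply_eq_comp,
      S.star_opS_basisVec_of_notMem (h j), map_zero]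

theorem rep_P_basisVec_of_mem {r : Fin m} {z : Z} :
    S.rep hq (1 - E.P n m q) (basisVec (S.τ r z)) = 0 := by
  rw [map_sub, map_one, E.P, map_sum, _root_.sub_apply, _root_.sum_apply,
    Finset.sum_eq_single r]
  · rw [map_mul, map_star, rep_t, mul_apply_eq_comp, S.star_opT_basisVec, map_smul,
      S.opT_basisVec, smul_smul, star_zpow_mul_zpow hq]
    simp
  · intro j _ hj
    rw [map_mul, map_star, rep_t, mul_apply_eq_comp,
      S.star_opT_basisVec_of_notMem hq fun w hw => hj (S.τ_inj hw).1, map_zero]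
  · simp

theorem rep_P_basisVec_of_notMem {w : Z} (h : ∀ r z, S.τ r z ≠ w) :
    S.rep hq (1 - E.P n m q) (basisVec w) = basisVec w := by
  rw [map_sub, map_one, E.P, map_sum, _root_.sub_apply, _root_.sum_apply,
    Finset.sum_eq_zero]
  · simp
  · intro j _
    rw [map_mul, map_star, rep_t, mul_apply_eq_comp,
      S.star_opT_basisVec_of_notMem hq (h j), map_zero]

theorem rep_Q_eq_zero (h : ∀ w, ∃ i z, S.σ i z = w) : S.rep hq (1 - E.Q n m q) = 0 := by
  refine ext_basisVec fun w => ?_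
  obtain ⟨i, z, rfl⟩ := h w
  rw [S.rep_Q_basisVec_of_mem hq]; rfl

theorem rep_P_eq_zero (h : ∀ w, ∃ r z, S.τ r z = w) : S.rep hq (1 - E.P n m q) = 0 := by
  refine ext_basisVec fun w => ?_
  obtain ⟨i, z, rfl⟩ := h w
  rw [S.rep_P_basisVec_of_mem hq]; rfl

end ShiftSystem

theorem basisVec_ne_zero {Z : Type} [DecidableEq Z] (z : Z) : basisVec z ≠ 0 := fun h => by
  have := orthonormal_basisVec.ne_zero z
  exact this h

/-! ### Fock and Cuntz systems -/

theorem cons_inj {n : ℕ} {i j : Fin n} {μ ν : List (Fin n)} (h : i :: μ = j :: ν) :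
    i = j ∧ μ = ν := by simpa using h

/-- The map `(k, z) ↦ (n k + i, z + 1)` of `ℕ × ℤ`; the ranges for `i < n` cover everything. The
integer coordinate only provides a degree. -/
def cuntzMap {n : ℕ} [NeZero n] (i : Fin n) (z : ℕ × ℤ) : ℕ × ℤ :=
  ((Nat.divModEquiv n).symm (z.1, i), z.2 + 1)

theorem cuntzMap_inj {n : ℕ} [NeZero n] {i j : Fin n} {z w : ℕ × ℤ}
    (h : cuntzMap i z = cuntzMap j w) : i = j ∧ z = w := by
  simp only [cuntzMap, Prod.mk.injEq, EmbeddingLike.apply_eq_iff_eq, add_left_inj] at h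
  exact ⟨h.1.2, Prod.ext h.1.1 h.2⟩

theorem exists_cuntzMap_eq {n : ℕ} [NeZero n] (w : ℕ × ℤ) : ∃ (i : Fin n) (z : ℕ × ℤ),
    cuntzMap i z = w :=
  ⟨(Nat.divModEquiv n w.1).2, ((Nat.divModEquiv n w.1).1, w.2 - 1),
    Prod.ext (by simp only [cuntzMap, Prod.mk.eta, Equiv.symm_apply_apply]) (by simp [cuntzMap])⟩

section Systems

variable (n m : ℕ)

/-- The system of the Fock representation: both families prepend letters to words. -/
def fockSystem : ShiftSystem n m (List (Fin n) × List (Fin m)) :=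
  .prod List.cons cons_inj (fun μ => (μ.length : ℤ)) (fun _ _ => by simp) List.cons cons_inj

/-- The first family is of Fock type, and the second one of Cuntz type. -/
def fockCuntzSystem [NeZero m] : ShiftSystem n m (List (Fin n) × (ℕ × ℤ)) :=
  .prod List.cons cons_inj (fun μ => (μ.length : ℤ)) (fun _ _ => by simp) cuntzMap cuntzMap_inj

/-- The first family is of Cuntz type, and the second one of Fock type. -/
def cuntzFockSystem [NeZero n] : ShiftSystem n m ((ℕ × ℤ) × List (Fin m)) :=
  .prod cuntzMap cuntzMap_inj (fun z => z.2) (fun _ _ => rfl) List.cons cons_inj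

/-- Both families are of Cuntz type. -/
def cuntzSystem [NeZero n] [NeZero m] : ShiftSystem n m ((ℕ × ℤ) × (ℕ × ℤ)) :=
  .prod cuntzMap cuntzMap_inj (fun z => z.2) (fun _ _ => rfl) cuntzMap cuntzMap_inj

end Systems

section Distinct

variable {n m : ℕ} {q : ℂ}

theorem continuous_starAlgHom {A B : Type*} [CStarAlgebra A] [CStarAlgebra B]
    (π : A →⋆ₐ[ℂ] B) : Continuous π :=
  AddMonoidHomClass.continuous_of_bound π 1 fun x => by
    rw [one_mul]; exact NonUnitalStarAlgHom.norm_apply_le π x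

/-- The closed ideal generated by a set lies in the kernel of every representation that vanishes
on the set. -/
theorem notMem_closedIdeal {B : Type*} [CStarAlgebra B] (π : E n m q →⋆ₐ[ℂ] B)
    {X : Set (E n m q)} {y : E n m q} (hX : ∀ x ∈ X, π x = 0) (hy : π y ≠ 0) :
    y ∉ closedIdeal X := by
  intro hmem
  have hle : closedIdeal X ≤ TwoSidedIdeal.ker π := by
    refine closedIdeal_le ?_ fun x hx => (TwoSidedIdeal.mem_ker π).2 (hX x hx)
    have : (TwoSidedIdeal.ker π : Set (E n m q)) = π ⁻¹' {0} := by
      ext x; exact TwoSidedIdeal.mem_ker π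
    rw [this]
    exact isClosed_singleton.preimage (continuous_starAlgHom π)
  exact hy ((TwoSidedIdeal.mem_ker π).1 (hle hmem))

theorem one_sub_Q_notMem_idealI₂ [NeZero m] (hq : ‖q‖ = 1) :
    1 - E.Q n m q ∉ idealI₂ n m q := by
  refine notMem_closedIdeal ((fockCuntzSystem n m).rep hq) ?_ fun h => ?_
  · rintro _ rfl
    refine ShiftSystem.rep_P_eq_zero _ hq fun w => ?_
    obtain ⟨r, z, hz⟩ := exists_cuntzMap_eq (n := m) w.2
    exact ⟨r, (w.1, z), Prod.ext rfl hz⟩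
  · refine basisVec_ne_zero (([], 0) : List (Fin n) × (ℕ × ℤ)) ?_
    rw [← (fockCuntzSystem n m).rep_Q_basisVec_of_notMem hq, h]
    · rfl
    · intro i z hz
      exact List.cons_ne_nil _ _ (congrArg Prod.fst hz)

theorem one_sub_P_notMem_idealI₁ [NeZero n] (hq : ‖q‖ = 1) :
    1 - E.P n m q ∉ idealI₁ n m q := by
  refine notMem_closedIdeal ((cuntzFockSystem n m).rep hq) ?_ fun h => ?_
  · rintro _ rfl
    refine ShiftSystem.rep_Q_eq_zero _ hq fun w => ?_
    obtain ⟨r, z, hz⟩ := exists_cuntzMap_eq (n := n) w.1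
    exact ⟨r, (z, w.2), Prod.ext hz rfl⟩
  · refine basisVec_ne_zero ((0, []) : (ℕ × ℤ) × List (Fin m)) ?_
    rw [← (cuntzFockSystem n m).rep_P_basisVec_of_notMem hq, h]
    · rfl
    · intro i z hz
      exact List.cons_ne_nil _ _ (congrArg Prod.snd hz)

theorem one_notMem_idealM [NeZero n] [NeZero m] (hq : ‖q‖ = 1) :
    (1 : E n m q) ∉ idealM n m q := by
  refine notMem_closedIdeal ((cuntzSystem n m).rep hq) ?_ fun h => ?_
  · rintro _ (rfl | rfl)
    · refine ShiftSystem.rep_Q_eq_zero _ hq fun w => ?_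
      obtain ⟨r, z, hz⟩ := exists_cuntzMap_eq (n := n) w.1
      exact ⟨r, (z, w.2), Prod.ext hz rfl⟩
    · refine ShiftSystem.rep_P_eq_zero _ hq fun w => ?_
      obtain ⟨r, z, hz⟩ := exists_cuntzMap_eq (n := m) w.2
      exact ⟨r, (w.1, z), Prod.ext rfl hz⟩
  · refine basisVec_ne_zero ((0, 0) : (ℕ × ℤ) × (ℕ × ℤ)) ?_
    rw [map_one] at h
    exact DFunLike.congr_fun h (basisVec _)

end Distinct

/-! ### Approximation of compact operators -/

section Compact

variable {H : Type*} [NormedAddCommGroup H] [InnerProductSpace ℂ H]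

/-- Contractions that tend to the identity pointwise tend to the identity uniformly on the
relatively compact image of the unit ball under a compact operator. -/
theorem tendsto_mul_of_isCompactOperator {p : ℕ → H →L[ℂ] H} (hp : ∀ k, ‖p k‖ ≤ 1)
    (hlim : ∀ x, Tendsto (fun k => p k x) atTop (𝓝 x)) {T : H →L[ℂ] H}
    (hT : IsCompactOperator T) : Tendsto (fun k => p k * T) atTop (𝓝 T) := by
  have htb := (hT.isCompact_closure_image_closedBall 1).totallyBounded.subset subset_closure
  refine Metric.tendsto_atTop.2 fun ε hε => ?_
  obtain ⟨u, hu, hcov⟩ := Metric.totallyBounded_iff.1 htb (ε / 4) (by positivity)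
  have hev : ∀ᶠ k in atTop, ∀ y ∈ u, ‖p k y - y‖ < ε / 4 := by
    refine (Set.Finite.eventually_all hu).2 fun y _ => ?_
    have := Metric.tendsto_nhds.1 (hlim y) (ε / 4) (by positivity)
    simpa only [dist_eq_norm] using this
  obtain ⟨N, hN⟩ := eventually_atTop.1 hev
  refine ⟨N, fun k hk => ?_⟩
  rw [dist_eq_norm]
  refine lt_of_le_of_lt (ContinuousLinearMap.opNorm_le_of_unit_norm (C := 3 * (ε / 4))
    (by positivity) fun x hx => ?_) (by linarith)
  obtain ⟨y, hy, hxy⟩ := Set.mem_iUnion₂.1 (hcov ⟨x, by simp [hx], rfl⟩)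
  rw [Metric.mem_ball, dist_eq_norm] at hxy
  have hxy' : ‖T x - y‖ < ε / 4 := hxy
  have e : (p k * T - T) x = p k (T x - y) + (p k y - y) - (T x - y) := by
    rw [_root_.sub_apply, mul_apply_eq_comp, map_sub]
    abel
  rw [e]
  have h1 : ‖p k (T x - y)‖ ≤ ‖T x - y‖ :=
    ((p k).le_opNorm _).trans (mul_le_of_le_one_left (norm_nonneg _) (hp k))
  have h2 := hN k hk y hy
  have h3 := norm_sub_le (p k (T x - y) + (p k y - y)) (T x - y)
  have h4 := norm_add_le (p k (T x - y)) (p k y - y)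
  linarith

open InnerProductSpace in
theorem isCompactOperator_rankOne (x y : H) : IsCompactOperator (rankOne ℂ x y) := by
  have h : IsCompactOperator (innerSL ℂ y : H →L[ℂ] ℂ) :=
    isCompactOperator_of_locallyCompactSpace_dom _
  rw [rankOne_def']
  exact h.clm_comp (ContinuousLinearMap.toSpanSingleton ℂ x)

variable [CompleteSpace H]

/-- Two-sided compressions of a compact operator by projections that tend to the identity tend to
the operator. -/
theorem tendsto_mul_mul_of_isCompactOperator {p : ℕ → H →L[ℂ] H} (hp : ∀ k, ‖p k‖ ≤ 1)
    (hps : ∀ k, star (p k) = p k) (hlim : ∀ x, Tendsto (fun k => p k x) atTop (𝓝 x))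
    {T : H →L[ℂ] H} (hT : IsCompactOperator T) :
    Tendsto (fun k => p k * T * p k) atTop (𝓝 T) := by
  have h1 := tendsto_mul_of_isCompactOperator hp hlim hT
  have h2 : Tendsto (fun k => T * p k) atTop (𝓝 T) := by
    have := (continuous_star.tendsto _).comp
      (tendsto_mul_of_isCompactOperator hp hlim (isCompactOperator_star H hT))
    simpa [Function.comp_def, star_mul, hps] using this
  have h3 : Tendsto (fun k => (p k * T - T) * p k) atTop (𝓝 0) := by
    refine squeeze_zero_norm (fun k => ?_) (tendsto_iff_norm_sub_tendsto_zero.1 h1)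
    exact (norm_mul_le _ _).trans (mul_le_of_le_one_right (norm_nonneg _) (hp k))
  have e : ∀ k, p k * T * p k = (p k * T - T) * p k + T * p k := fun k => by noncomm_ring
  simp_rw [e]
  simpa using h3.add h2

end Compact

section Truncation

open InnerProductSpace

/-- The projection of `ℓ²(ℕ)` onto the first `N` coordinates. -/
def truncation (N : ℕ) : lp (fun _ : ℕ => ℂ) 2 →L[ℂ] lp (fun _ : ℕ => ℂ) 2 :=
  ∑ z ∈ Finset.range N, rankOne ℂ (basisVec z) (basisVec z)

theorem truncation_apply (N : ℕ) (f : lp (fun _ : ℕ => ℂ) 2) :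
    truncation N f = ∑ z ∈ Finset.range N, f z • basisVec z := by
  rw [truncation, _root_.sum_apply]
  exact Finset.sum_congr rfl fun z _ => by rw [rankOne_apply, inner_basisVec]

theorem star_truncation (N : ℕ) : star (truncation N) = truncation N := by
  rw [truncation, star_sum]
  exact Finset.sum_congr rfl fun z _ => by
    rw [ContinuousLinearMap.star_eq_adjoint, adjoint_rankOne]

theorem truncation_mul_self (N : ℕ) : truncation N * truncation N = truncation N := by
  refine ext_basisVec fun w => ?_
  rw [mul_apply_eq_comp]
  have h : ∀ w, truncation N (basisVec w) = if w < N then basisVec w else 0 := by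
    intro w
    rw [truncation_apply]
    simp [basisVec, lp.single_apply, Pi.single_apply]
  rw [h]
  split_ifs with hw
  · rw [h, if_pos hw]
  · simp

theorem norm_truncation_le (N : ℕ) : ‖truncation N‖ ≤ 1 :=
  norm_le_one_of_projection (star_truncation N) (truncation_mul_self N)

theorem tendsto_truncation (f : lp (fun _ : ℕ => ℂ) 2) :
    Tendsto (fun N => truncation N f) atTop (𝓝 f) := by
  simp_rw [truncation_apply]
  exact (hasSum_basisVec f).tendsto_sum_nat

/-- A closed linear subspace with all matrix units contains all compact operators. -/
theorem mem_of_isCompactOperator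
    {L : Submodule ℂ (lp (fun _ : ℕ => ℂ) 2 →L[ℂ] lp (fun _ : ℕ => ℂ) 2)}
    (hL : IsClosed (L : Set (lp (fun _ : ℕ => ℂ) 2 →L[ℂ] lp (fun _ : ℕ => ℂ) 2)))
    (hmem : ∀ z w, rankOne ℂ (basisVec z) (basisVec w) ∈ L)
    {T : lp (fun _ : ℕ => ℂ) 2 →L[ℂ] lp (fun _ : ℕ => ℂ) 2} (hT : IsCompactOperator T) :
    T ∈ L := by
  refine hL.mem_of_tendsto (tendsto_mul_mul_of_isCompactOperator norm_truncation_le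
    star_truncation tendsto_truncation hT) (Eventually.of_forall fun N => ?_)
  have e : truncation N * T * truncation N = ∑ z ∈ Finset.range N, ∑ w ∈ Finset.range N,
      (inner ℂ (basisVec z) (T (basisVec w))) • rankOne ℂ (basisVec z) (basisVec w) := by
    rw [truncation, Finset.sum_mul, Finset.sum_mul]
    refine Finset.sum_congr rfl fun z _ => ?_
    rw [Finset.mul_sum]
    refine Finset.sum_congr rfl fun w _ => ?_
    ext1 f
    simp only [mul_apply_eq_comp, rankOne_apply, _root_.smul_apply, map_smul, smul_smul]
    rw [mul_comm]
  rw [SetLike.mem_coe, e]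
  exact sum_mem fun z _ => sum_mem fun w _ => L.smul_mem _ (hmem z w)

end Truncation

/-! ### The Fock representation -/

section Fock

variable {n m : ℕ} {q : ℂ} (e : List (Fin n) × List (Fin m) ≃ ℕ) (hq : ‖q‖ = 1)

/-- The Fock representation, with the pairs of words enumerated by the natural numbers. -/
abbrev fockRep : E n m q →⋆ₐ[ℂ] (lp (fun _ : ℕ => ℂ) 2 →L[ℂ] lp (fun _ : ℕ => ℂ) 2) :=
  ((fockSystem n m).congr e).rep hq

theorem fockSystem_congr_σ (i : Fin n) (μ : List (Fin n)) (α : List (Fin m)) :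
    ((fockSystem n m).congr e).σ i (e (μ, α)) = e (i :: μ, α) := by
  simp [ShiftSystem.congr, fockSystem, ShiftSystem.prod]

theorem fockSystem_congr_τ (r : Fin m) (μ : List (Fin n)) (α : List (Fin m)) :
    ((fockSystem n m).congr e).τ r (e (μ, α)) = e (μ, r :: α) := by
  simp [ShiftSystem.congr, fockSystem, ShiftSystem.prod]

/-- In the Fock representation the product of the defect projections is the projection onto the
vacuum vector. -/
theorem fockRep_defect :
    fockRep e hq ((1 - E.Q n m q) * (1 - E.P n m q)) =
      InnerProductSpace.rankOne ℂ (basisVec (e ([], []))) (basisVec (e ([], []))) := by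
  refine ext_basisVec fun w => ?_
  obtain ⟨⟨μ, α⟩, rfl⟩ := e.surjective w
  rw [map_mul, mul_apply_eq_comp, InnerProductSpace.rankOne_apply, inner_basisVec]
  cases α with
  | cons r α =>
    have hne : (([], []) : List (Fin n) × List (Fin m)) ≠ (μ, r :: α) := by simp
    rw [← fockSystem_congr_τ, ShiftSystem.rep_P_basisVec_of_mem, map_zero, fockSystem_congr_τ]
    simp [basisVec, lp.single_apply]
  | nil =>
    rw [ShiftSystem.rep_P_basisVec_of_notMem _ hq fun r z hz => ?_]
    · cases μ with
      | cons i μ =>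
        rw [← fockSystem_congr_σ, ShiftSystem.rep_Q_basisVec_of_mem, fockSystem_congr_σ]
        simp [basisVec, lp.single_apply]
      | nil =>
        rw [ShiftSystem.rep_Q_basisVec_of_notMem _ hq fun i z hz => ?_]
        · simp [basisVec, lp.single_apply]
        · obtain ⟨⟨μ', α'⟩, rfl⟩ := e.surjective z
          rw [fockSystem_congr_σ] at hz
          simpa using e.injective hz
    · obtain ⟨⟨μ', α'⟩, rfl⟩ := e.surjective z
      rw [fockSystem_congr_τ] at hz
      simpa using e.injective hz

/-- The vacuum vector is cyclic: it is mapped to a multiple of each basis vector. -/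
theorem exists_fockRep_vacuum (z : ℕ) : ∃ (a : E n m q) (c : ℂ), c ≠ 0 ∧
    fockRep e hq a (basisVec (e ([], []))) = c • basisVec z := by
  obtain ⟨⟨μ, α⟩, rfl⟩ := e.surjective z
  induction α with
  | nil =>
    induction μ with
    | nil => exact ⟨1, 1, one_ne_zero, by simp⟩
    | cons i μ ih =>
      obtain ⟨a, c, hc, h⟩ := ih
      refine ⟨E.s n m q i * a, c, hc, ?_⟩
      rw [map_mul, mul_apply_eq_comp, h, map_smul, ShiftSystem.rep_s, ShiftSystem.opS_basisVec,
        fockSystem_congr_σ]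
  | cons r α ih =>
    obtain ⟨a, c, hc, h⟩ := ih
    refine ⟨E.t n m q r * a, c * q ^ ((fockSystem n m).congr e).d (e (μ, α)),
      mul_ne_zero hc (zpow_ne_zero _ (ShiftSystem.q_ne_zero hq)), ?_⟩
    rw [map_mul, mul_apply_eq_comp, h, map_smul, ShiftSystem.rep_t, ShiftSystem.opT_basisVec,
      fockSystem_congr_τ, smul_smul]

theorem fockRep_defect_ne_zero : fockRep e hq ((1 - E.Q n m q) * (1 - E.P n m q)) ≠ 0 := by
  rw [fockRep_defect]
  exact InnerProductSpace.rankOne_ne_zero (basisVec_ne_zero _) (basisVec_ne_zero _)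

/-- The Fock representation maps the ideal of the product of the defect projections to compact
operators. -/
theorem isCompactOperator_fockRep {x : E n m q} (hx : x ∈ idealI n m q) :
    IsCompactOperator (fockRep e hq x) := by
  let J : TwoSidedIdeal (E n m q) := TwoSidedIdeal.mk'
    {x | IsCompactOperator (fockRep e hq x)}
    (by simpa using isCompactOperator_zero)
    (fun {a b} ha hb => by simpa using! ha.add hb)
    (fun {a} ha => by simpa using! ha.neg)
    (fun {a b} hb => by simpa using! hb.clm_comp (fockRep e hq a))
    (fun {a b} ha => by simpa using! ha.comp_clm (fockRep e hq b))
  have hJ : (J : Set (E n m q)) = {x | IsCompactOperator (fockRep e hq x)} :=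
    TwoSidedIdeal.coe_mk' ..
  have hle : idealI n m q ≤ J := by
    refine closedIdeal_le ?_ ?_
    · rw [hJ]
      exact isClosed_setOfPred_isCompactOperator.preimage (continuous_starAlgHom (fockRep e hq))
    · rw [hJ, Set.singleton_subset_iff]
      change IsCompactOperator (fockRep e hq ((1 - E.Q n m q) * (1 - E.P n m q)))
      rw [fockRep_defect]
      exact isCompactOperator_rankOne _ _
  have : x ∈ (J : Set (E n m q)) := hle hx
  rwa [hJ] at this

/-- If the Fock representation is faithful, every compact operator is the image of an element of
the ideal of the product of the defect projections. -/
theorem exists_fockRep_eq (hinj : Function.Injective (fockRep (q := q) e hq))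
    {T : lp (fun _ : ℕ => ℂ) 2 →L[ℂ] lp (fun _ : ℕ => ℂ) 2} (hT : IsCompactOperator T) :
    ∃ x ∈ idealI n m q, fockRep e hq x = T := by
  let I : Submodule ℂ (E n m q) :=
    { carrier := idealI n m q
      add_mem' := TwoSidedIdeal.add_mem _
      zero_mem' := TwoSidedIdeal.zero_mem _
      smul_mem' := fun c x hx => smul_mem_ideal _ c hx }
  let π : E n m q →ₗ[ℂ] lp (fun _ : ℕ => ℂ) 2 →L[ℂ] lp (fun _ : ℕ => ℂ) 2 :=
    (fockRep e hq).toAlgHom.toLinearMap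
  have hcl : IsClosed (I.map π : Set (lp (fun _ : ℕ => ℂ) 2 →L[ℂ] lp (fun _ : ℕ => ℂ) 2)) := by
    have hiso := NonUnitalStarAlgHom.isometry (fockRep e hq) hinj
    exact hiso.isClosedEmbedding.isClosedMap _ (isClosed_closedIdeal _)
  have := mem_of_isCompactOperator hcl (fun z w => ?_) hT
  · obtain ⟨x, hx, rfl⟩ := this
    exact ⟨x, hx, rfl⟩
  · obtain ⟨a, c, hc, ha⟩ := exists_fockRep_vacuum e hq z
    obtain ⟨b, d, hd, hb⟩ := exists_fockRep_vacuum e hq w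
    refine ⟨(c * star d)⁻¹ • (a * ((1 - E.Q n m q) * (1 - E.P n m q)) * star b), ?_, ?_⟩
    · exact I.smul_mem _ (TwoSidedIdeal.mul_mem_right _ _ _ (TwoSidedIdeal.mul_mem_left _ _ _
        (mem_closedIdeal_singleton _)))
    · have h0 : c * star d ≠ 0 := mul_ne_zero hc (by simpa using hd)
      change fockRep e hq ((c * star d)⁻¹ • _) = _
      rw [map_smul, map_mul, map_mul, fockRep_defect, map_star, inv_smul_eq_iff₀ h0]
      ext1 f
      rw [mul_apply_eq_comp, mul_apply_eq_comp, InnerProductSpace.rankOne_apply, map_smul, ha,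
        _root_.smul_apply, InnerProductSpace.rankOne_apply, ContinuousLinearMap.star_eq_adjoint,
        ContinuousLinearMap.adjoint_inner_right, hb, inner_smul_left, smul_smul, smul_smul]
      congr 1
      change star d * _ * c = c * star d * _
      ring

end Fock

/-! ### The ideals of the universal algebra -/

section Universal

variable {n m : ℕ} {q : ℂ}

theorem idealI_eq : idealI n m q =
    closedIdeal {(1 - rangeProj (E.s n m q) 1) * (1 - rangeProj (E.t n m q) 1)} := by
  rw [idealI, E.Q_eq, E.P_eq]

theorem idealI₁_eq : idealI₁ n m q = closedIdeal {1 - rangeProj (E.s n m q) 1} := by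
  rw [idealI₁, E.Q_eq]

theorem idealI₂_eq : idealI₂ n m q = closedIdeal {1 - rangeProj (E.t n m q) 1} := by
  rw [idealI₂, E.P_eq]

theorem idealM_eq : idealM n m q =
    closedIdeal {1 - rangeProj (E.s n m q) 1, 1 - rangeProj (E.t n m q) 1} := by
  rw [idealM, E.Q_eq, E.P_eq]

theorem mem_idealI_iff (hq : ‖q‖ = 1) {x : E n m q} :
    x ∈ idealI n m q ↔ x ∈ idealI₁ n m q ∧ x ∈ idealI₂ n m q := by
  rw [idealI_eq, idealI₁_eq, idealI₂_eq]
  exact mem_closedIdeal_mul_defect_iff E.relations hq E.isGenerated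

theorem idealM_eq_sup (hq : ‖q‖ = 1) : idealM n m q = idealI₁ n m q ⊔ idealI₂ n m q := by
  rw [idealM_eq, idealI₁_eq, idealI₂_eq]
  exact closedIdeal_pair_defect E.relations hq E.isGenerated

theorem closed_cases (hn : 2 ≤ n) (hm : 2 ≤ m) (hq : ‖q‖ = 1) {J : TwoSidedIdeal (E n m q)}
    (hJ : IsClosed (J : Set (E n m q))) : J = ⊥ ∨ J = idealI n m q ∨ J = idealI₁ n m q ∨
      J = idealI₂ n m q ∨ J = idealM n m q ∨ J = ⊤ := by
  rw [idealI_eq, idealI₁_eq, idealI₂_eq, idealM_eq]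
  exact closed_ideal_cases E.relations hq E.isGenerated E.isGauge hn hm hJ

theorem idealI_le_idealI₁ (hq : ‖q‖ = 1) : idealI n m q ≤ idealI₁ n m q :=
  fun _ hx => ((mem_idealI_iff hq).1 hx).1

theorem idealI_le_idealI₂ (hq : ‖q‖ = 1) : idealI n m q ≤ idealI₂ n m q :=
  fun _ hx => ((mem_idealI_iff hq).1 hx).2

theorem idealI_le_of_ne_bot (hn : 2 ≤ n) (hm : 2 ≤ m) (hq : ‖q‖ = 1)
    {J : TwoSidedIdeal (E n m q)} (hJ : IsClosed (J : Set (E n m q))) (h0 : J ≠ ⊥) :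
    idealI n m q ≤ J := by
  rcases closed_cases hn hm hq hJ with h | h | h | h | h | h
  · exact absurd h h0
  · exact h.ge
  · rw [h]; exact idealI_le_idealI₁ hq
  · rw [h]; exact idealI_le_idealI₂ hq
  · rw [h, idealM_eq_sup hq]; exact (idealI_le_idealI₁ hq).trans le_sup_left
  · rw [h]; exact le_top

theorem exists_equiv_nat (hn : 2 ≤ n) : Nonempty (List (Fin n) × List (Fin m) ≃ ℕ) := by
  have : NeZero n := ⟨by omega⟩
  exact nonempty_equiv_of_countable

theorem idealI_ne_bot (hn : 2 ≤ n) (hq : ‖q‖ = 1) : idealI n m q ≠ ⊥ := by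
  obtain ⟨e⟩ := exists_equiv_nat (n := n) (m := m) hn
  intro h
  have h1 : (1 - E.Q n m q) * (1 - E.P n m q) ∈ idealI n m q := mem_closedIdeal_singleton _
  rw [h, TwoSidedIdeal.mem_bot] at h1
  exact fockRep_defect_ne_zero e hq (by rw [h1, map_zero])

/-- The Fock representation is faithful: its kernel does not contain the product of the defect
projections, hence it is zero. -/
theorem fockRep_injective (hn : 2 ≤ n) (hm : 2 ≤ m) (hq : ‖q‖ = 1)
    (e : List (Fin n) × List (Fin m) ≃ ℕ) : Function.Injective (fockRep (q := q) e hq) := by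
  rw [← TwoSidedIdeal.ker_eq_bot]
  by_contra h0
  have hcl : IsClosed (TwoSidedIdeal.ker (fockRep (q := q) e hq) : Set (E n m q)) := by
    have : (TwoSidedIdeal.ker (fockRep (q := q) e hq) : Set (E n m q)) =
        fockRep e hq ⁻¹' {0} := by
      ext x; exact TwoSidedIdeal.mem_ker _
    rw [this]
    exact isClosed_singleton.preimage (continuous_starAlgHom _)
  have := idealI_le_of_ne_bot hn hm hq hcl h0 (mem_closedIdeal_singleton _)
  exact fockRep_defect_ne_zero e hq ((TwoSidedIdeal.mem_ker _).1 this)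

/-- The compact operators are embedded into the universal algebra by the inverse of the Fock
representation, with range the ideal of the product of the defect projections. -/
theorem exists_compactOperators_hom (hn : 2 ≤ n) (hm : 2 ≤ m) (hq : ‖q‖ = 1) :
    ∃ φ : compactOperators (lp (fun _ : ℕ => ℂ) 2) →⋆ₙₐ[ℂ] E n m q,
      Function.Injective φ ∧ Set.range φ = (idealI n m q : Set (E n m q)) := by
  obtain ⟨e⟩ := exists_equiv_nat (n := n) (m := m) hn
  have hinj := fockRep_injective hn hm hq e
  have hex : ∀ T : compactOperators (lp (fun _ : ℕ => ℂ) 2),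
      ∃ x ∈ idealI n m q, fockRep e hq x = T := fun T => exists_fockRep_eq e hq hinj T.2
  choose φ hφ hφ' using hex
  refine ⟨{ toFun := φ
            map_smul' := fun c T => hinj ?_
            map_zero' := hinj ?_
            map_add' := fun S T => hinj ?_
            map_mul' := fun S T => hinj ?_
            map_star' := fun T => hinj ?_ }, fun S T h => ?_, ?_⟩
  · rw [hφ']
    change _ = fockRep e hq (c • φ T)
    rw [map_smul, hφ']; rfl
  · rw [hφ', map_zero]; rfl
  · rw [hφ', map_add, hφ', hφ']; rfl
  · rw [hφ', map_mul, hφ', hφ']; rfl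
  · rw [hφ', map_star, hφ']; rfl
  · have h' : φ S = φ T := h
    exact Subtype.ext (by rw [← hφ', ← hφ', h'])
  · ext x
    constructor
    · rintro ⟨T, rfl⟩
      exact hφ T
    · intro hx
      exact ⟨⟨fockRep e hq x, isCompactOperator_fockRep e hq hx⟩, hinj (hφ' _)⟩

end Universal

end TwistedCuntz

end

open TwistedCuntz in
theorem mainTheorem4 (n m : ℕ) (hn : 2 ≤ n) (hm : 2 ≤ m) (q : ℂ) (hq : ‖q‖ = 1) :
    (∀ J : TwoSidedIdeal (E n m q), IsNontrivialClosedIdeal J ↔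
      J = idealI n m q ∨ J = idealI₁ n m q ∨ J = idealI₂ n m q ∨ J = idealM n m q) ∧
    [idealI n m q, idealI₁ n m q, idealI₂ n m q, idealM n m q].Nodup ∧
    (idealM n m q : Set (E n m q)) = (idealI₁ n m q : Set (E n m q)) + idealI₂ n m q ∧
    (∀ J : TwoSidedIdeal (E n m q), IsNontrivialClosedIdeal J → IsEssential J) ∧
    (∃ φ : compactOperators (lp (fun _ : ℕ => ℂ) 2) →⋆ₙₐ[ℂ] E n m q,
      Function.Injective φ ∧ Set.range φ = (idealI n m q : Set (E n m q))) ∧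
    (∀ J : TwoSidedIdeal (E n m q), IsMinimalClosedIdeal J ↔ J = idealI n m q) := by
  have : NeZero n := ⟨by omega⟩
  have : NeZero m := ⟨by omega⟩
  have hI0 : idealI n m q ≠ ⊥ := idealI_ne_bot hn hq
  have hI1 := idealI_le_idealI₁ (n := n) (m := m) hq
  have hI2 := idealI_le_idealI₂ (n := n) (m := m) hq
  have hM := idealM_eq_sup (n := n) (m := m) hq
  have h1M : idealI₁ n m q ≤ idealM n m q := hM ▸ le_sup_left
  have h2M : idealI₂ n m q ≤ idealM n m q := hM ▸ le_sup_right
  have hMtop : idealM n m q ≠ ⊤ := fun h => one_notMem_idealM hq ((TwoSidedIdeal.one_mem_iff _).2 h)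
  have hQ1 : 1 - E.Q n m q ∈ idealI₁ n m q := mem_closedIdeal_singleton _
  have hP2 : 1 - E.P n m q ∈ idealI₂ n m q := mem_closedIdeal_singleton _
  have hQ2 := one_sub_Q_notMem_idealI₂ (n := n) (m := m) hq
  have hP1 := one_sub_P_notMem_idealI₁ (n := n) (m := m) hq
  have hnt : ∀ J : TwoSidedIdeal (E n m q), IsClosed (J : Set (E n m q)) → idealI n m q ≤ J →
      J ≤ idealM n m q → IsNontrivialClosedIdeal J := fun J hJ hl hu =>
    ⟨hJ, fun h => hI0 (le_bot_iff.1 (h ▸ hl)), fun h => hMtop (top_le_iff.1 (h ▸ hu))⟩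
  refine ⟨fun J => ⟨fun hJ => ?_, ?_⟩, ?_, ?_, fun J hJ K hK hK0 h => ?_,
    exists_compactOperators_hom hn hm hq, fun J => ⟨fun hJ => ?_, ?_⟩⟩
  · rcases closed_cases hn hm hq hJ.isClosed with h | h | h | h | h | h
    · exact absurd h hJ.ne_bot
    · exact Or.inl h
    · exact Or.inr (Or.inl h)
    · exact Or.inr (Or.inr (Or.inl h))
    · exact Or.inr (Or.inr (Or.inr h))
    · exact absurd h hJ.ne_top
  · rintro (rfl | rfl | rfl | rfl)
    · exact hnt _ (isClosed_closedIdeal _) le_rfl (hI1.trans h1M)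
    · exact hnt _ (isClosed_closedIdeal _) hI1 h1M
    · exact hnt _ (isClosed_closedIdeal _) hI2 h2M
    · exact hnt _ (isClosed_closedIdeal _) (hI1.trans h1M) le_rfl
  · have hI1' : idealI n m q ≠ idealI₁ n m q := fun h => hQ2 (hI2 (h ▸ hQ1))
    have hI2' : idealI n m q ≠ idealI₂ n m q := fun h => hP1 (hI1 (h ▸ hP2))
    have hIM : idealI n m q ≠ idealM n m q := fun h => hQ2 (hI2 (h ▸ h1M hQ1))
    have h12 : idealI₁ n m q ≠ idealI₂ n m q := fun h => hQ2 (h ▸ hQ1)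
    have h1M' : idealI₁ n m q ≠ idealM n m q := fun h => hP1 (h ▸ h2M hP2)
    have h2M' : idealI₂ n m q ≠ idealM n m q := fun h => hQ2 (h ▸ h1M hQ1)
    simp [hI1', hI2', hIM, h12, h1M', h2M']
  · ext x
    rw [hM, SetLike.mem_coe, TwoSidedIdeal.mem_sup, Set.mem_add]
    rfl
  · have := le_inf (idealI_le_of_ne_bot hn hm hq hJ.isClosed hJ.ne_bot)
      (idealI_le_of_ne_bot hn hm hq hK hK0)
    exact hI0 (le_bot_iff.1 (h ▸ this))
  · exact le_antisymm (hJ.2 ⟨isClosed_closedIdeal _, hI0⟩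
      (idealI_le_of_ne_bot hn hm hq hJ.1.1 hJ.1.2))
      (idealI_le_of_ne_bot hn hm hq hJ.1.1 hJ.1.2)
  · rintro rfl
    exact ⟨⟨isClosed_closedIdeal _, hI0⟩, fun K hK _ =>
      idealI_le_of_ne_bot hn hm hq hK.1 hK.2⟩
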